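/- **Setting.** Let $d\ge 1$. Consider $$\min_{x\in\mathbb R^d} F(x):=f(x)+h(x)\quad\text{s.t.}\quad Ax=b,\ \ g(x)=(g_1(x),\dots,g_m(x))\le 0, \tag{P}$$ with $A\in\mathbb R^{n\times d}$, $b\in\mathbb R^n$, $\mathcal X:=\operatorname{dom}F=\operatorname{dom}h$. Norms of vectors are Euclidean, norms of matrices are spectral, $\|\cdot\|_F$ is the Frobenius norm, $[\cdot]_+$ is the componentwise positive part, $\operatorname{dist}(0,\emptyset)=+\infty$, and $\operatorname{bd}$ is the boundary. For a convex function $\phi$ with domain $\mathcal X$, $\partial\phi(x)=\{\xi:\phi(x')\ge\phi(x)+\langle\xi,x'-x\rangle\ \forall x'\in\mathcal X\}$; moreover $\partial F(x):=\partial\big(F+\tfrac\rho2\|\cdot\|^2\big)(x)-\rho x$. Assume: 1. $\mathcal X$ is compact with diameter $D$, $h$ is closed and convex, $F$ is continuous on $\mathcal X$, and $f$ is $\rho$-weakly convex on $\mathcal X$ for some $\rho>0$ (that is, $f+\frac\rho2\|\cdot\|^2$ is convex there). 2. Each $g_i:\mathbb R^d\to\mathbb R$ is convex, and on an open set containing $\mathcal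 X$ it is differentiable with $L_g$-Lipschitz gradient; $B_g>0$ is a constant with $|g_i(x)|\le B_g$, $\|\nabla g_i(x)\|\le B_g$ and $|g_i(x)-g_i(x')|\le B_g\|x-x'\|$ for all $x,x'\in\mathcal X$ and all $i$. 3. There is $x_{\rm feas}\in\operatorname{int}\mathcal X$ with $Ax_{\rm feas}=b$ and $g_{\min}:=\min_i(-g_i(x_{\rm feas}))>0$. 4. For some $r_h>0$ and every $x\in\mathcal X$: $\emptyset\ne\partial h(x)\subseteq\mathcal N_{\mathcal X}(x)+\{u:\|u\|\le r_h\}$, where $\mathcal N_{\mathcal X}$ is the normal cone. 5. $f=l\circ c$, where $c:\mathbb R^d\to\mathbb R^p$ is differentiable with $\|J_c(x)-J_c(x')\|_F\le L_c\|x-x'\|$ for all $x,x'$, and $l:\mathbb R^p\to\mathbb R$ is convex and $M_l$-Lipschitz with $M_l>0$. The constant $\rho$ satisfies $\rho\ge M_lL_c$. A point $x\in\mathcal X$ is an *$\varepsilon$-KKT point* if there are $y\in\mathbb R^n$, $z\in\mathbb R^m_+$ with $\operatorname{dist}(0,\partial F(x)+J_g(x)^\top z+A^\top y)\le\varepsilon$,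 $\sqrt{\|Ax-b\|^2+\|[g(x)]_+\|^2}\le\varepsilon$ and $\sum_i|z_ig_i(x)|\le\varepsilon$. A point is a *near $\varepsilon$-KKT point* if it is within distance $\varepsilon$ of an $\varepsilon$-KKT point. **Algorithm (DPALM).** Let $x^0\in\mathcal X$, $y^0\in\operatorname{Range}(A)$, $z^0\ge0$, $\beta_0,v_0>0$, and for $k\ge1$ let $\beta_k=\beta_0\sqrt{k+1}$, $v_k=v_0/(\sqrt{k+1}\,\log^2(k+1))$. Given $(x^k,y^k,z^k)$, put, with $l^\nu(u)=\min_z\{l(z)+\frac1{2\nu}\|z-u\|^2\}$, $$\hat f^k(x)=l^{\nu}\big(c(x^k)+J_c(x^k)(x-x^k)\big)+\langle y^k,Ax-b\rangle+\tfrac{\beta_k}2\|Ax-b\|^2+\tfrac{\beta_k}2\big\|[g(x)+\tfrac{z^k}{\beta_k}]_+\big\|^2-\tfrac{\|z^k\|^2}{2\beta_k},$$ $$\hat h^k(x)=h(x)+\tfrac\rho2\|x-x^k\|^2 .$$ Compute $x^{k+1}$ with $\operatorname{dist}(0,\partial(\hat f^k+\hat h^k)(x^{k+1}))\le\varepsilon_k$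 by Nesterov's accelerated proximal gradient method (APG, below) applied to $\min(\hat f^k+\hat h^k)$. Then set $$y^{k+1}=y^k+\alpha_k(Ax^{k+1}-b),\quad z^{k+1}=z^k+\alpha_k\max\{-z^k/\beta_k,\,g(x^{k+1})\},\quad \alpha_k=\min\Big\{\beta_k,\tfrac{v_k}{\sqrt{\|Ax^{k+1}-b\|^2+\|[g(x^{k+1})]_+\|^2}}\Big\},$$ where $v/0=+\infty$. *APG* for $\min\phi=\tilde f+\tilde h$, $\tilde h$ being $\mu$-strongly convex (here $\mu=\rho$), with parameters $\gamma_u=2$, $\gamma_d\ge2$, any starting point $w\in\mathcal X$, and a starting value $L_0$ with $0<L_0\le L_{\hat f^k}$ (defined below): put $u^0=v^0=w$, $A_0=0$, $L=L_0$. Iteration $t\ge0$: for the current $L$ let $a>0$ solve $\frac{a^2}{A_t+a}=\frac{2(1+\mu A_t)}{L}$, put $\bar y=\frac{A_tu^t+av^t}{A_t+a}$, $M=\operatorname{prox}_{\tilde h/L}(\bar y-\frac1L\nabla\tilde f(\bar y))$ and $\phi'=L(\bar y-M)+\nabla\tilde f(M)-\nabla\tilde f(\bar y)$; as long as $\langle\phi',\bar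 y-M\rangle<\frac1L\|\phi'\|^2$, replace $L$ by $\gamma_uL$ and recompute. Then $u^{t+1}=M$, $a_{t+1}=a$, $A_{t+1}=A_t+a$, $v^{t+1}=\operatorname{prox}_{A_{t+1}\tilde h}\big(w-\sum_{i=1}^{t+1}a_i\nabla\tilde f(u^i)\big)$, and $L$ is replaced by $L/\gamma_d$; stop with output $u^{t+1}$ as soon as $\operatorname{dist}(0,\partial\phi(u^{t+1}))\le\varepsilon_k$. One such iteration $u^t\to u^{t+1}$ counts as one *proximal-gradient step*. **Constants.** Let $\lambda^+_{\min}$ be the smallest positive eigenvalue, $\dagger$ the Moore–Penrose inverse, and let $\lambda_{\min}^+(AA^\top)=+\infty$ if $A=0$, $g_{\min}=+\infty$ if $m=0$ (with $\frac1{+\infty}=0$). Put $\delta:=\operatorname{dist}(x_{\rm feas},\operatorname{bd}\mathcal X)$ and $$\|\nabla c\|:=\|J_c(x_{\rm feas})\|_F+L_cD,\quad B_f:=M_l\|\nabla c\|,\quad \tau:=\min\Big\{\frac{g_{\min}}{2\sqrt mB_g},\delta\Big\},$$ $$\theta:=\frac{D(r_h+B_f)+2\rho D^2+D+\tau(1+r_h+B_f+2\rho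 D)}{\min\{\tau\sqrt{\lambda^+_{\min}(AA^\top)},\,g_{\min}/2\}},\quad B_p:=\max\{\|(y^0,z^0)\|,\theta\},$$ $$Q:=D(B_f+2\rho D+r_h),\quad C_1:=\frac1D+\frac1\delta+\frac{B_g}{g_{\min}},\quad C_p:=2\Big[2\Big(B_p+\sqrt{\tfrac{Q^2}{g_{\min}^2}+Q^2\|(AA^\top)^\dagger A\|^2C_1^2}\Big)+1\Big],$$ $$C_x:=2\max_{\mathcal X}|F|+\frac{14C_p^2+8B_pC_p+7B_p^2}{4\beta_0}+(10C_p+4B_p)\frac{v_0}{\beta_0}+\frac{\beta_0}2\Big(\|Ax^0-b\|^2+\big\|[g(x^0)+\tfrac{z^0}{\beta_0}]_+\big\|^2\Big)+|\langle y^0,Ax^0-b\rangle|,$$ $$C_5:=\max\Big\{\frac{4C_p^2}{\beta_0^2},\frac{4(B_p^2+\frac52C_p^2)^2}{\beta_0^2}\Big\},\qquad C_2:=\|A^\top A\|+mB_g(B_g+L_g),$$ $$C_4:=\max\Big\{\tfrac32,\ \tfrac3{2\rho}\sqrt{\|A\|^2+mB_g^2},\ \tfrac{4B_g}{\rho}\sqrt{m\beta_0\sqrt{C_5}},\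 \tfrac{64}{\rho^2}mB_g^2\beta_0\sqrt{\rho C_x},\ \tfrac{8B_g}{\rho}\sqrt{m\beta_0},\ \tfrac3{4\rho}\Big\},$$ $$\nu:=\min\Big\{1,\frac{\varepsilon^2}{64C_4^2\rho M_l^2}\Big\},\quad \varepsilon_k:=\min\Big\{\frac{\varepsilon}{16C_4},\sqrt{\tfrac{\rho}{2\beta_k}},1\Big\},\quad C_6:=\frac{\|\nabla c\|^2}{\nu}+\sqrt mL_gB_p,$$ $$L_{\hat f^k}:=C_6+\sqrt{k+1}\,\beta_0C_2,\qquad K:=\lceil C_5\varepsilon^{-2}\rceil+\lceil64\rho C_xC_4^2\varepsilon^{-2}\rceil .$$ **Theorem (Total complexity result II).** For every $\varepsilon>0$, and for all choices of the APG parameters $\gamma_d$, of the starting values $L_0$ and of the starting points as above (they may differ from one subproblem to the next), DPALM is well defined: in particular, APG stops after finitely many steps on each subproblem. Some $x^k$ with $k\le K$ is a near $\varepsilon$-KKT point of (P), and the total number $T_2^{\rm total}$ of proximal-gradient steps spent in the first $K$ outer iterations satisfies $$T_2^{\rm total}\le 2K+K\left(2\sqrt{\frac{C_6}\rho}+2\sqrt{\frac{\sqrt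 K\beta_0C_2}\rho}+\frac1{\log2}\right)\max\left\{0,\ \log\left(9\,\varepsilon_K^{-1}D\sqrt{\tfrac1\rho}\,\big(C_6+\sqrt K\beta_0C_2\big)^{3/2}\right)\right\}.$$ For a fixed problem and fixed $x^0,y^0,z^0,\beta_0,v_0$, the right-hand side is $O(\varepsilon^{-3}\log(1/\varepsilon))$ as $\varepsilon\to0^+$; thus $T_2^{\rm total}=\widetilde O(\varepsilon^{-3})$. -/

import Mathlib

open Filter Topology
open scoped ENNReal Pointwise Matrix.Norms.L2Operator

noncomputable section

namespace DPALM

/-- `ℝᵈ` with the Euclidean norm. -/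
abbrev Vec (d : ℕ) : Type := EuclideanSpace ℝ (Fin d)

/-! ### Convex analysis

An extended-valued function with domain `X` is represented by the pair of the set `X` and a
real-valued function, of which only the values on `X` matter (the value is `+∞` off `X`). -/

section ConvexAnalysis

variable {d : ℕ}

/-- The subdifferential at `x` of the convex function `φ` with domain `X`. -/
def subdiff (X : Set (Vec d)) (φ : Vec d → ℝ) (x : Vec d) : Set (Vec d) :=
  {ξ | x ∈ X ∧ ∀ x' ∈ X, inner ℝ ξ (x' - x) ≤ φ x' - φ x}

/-- The subdifferential at `x` of the `ρ`-weakly convex function `φ` with domain `X`, i.e.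
`∂(φ + (ρ/2)‖·‖²)(x) - ρ x`. -/
def weakSubdiff (X : Set (Vec d)) (ρ : ℝ) (φ : Vec d → ℝ) (x : Vec d) : Set (Vec d) :=
  {ξ | ξ + ρ • x ∈ subdiff X (fun u => φ u + ρ / 2 * ‖u‖ ^ 2) x}

/-- The normal cone of `X` at `x`. -/
def normalCone (X : Set (Vec d)) (x : Vec d) : Set (Vec d) :=
  {ξ | ∀ x' ∈ X, inner ℝ ξ (x' - x) ≤ 0}

/-- `x = prox_{t φ}(w) = argmin_z { φ(z) + ‖z - w‖² / (2 t) }`, where `φ` has domain `X`. -/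
def IsProx (X : Set (Vec d)) (t : ℝ) (φ : Vec d → ℝ) (w x : Vec d) : Prop :=
  x ∈ X ∧ ∀ z ∈ X, φ x + 1 / (2 * t) * ‖x - w‖ ^ 2 ≤ φ z + 1 / (2 * t) * ‖z - w‖ ^ 2

/-- The Moreau envelope of `φ : ℝᵖ → ℝ` with parameter `ν`. -/
def moreau (ν : ℝ) (φ : Vec d → ℝ) (u : Vec d) : ℝ :=
  ⨅ z : Vec d, (φ z + 1 / (2 * ν) * ‖z - u‖ ^ 2)

/-- The distance of `0` to `S` is at most `r` (the distance to the empty set is `+∞`). -/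
def DistZeroLE (S : Set (Vec d)) (r : ℝ) : Prop :=
  Metric.infEDist (0 : Vec d) S ≤ ENNReal.ofReal r

end ConvexAnalysis

/-! ### Matrices -/

/-- The smallest positive eigenvalue of `M` (`+∞` if there is none). -/
def lamMinPos {n : ℕ} (M : Matrix (Fin n) (Fin n) ℝ) : ℝ≥0∞ :=
  ⨅ (μ : ℝ) (_ : 0 < μ ∧ Module.End.HasEigenvalue (Matrix.toLin' M) μ), ENNReal.ofReal μ

/-- `A Aᵀ` is symmetric. -/
theorem isHermitian_mul_transpose {n d : ℕ} (A : Matrix (Fin n) (Fin d) ℝ) :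
    (A * A.transpose).IsHermitian := by
  simpa [Matrix.conjTranspose_eq_transpose_of_trivial] using
    Matrix.isHermitian_mul_conjTranspose_self A

/-- The Moore-Penrose inverse of a symmetric matrix `M = U diag(λ) Uᵀ`, that is
`U diag(λ⁺) Uᵀ`, where `λ⁺ = 1/λ` for `λ ≠ 0` and `0⁺ = 0`. -/
def pinv {n : ℕ} {M : Matrix (Fin n) (Fin n) ℝ} (hM : M.IsHermitian) :
    Matrix (Fin n) (Fin n) ℝ :=
  (hM.eigenvectorUnitary : Matrix (Fin n) (Fin n) ℝ) *
    Matrix.diagonal (fun i => (hM.eigenvalues i)⁻¹) *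
    star (hM.eigenvectorUnitary : Matrix (Fin n) (Fin n) ℝ)

/-- The Frobenius norm of the Jacobian matrix given by the linear map `T`. -/
def frobNorm {d p : ℕ} (T : Vec d →L[ℝ] Vec p) : ℝ :=
  Real.sqrt (∑ i : Fin p, ∑ j : Fin d, (T (EuclideanSpace.single j 1) i) ^ 2)

/-! ### The problem and the constants -/

/-- The data of the problem `min f(x) + h(x)  s.t.  A x = b, g(x) ≤ 0`, with `f = l ∘ c` and with
`dom h = X`, together with the constants named in the assumptions, the starting point, and the
parameters of the algorithm.  (Data only: the hypotheses are in `Setting.Assumptions`.) -/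
structure Setting (d n m p : ℕ) where
  /-- the domain of the objective -/
  X : Set (Vec d)
  /-- the convex regularizer (equal to `+∞` off `X`) -/
  h : Vec d → ℝ
  /-- the outer convex function -/
  l : Vec p → ℝ
  /-- the inner smooth mapping -/
  c : Vec d → Vec p
  A : Matrix (Fin n) (Fin d) ℝ
  b : Vec n
  g : Fin m → Vec d → ℝ
  /-- the weak convexity constant, which is also the proximal parameter of the algorithm -/
  ρ : ℝ
  /-- Lipschitz constant of the gradients of the `gᵢ` -/
  Lg : ℝ
  /-- bound of `|gᵢ|` and of `‖∇gᵢ‖` on `X` -/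
  Bg : ℝ
  rh : ℝ
  /-- Lipschitz constant of `l` -/
  Ml : ℝ
  /-- Lipschitz constant of the Jacobian of `c` -/
  Lc : ℝ
  /-- the Slater point -/
  xfeas : Vec d
  x0 : Vec d
  y0 : Vec n
  z0 : Vec m
  β0 : ℝ
  v0 : ℝ

namespace Setting

variable {d n m p : ℕ} (S : Setting d n m p)

/-- `A x`. -/
def Amul (x : Vec d) : Vec n := Matrix.toEuclideanLin S.A x

/-- `Aᵀ y`. -/
def ATmul (y : Vec n) : Vec d := Matrix.toEuclideanLin S.A.transpose y

/-- `f = l ∘ c`. -/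
def f (x : Vec d) : ℝ := S.l (S.c x)

/-- The objective `F = f + h` (with domain `X`). -/
def F (x : Vec d) : ℝ := S.f x + S.h x

/-- The hypotheses on the problem, on the constants and on the initialization. -/
structure Assumptions : Prop where
  d_pos : 0 < d
  -- the objective
  X_compact : IsCompact S.X
  h_convex : ConvexOn ℝ S.X S.h
  F_continuous : ContinuousOn S.F S.X
  ρ_pos : 0 < S.ρ
  f_weaklyConvex : ConvexOn ℝ S.X (fun x => S.f x + S.ρ / 2 * ‖x‖ ^ 2)
  -- the nonlinear constraints
  g_convex : ∀ i, ConvexOn ℝ Set.univ (S.g i)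
  g_smooth : ∃ U : Set (Vec d), IsOpen U ∧ S.X ⊆ U ∧ ∀ i,
    (∀ x ∈ U, DifferentiableAt ℝ (S.g i) x) ∧
    ∀ x ∈ U, ∀ x' ∈ U, ‖gradient (S.g i) x - gradient (S.g i) x'‖ ≤ S.Lg * ‖x - x'‖
  Bg_pos : 0 < S.Bg
  Bg_bound : ∀ i, ∀ x ∈ S.X, |S.g i x| ≤ S.Bg ∧ ‖gradient (S.g i) x‖ ≤ S.Bg ∧
    ∀ x' ∈ S.X, |S.g i x - S.g i x'| ≤ S.Bg * ‖x - x'‖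
  -- Slater's condition
  xfeas_mem : S.xfeas ∈ interior S.X
  xfeas_eq : S.Amul S.xfeas = S.b
  xfeas_lt : ∀ i, S.g i S.xfeas < 0
  -- the subgradients of the regularizer
  rh_pos : 0 < S.rh
  h_subdiff : ∀ x ∈ S.X, (subdiff S.X S.h x).Nonempty ∧
    subdiff S.X S.h x ⊆ normalCone S.X x + Metric.closedBall 0 S.rh
  -- the compositional form
  c_differentiable : Differentiable ℝ S.c
  c_smooth : ∀ x x', frobNorm (fderiv ℝ S.c x - fderiv ℝ S.c x') ≤ S.Lc * ‖x - x'‖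
  l_convex : ConvexOn ℝ Set.univ S.l
  Ml_pos : 0 < S.Ml
  l_lipschitz : ∀ u u', |S.l u - S.l u'| ≤ S.Ml * ‖u - u'‖
  ρ_ge : S.Ml * S.Lc ≤ S.ρ
  -- the initialization
  x0_mem : S.x0 ∈ S.X
  y0_mem : ∃ w, S.y0 = S.Amul w
  z0_nonneg : ∀ i, 0 ≤ S.z0 i
  β0_pos : 0 < S.β0
  v0_pos : 0 < S.v0

/-! #### Approximate KKT points -/

/-- `‖A x - b‖² + ‖[g(x)]₊‖²`. -/
def infeasSq (x : Vec d) : ℝ :=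
  ‖S.Amul x - S.b‖ ^ 2 + ∑ i, (max (S.g i x) 0) ^ 2

/-- `x` is an `ε`-KKT point. -/
def IsKKT (ε : ℝ) (x : Vec d) : Prop :=
  x ∈ S.X ∧ ∃ (y : Vec n) (z : Vec m), (∀ i, 0 ≤ z i) ∧
    DistZeroLE
      ((fun ξ => ξ + ∑ i, z i • gradient (S.g i) x + S.ATmul y) '' weakSubdiff S.X S.ρ S.F x) ε ∧
    Real.sqrt (S.infeasSq x) ≤ ε ∧
    ∑ i, |z i * S.g i x| ≤ ε

/-- `x` is a near `ε`-KKT point. -/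
def IsNearKKT (ε : ℝ) (x : Vec d) : Prop :=
  ∃ x', S.IsKKT ε x' ∧ ‖x - x'‖ ≤ ε

/-! #### Parameters of the algorithm -/

/-- The penalty parameters `β_k = β₀ √(k+1)`. -/
def β (k : ℕ) : ℝ := S.β0 * Real.sqrt (k + 1)

/-- `v_0 = v₀` and `v_k = v₀ / (√(k+1) log²(k+1))` for `k ≥ 1`. -/
def v (k : ℕ) : ℝ :=
  if k = 0 then S.v0 else S.v0 / (Real.sqrt (k + 1) * Real.log (k + 1) ^ 2)

/-- The dual stepsize `α_k = min {β_k, v_k / √(‖A x^{k+1} - b‖² + ‖[g(x^{k+1})]₊‖²)}` as a function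
of `x = x^{k+1}`, with `v/0 = +∞`. -/
def α (k : ℕ) (x : Vec d) : ℝ :=
  if S.infeasSq x = 0 then S.β k else min (S.β k) (S.v k / Real.sqrt (S.infeasSq x))

/-! #### The constants of the complexity bound -/

/-- The diameter of `X`. -/
def D : ℝ := Metric.diam S.X

/-- `‖∇c‖ := ‖J_c(x_feas)‖_F + L_c D`. -/
def normDc : ℝ := frobNorm (fderiv ℝ S.c S.xfeas) + S.Lc * S.D

/-- `B_f := M_l ‖∇c‖`. -/
def Bf : ℝ := S.Ml * S.normDc

/-- `g_min := min_i -g_i(x_feas)` (`+∞` if `m = 0`). -/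
def gMin : ℝ≥0∞ := ⨅ i, ENNReal.ofReal (-S.g i S.xfeas)

/-- `dist(x_feas, bd X)`. -/
def distBd : ℝ := Metric.infDist S.xfeas (frontier S.X)

/-- `τ := min {g_min / (2 √m B_g), dist(x_feas, bd X)}`. -/
def τ : ℝ≥0∞ :=
  min (S.gMin / ENNReal.ofReal (2 * Real.sqrt m * S.Bg)) (ENNReal.ofReal S.distBd)

/-- `D(r_h + B_f) + 2ρD² + D + τ(1 + r_h + B_f + 2ρD)`. -/
def Bbar : ℝ :=
  S.D * (S.rh + S.Bf) + 2 * S.ρ * S.D ^ 2 + S.D +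
    S.τ.toReal * (1 + S.rh + S.Bf + 2 * S.ρ * S.D)

/-- `θ := Bbar / min {τ √(λ⁺_min(A Aᵀ)), g_min / 2}`. -/
def θ : ℝ :=
  (ENNReal.ofReal S.Bbar /
    min (S.τ * lamMinPos (S.A * S.A.transpose) ^ (1 / 2 : ℝ)) (S.gMin / 2)).toReal

/-- `B_p := max {‖p⁰‖, θ}` with `p⁰ = (y⁰, z⁰)`. -/
def Bp : ℝ := max (Real.sqrt (‖S.y0‖ ^ 2 + ‖S.z0‖ ^ 2)) S.θ

/-- `Q := D (B_f + 2ρD + r_h)`. -/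
def Q : ℝ := S.D * (S.Bf + 2 * S.ρ * S.D + S.rh)

/-- `C_1 := 1/D + 1/dist(x_feas, bd X) + B_g/g_min`. -/
def C1 : ℝ := 1 / S.D + 1 / S.distBd + (ENNReal.ofReal S.Bg / S.gMin).toReal

/-- `2 (B_p + √(Q²/g_min² + Q² ‖(A Aᵀ)† A‖² C_1²)) + 1`. -/
def CpHat : ℝ :=
  2 * (S.Bp + Real.sqrt ((ENNReal.ofReal S.Q / S.gMin).toReal ^ 2 +
    S.Q ^ 2 * ‖pinv (isHermitian_mul_transpose S.A) * S.A‖ ^ 2 * S.C1 ^ 2)) + 1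

def Cp : ℝ := 2 * S.CpHat

def Cx : ℝ :=
  2 * sSup ((fun x => |S.F x|) '' S.X) +
    1 / (4 * S.β0) * (14 * S.Cp ^ 2 + 8 * S.Bp * S.Cp + 7 * S.Bp ^ 2) +
    (10 * S.Cp + 4 * S.Bp) * (S.v0 / S.β0) +
    S.β0 / 2 * (‖S.Amul S.x0 - S.b‖ ^ 2 + ∑ i, (max (S.g i S.x0 + S.z0 i / S.β0) 0) ^ 2) +
    |inner ℝ S.y0 (S.Amul S.x0 - S.b)|

def C2 : ℝ := ‖S.A.transpose * S.A‖ + m * S.Bg * (S.Bg + S.Lg)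

def C5 : ℝ :=
  max (4 * S.Cp ^ 2 / S.β0 ^ 2) (4 * (S.Bp ^ 2 + 5 * S.Cp ^ 2 / 2) ^ 2 / S.β0 ^ 2)

def C4 : ℝ :=
  max (3 / 2) <| max (3 / (2 * S.ρ) * Real.sqrt (‖S.A‖ ^ 2 + m * S.Bg ^ 2)) <|
  max (4 * S.Bg / S.ρ * Real.sqrt (m * S.β0 * Real.sqrt S.C5)) <|
  max (64 / S.ρ ^ 2 * m * S.Bg ^ 2 * S.β0 * Real.sqrt (S.ρ * S.Cx)) <|
  max (8 * S.Bg / S.ρ * Real.sqrt (m * S.β0)) (3 / (4 * S.ρ))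

/-- The smoothing parameter. -/
def ν (ε : ℝ) : ℝ := min 1 (ε ^ 2 / (64 * S.C4 ^ 2 * S.ρ * S.Ml ^ 2))

/-- The accuracy to which the `k`-th subproblem is solved. -/
def εk (ε : ℝ) (k : ℕ) : ℝ :=
  min (ε / (16 * S.C4)) (min (Real.sqrt (S.ρ / (2 * S.β k))) 1)

def C6 (ε : ℝ) : ℝ := S.normDc ^ 2 / S.ν ε + Real.sqrt m * S.Lg * S.Bp

/-- The smoothness constant `C_6 + √(k+1) β₀ C_2` of the smooth part of the `k`-th subproblem. -/
def Lhat (ε : ℝ) (k : ℕ) : ℝ := S.C6 ε + Real.sqrt (k + 1) * S.β0 * S.C2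

/-- The number of outer iterations. -/
def K (ε : ℝ) : ℕ :=
  ⌈S.C5 / ε ^ 2⌉₊ + ⌈64 * S.ρ * S.Cx * S.C4 ^ 2 / ε ^ 2⌉₊

/-- The bound on the total number of proximal-gradient steps. -/
def totalBound (ε : ℝ) : ℝ :=
  2 * S.K ε +
    S.K ε * (2 * Real.sqrt (S.C6 ε / S.ρ) +
        2 * Real.sqrt (Real.sqrt (S.K ε) * S.β0 * S.C2 / S.ρ) + 1 / Real.log 2) *
      max 0 (Real.log (9 * (S.εk ε (S.K ε))⁻¹ * S.D * Real.sqrt (1 / S.ρ) *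
        (S.C6 ε + Real.sqrt (S.K ε) * S.β0 * S.C2) ^ (3 / 2 : ℝ)))

/-! #### The smoothed subproblems -/

/-- `f^ν(x; x̄) = l^ν(c(x̄) + J_c(x̄)(x - x̄))`. -/
def fSmooth (ν : ℝ) (xbar x : Vec d) : ℝ :=
  moreau ν S.l (S.c xbar + fderiv ℝ S.c xbar (x - xbar))

/-- The smooth part of the `k`-th subproblem, at the iterate `(xk, yk, zk)`. -/
def fHat (ν : ℝ) (k : ℕ) (xk : Vec d) (yk : Vec n) (zk : Vec m) (x : Vec d) : ℝ :=
  S.fSmooth ν xk x + inner ℝ yk (S.Amul x - S.b) + S.β k / 2 * ‖S.Amul x - S.b‖ ^ 2 +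
    S.β k / 2 * ∑ i, (max (S.g i x + zk i / S.β k) 0) ^ 2 - ‖zk‖ ^ 2 / (2 * S.β k)

/-- The simple part of the `k`-th subproblem (with domain `X`). -/
def hHat (xk x : Vec d) : ℝ := S.h x + S.ρ / 2 * ‖x - xk‖ ^ 2

end Setting

/-! ### Nesterov's accelerated proximal gradient method

For `min φ = f + h` over `X = dom h`, with `f` convex and smooth and `h` `μ`-strongly convex. -/

section APG

variable {d : ℕ}

/-- The state at the beginning of an iteration: the points `xᵗ` and `vᵗ`, the sum
`s = ∑_{i ≤ t} aᵢ ∇f(xⁱ)`, the number `A_t`, and the trial value `L` that enters the line search. -/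
structure APGState (d : ℕ) where
  x : Vec d
  v : Vec d
  s : Vec d
  A : ℝ
  L : ℝ

/-- The initial state. -/
def apgInit (w : Vec d) (L0 : ℝ) : APGState d := ⟨w, w, 0, 0, L0⟩

/-- A trial of the line search with the value `L`: the positive solution `a` of
`a² / (A_t + a) = 2 (1 + μ A_t) / L`, the point `y = (A_t xᵗ + a vᵗ) / (A_t + a)`, and
`M = M_L(y) = prox_{h/L}(y - ∇f(y)/L)`. -/
def IsTrial (X : Set (Vec d)) (f h : Vec d → ℝ) (μ : ℝ) (s : APGState d) (L a : ℝ)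
    (y M : Vec d) : Prop :=
  0 < a ∧ a ^ 2 / (s.A + a) = 2 * ((1 + μ * s.A) / L) ∧
  y = (s.A + a)⁻¹ • (s.A • s.x + a • s.v) ∧
  IsProx X (1 / L) h (y - (1 / L) • gradient f y) M

/-- The acceptance test `⟨φ'(M), y - M⟩ ≥ ‖φ'(M)‖² / L` with
`φ'(M) = L (y - M) + ∇f(M) - ∇f(y)`. -/
def Accepts (f : Vec d → ℝ) (L : ℝ) (y M : Vec d) : Prop :=
  1 / L * ‖L • (y - M) + gradient f M - gradient f y‖ ^ 2 ≤
    inner ℝ (L • (y - M) + gradient f M - gradient f y) (y - M)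

/-- One iteration (one proximal-gradient step `x^{t+1} = M_{L_{t+1}}(yᵗ)`): the trial values
`L, L γu, L γu², …` are tested until one of them is accepted; the next line search starts from the
accepted value divided by `γd`. -/
def APGStep (X : Set (Vec d)) (f h : Vec d → ℝ) (μ γu γd : ℝ) (w : Vec d)
    (s s' : APGState d) : Prop :=
  ∃ j : ℕ,
    (∀ i < j, ∃ a y M, IsTrial X f h μ s (s.L * γu ^ i) a y M ∧
      ¬ Accepts f (s.L * γu ^ i) y M) ∧
    ∃ a y M, IsTrial X f h μ s (s.L * γu ^ j) a y M ∧ Accepts f (s.L * γu ^ j) y M ∧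
      s'.x = M ∧ s'.A = s.A + a ∧ s'.L = s.L * γu ^ j / γd ∧
      s'.s = s.s + a • gradient f M ∧
      IsProx X s'.A h (w - s'.s) s'.v

/-- The method, started from the point `w` and the trial value `L0`, stops with output `x` after
exactly `N` iterations, the stopping test after each iteration being `dist(0, ∂φ(xᵗ)) ≤ Δ`. -/
def APGOutputs (X : Set (Vec d)) (f h : Vec d → ℝ) (μ γu γd Δ L0 : ℝ) (w : Vec d)
    (N : ℕ) (x : Vec d) : Prop :=
  ∃ σ : ℕ → APGState d, σ 0 = apgInit w L0 ∧
    (∀ t < N, APGStep X f h μ γu γd w (σ t) (σ (t + 1))) ∧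
    0 < N ∧
    (∀ t, 0 < t → t < N → ¬ DistZeroLE (subdiff X (fun u => f u + h u) (σ t).x) Δ) ∧
    DistZeroLE (subdiff X (fun u => f u + h u) (σ N).x) Δ ∧
    x = (σ N).x

end APG

/-! ### The damped proximal augmented Lagrangian method -/

/-- The iterates of the method; `T k` is the number of proximal-gradient steps that are spent on the
`k`-th subproblem, i.e. to compute `x^{k+1}`. -/
structure Run (d n m : ℕ) where
  x : ℕ → Vec d
  y : ℕ → Vec n
  z : ℕ → Vec m
  T : ℕ → ℕ

/-- `R` is generated by the method with target accuracy `ε`, where the `k`-th smoothed subproblem is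
solved by the accelerated proximal gradient method (with `γu = 2`), started from the point
`w k (x^k)` and the trial value `L0 k`, up to the accuracy `ε_k`. -/
structure Setting.IsRun {d n m p : ℕ} (S : Setting d n m p) (ε γd : ℝ) (L0 : ℕ → ℝ)
    (w : ℕ → Vec d → Vec d) (R : Run d n m) : Prop where
  x_zero : R.x 0 = S.x0
  y_zero : R.y 0 = S.y0
  z_zero : R.z 0 = S.z0
  x_succ : ∀ k, APGOutputs S.X (S.fHat (S.ν ε) k (R.x k) (R.y k) (R.z k)) (S.hHat (R.x k))
    S.ρ 2 γd (S.εk ε k) (L0 k) (w k (R.x k)) (R.T k) (R.x (k + 1))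
  y_succ : ∀ k, R.y (k + 1) =
    R.y k + S.α k (R.x (k + 1)) • (S.Amul (R.x (k + 1)) - S.b)
  z_succ : ∀ k i, R.z (k + 1) i =
    R.z k i + S.α k (R.x (k + 1)) * max (-(R.z k i) / S.β k) (S.g i (R.x (k + 1)))

end DPALM

end

namespace DPALM

/-! ### First-order optimality and cocoercive convex functions -/

section ConvexBasics

variable {d : ℕ}

/-! Outer loop. Compare x^k with the exact minimizer x̂ over X of F plus the augmented Lagrangian
term plus ρ‖· - x^k‖². Half of the quadratic makes F convex, the other half gives strong convexity.
Optimality of x̂ puts -2ρ(x̂ - x^k) into ∂F(x̂) plus the constraint gradients weighted by the fully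
updated multipliers y^k + β_k(Ax̂ - b) and [z^k + β_k g(x̂)]₊. So x̂ is an ε-KKT point near x^k once
(i) these multipliers are bounded, because infeasibility and complementarity are then O(1/β_k), and
(ii) ‖x^k - x̂‖ is small.

For (i), `Assumptions.multiplier_bound` shows that the ball of radius B_p is invariant: a multiplier
pair that grows has a nonnegative complementarity term, and testing stationarity at a shifted Slater
point then bounds it by θ. The damped update is a convex combination of the old pair and the full
update, so it stays in the ball.

For (ii), `Inv.outer_step` combines the quadratic growth of the exact and of the smoothed
subproblem: (ρ/2)‖x^k - x̂‖² is at most the decrease of F plus the augmented Lagrangian term, up to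
smoothing and inexactness errors. `IsRun.sum_decrease_le` telescopes these decreases; the dual steps
cost O(v_k/β_k) and the penalty increases O((β_{k+1} - β_k)/β_k²), both summable. After ⌈C₅ε⁻²⌉
iterations β_k is large enough, and an averaging argument over the following window gives a good
index (`IsRun.exists_isNearKKT`).

Inner loop. `APGInv` is an estimate-sequence invariant. It keeps both sequences of the accelerated
method within D/√(μA_t) of the minimizer, while √A_t grows by the factor 1 + ½√(μ/L) per step. The
acceptance test exhibits a subgradient bounded by a multiple of the proximal step length, so the
stopping residual decays geometrically (`apg_residual`, `apg_iterations_le`). The smoothness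
constant enters as a cocoercivity constant on X (`SmoothConvexOn`), a notion stable under sums and
affine substitution and available although the gᵢ are smooth only near X.

Order. K is O(ε⁻²), and √(L̂/ρ) is O(ε⁻¹) because ν is of order ε²; the logarithm supplies the last
factor. -/

theorem hasDerivAt_line_of_grad {φ : Vec d → ℝ} {G x w : Vec d} {t : ℝ}
    (h : HasGradientAt φ G (x + t • w)) :
    HasDerivAt (fun s : ℝ => φ (x + s • w)) (inner ℝ G w) t := by
  have h1 : HasDerivAt (fun s : ℝ => x + s • w) w t := by
    simpa using ((hasDerivAt_id t).smul_const w).const_add x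
  have h2 := (hasGradientAt_iff_hasFDerivAt.1 h).comp_hasDerivAt t h1
  simpa [Function.comp_def] using h2

/-- First-order optimality: a subgradient of `P + R` at `x`, minus the gradient of `R`, is a
subgradient of the convex function `P`. -/
theorem inner_sub_grad_le {X : Set (Vec d)} {P R : Vec d → ℝ} (hP : ConvexOn ℝ X P)
    {x r ζ : Vec d} (hx : x ∈ X) (hR : HasGradientAt R r x)
    (h : ∀ u ∈ X, inner ℝ ζ (u - x) ≤ (P u + R u) - (P x + R x)) {u : Vec d} (hu : u ∈ X) :
    inner ℝ (ζ - r) (u - x) ≤ P u - P x := by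
  have hd : HasDerivAt (fun s : ℝ => R (x + s • (u - x))) (inner ℝ r (u - x)) 0 :=
    hasDerivAt_line_of_grad (by simpa using hR)
  have ht := hd.tendsto_slope_zero_right
  -- Along the segment from x to u, convexity caps the difference quotient of P by P u - P x, so the
  -- hypothesis bounds that of R from below; then t → 0⁺. R need not be convex.
  have key : inner ℝ ζ (u - x) - (P u - P x) ≤ inner ℝ r (u - x) := by
    refine ge_of_tendsto ht ?_
    filter_upwards [Ioo_mem_nhdsGT (zero_lt_one (α := ℝ))] with t ht
    have hmem : x + t • (u - x) ∈ X := by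
      have := hP.1 hx hu (sub_nonneg.2 ht.2.le) ht.1.le (by ring)
      convert this using 1
      module
    have h1 := h _ hmem
    have h2 := hP.2 hx hu (sub_nonneg.2 ht.2.le) ht.1.le (by ring)
    have h3 : (1 - t) • x + t • u = x + t • (u - x) := by module
    rw [h3] at h2
    rw [add_sub_cancel_left, real_inner_smul_right] at h1
    simp only [smul_eq_mul, zero_add, zero_smul, add_zero] at h2 ⊢
    rw [inv_mul_eq_div, le_div_iff₀ ht.1]
    nlinarith
  rw [inner_sub_left]
  linarith

theorem hasGradientAt_quad (c : ℝ) (w x : Vec d) :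
    HasGradientAt (fun u : Vec d => c / 2 * ‖u - w‖ ^ 2) (c • (x - w)) x := by
  rw [hasGradientAt_iff_hasFDerivAt]
  have h := ((hasFDerivAt_id (𝕜 := ℝ) x).sub_const w).norm_sq.const_mul (c / 2)
  refine h.congr_fderiv ?_
  ext v
  simp
  ring

theorem hasGradientAt_add {φ ψ : Vec d → ℝ} {a b x : Vec d} (h1 : HasGradientAt φ a x)
    (h2 : HasGradientAt ψ b x) : HasGradientAt (fun u => φ u + ψ u) (a + b) x := by
  rw [hasGradientAt_iff_hasFDerivAt] at *
  rw [map_add]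
  exact h1.add h2

/-- Minimizing `P + (c/2)‖· - w‖²`, `P` convex: quadratic growth at an approximate minimizer. -/
theorem quad_growth {X : Set (Vec d)} {P : Vec d → ℝ} (hP : ConvexOn ℝ X P) {c : ℝ}
    {w x ζ : Vec d} (hx : x ∈ X)
    (h : ∀ u ∈ X, inner ℝ ζ (u - x) ≤
      (P u + c / 2 * ‖u - w‖ ^ 2) - (P x + c / 2 * ‖x - w‖ ^ 2)) {u : Vec d} (hu : u ∈ X) :
    inner ℝ ζ (u - x) + c / 2 * ‖u - x‖ ^ 2 ≤
      (P u + c / 2 * ‖u - w‖ ^ 2) - (P x + c / 2 * ‖x - w‖ ^ 2) := by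
  have h1 := inner_sub_grad_le hP hx (hasGradientAt_quad c w x) h hu
  have h2 : ‖u - w‖ ^ 2 = ‖u - x‖ ^ 2 + 2 * inner ℝ (x - w) (u - x) + ‖x - w‖ ^ 2 := by
    rw [show u - w = (u - x) + (x - w) by abel, norm_add_sq_real, real_inner_comm]
  rw [inner_sub_left, real_inner_smul_left] at h1
  rw [h2]
  linarith

/-- `φ` is differentiable on `X` with gradient `G`, satisfies the gradient inequality there, and
`G` is `1/L`-cocoercive. -/
structure SmoothConvexOn (X : Set (Vec d)) (φ : Vec d → ℝ) (G : Vec d → Vec d) (L : ℝ) :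
    Prop where
  grad : ∀ x ∈ X, HasGradientAt φ (G x) x
  le : ∀ x ∈ X, ∀ y ∈ X, φ x + inner ℝ (G x) (y - x) ≤ φ y
  coco : ∀ x ∈ X, ∀ y ∈ X, ‖G x - G y‖ ^ 2 ≤ L * inner ℝ (G x - G y) (x - y)

namespace SmoothConvexOn

variable {X : Set (Vec d)} {φ ψ : Vec d → ℝ} {G H : Vec d → Vec d} {L M : ℝ}

theorem mono_inner (h : SmoothConvexOn X φ G L) {x y : Vec d} (hx : x ∈ X) (hy : y ∈ X) :
    0 ≤ inner ℝ (G x - G y) (x - y) := by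
  have h1 := h.le x hx y hy
  have h2 := h.le y hy x hx
  rw [← neg_sub x y, inner_neg_right] at h1
  rw [inner_sub_left]
  linarith

theorem mono (h : SmoothConvexOn X φ G L) (hLM : L ≤ M) : SmoothConvexOn X φ G M :=
  ⟨h.grad, h.le, fun x hx y hy => (h.coco x hx y hy).trans
    (mul_le_mul_of_nonneg_right hLM (h.mono_inner hx hy))⟩

theorem const (X : Set (Vec d)) (a : ℝ) : SmoothConvexOn X (fun _ => a) (fun _ => 0) 0 :=
  ⟨fun x _ => hasGradientAt_const x a, by simp, by simp⟩

end SmoothConvexOn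

/-- The product (‖a‖‖b‖)² is at most (Lt)(Ms), so the cross term is at most Lt + Ms by AM-GM. This
makes cocoercivity constants add without loss. -/
theorem norm_add_sq_le_of_coco {E : Type*} [NormedAddCommGroup E] {a b : E} {L M s t : ℝ}
    (hL : 0 ≤ L) (hM : 0 ≤ M) (hs : 0 ≤ s) (ht : 0 ≤ t)
    (ha : ‖a‖ ^ 2 ≤ L * s) (hb : ‖b‖ ^ 2 ≤ M * t) : ‖a + b‖ ^ 2 ≤ (L + M) * (s + t) := by
  have h1 : (‖a‖ * ‖b‖) ^ 2 ≤ (L * t) * (M * s) := by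
    rw [mul_pow]
    calc _ ≤ (L * s) * (M * t) := mul_le_mul ha hb (by positivity) (by positivity)
      _ = _ := by ring
  have h2 : 2 * (‖a‖ * ‖b‖) ≤ L * t + M * s := by
    have h3 : 0 ≤ L * t := by positivity
    have h4 : 0 ≤ M * s := by positivity
    refine le_of_sq_le_sq ?_ (by positivity)
    nlinarith [sq_nonneg (L * t - M * s)]
  have h5 : ‖a + b‖ ^ 2 ≤ (‖a‖ + ‖b‖) ^ 2 := by gcongr; exact norm_add_le a b
  nlinarith

namespace SmoothConvexOn

variable {X : Set (Vec d)} {φ ψ : Vec d → ℝ} {G H : Vec d → Vec d} {L M : ℝ}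

theorem add (h1 : SmoothConvexOn X φ G L) (h2 : SmoothConvexOn X ψ H M) (hL : 0 ≤ L)
    (hM : 0 ≤ M) : SmoothConvexOn X (fun x => φ x + ψ x) (fun x => G x + H x) (L + M) where
  grad x hx := hasGradientAt_add (h1.grad x hx) (h2.grad x hx)
  le x hx y hy := by
    have := h1.le x hx y hy
    have := h2.le x hx y hy
    rw [inner_add_left]
    linarith
  coco x hx y hy := by
    have := norm_add_sq_le_of_coco hL hM (h1.mono_inner hx hy) (h2.mono_inner hx hy)
      (h1.coco x hx y hy) (h2.coco x hx y hy)
    rw [← inner_add_left] at this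
    rw [add_sub_add_comm]
    exact this

theorem sum {ι : Type*} (s : Finset ι) {φ : ι → Vec d → ℝ} {G : ι → Vec d → Vec d} {L : ι → ℝ}
    (h : ∀ i ∈ s, SmoothConvexOn X (φ i) (G i) (L i)) (hL : ∀ i ∈ s, 0 ≤ L i) :
    SmoothConvexOn X (fun x => ∑ i ∈ s, φ i x) (fun x => ∑ i ∈ s, G i x) (∑ i ∈ s, L i) := by
  classical
  induction s using Finset.induction_on with
  | empty => simpa using const X 0
  | insert a s ha ih =>
    simp only [Finset.sum_insert ha]
    exact (h a (Finset.mem_insert_self a s)).add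
      (ih (fun i hi => h i (Finset.mem_insert_of_mem hi))
        (fun i hi => hL i (Finset.mem_insert_of_mem hi)))
      (hL a (Finset.mem_insert_self a s))
      (Finset.sum_nonneg fun i hi => hL i (Finset.mem_insert_of_mem hi))

end SmoothConvexOn

end ConvexBasics

/-! ### One step of the accelerated method: line search and estimate sequence -/

section AcceleratedProximalGradient

variable {d : ℕ} {X : Set (Vec d)} {f h : Vec d → ℝ} {G : Vec d → Vec d} {μ Lf D : ℝ}

theorem norm_sq_eq_add_inner (u x w : Vec d) :
    ‖u - w‖ ^ 2 = ‖u - x‖ ^ 2 + 2 * inner ℝ (x - w) (u - x) + ‖x - w‖ ^ 2 := by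
  rw [show u - w = (u - x) + (x - w) by abel, norm_add_sq_real, real_inner_comm]

/-- The strong-convexity quadratic and the proximal term go together to the differentiable side, so
optimality only needs convexity of h - (μ/2)‖·‖²; recompleting the square recovers the gain (μ/2)‖u
- x‖². -/
theorem IsProx.inner_le {t : ℝ} {w x u : Vec d} (ht : 0 < t)
    (hh : ConvexOn ℝ X (fun u => h u - μ / 2 * ‖u‖ ^ 2)) (hp : IsProx X t h w x) (hu : u ∈ X) :
    1 / t * inner ℝ (w - x) (u - x) + μ / 2 * ‖u - x‖ ^ 2 ≤ h u - h x := by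
  have hR := hasGradientAt_add (hasGradientAt_quad μ 0 x) (hasGradientAt_quad (1 / t) w x)
  have key := inner_sub_grad_le (ζ := 0) hh hp.1 hR (fun v hv => by
    have := hp.2 v hv
    rw [inner_zero_left]
    simp only [sub_zero]
    rw [show 1 / (2 * t) = 1 / t / 2 by field_simp] at this
    linarith) hu
  have h2 := norm_sq_eq_add_inner u x 0
  simp only [sub_zero] at h2 key
  rw [h2, zero_sub, inner_neg_left, inner_add_left, real_inner_smul_left, real_inner_smul_left,
    ← neg_sub w x, inner_neg_left] at key
  linarith

/-- Strong convexity: quadratic growth of the composite objective at its minimizer. -/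
theorem SmoothConvexOn.quad_growth_add (hf : SmoothConvexOn X f G Lf)
    (hh : ConvexOn ℝ X (fun u => h u - μ / 2 * ‖u‖ ^ 2)) {x u : Vec d} (hx : x ∈ X)
    (hmin : ∀ u ∈ X, f x + h x ≤ f u + h u) (hu : u ∈ X) :
    μ / 2 * ‖u - x‖ ^ 2 ≤ (f u + h u) - (f x + h x) := by
  have hR := hasGradientAt_add (hasGradientAt_quad μ 0 x) (hf.grad x hx)
  have key := inner_sub_grad_le (ζ := 0) hh hx hR (fun v hv => by
    have := hmin v hv
    rw [inner_zero_left]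
    simp only [sub_zero]
    linarith) hu
  have h1 := hf.le x hx u hu
  have h2 := norm_sq_eq_add_inner u x 0
  simp only [sub_zero] at h2 key
  rw [h2, zero_sub, inner_neg_left, inner_add_left, real_inner_smul_left] at key
  linarith

/-- The acceptance test holds as soon as `L` is at least the smoothness constant. -/
theorem SmoothConvexOn.accepts (hf : SmoothConvexOn X f G Lf) {L : ℝ} (hL : 0 < L)
    (hLf : Lf ≤ L) {y M : Vec d} (hy : y ∈ X) (hM : M ∈ X) : Accepts f L y M := by
  unfold Accepts
  rw [(hf.grad y hy).gradient, (hf.grad M hM).gradient]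
  -- With e = ∇f(y) - ∇f(M), the test ‖L(y - M) - e‖² ≤ L⟨L(y - M) - e, y - M⟩ expands to exactly
  -- ‖e‖² ≤ L⟨e, y - M⟩.
  have hc := (hf.mono hLf).coco y hy M hM
  set e := G y - G M
  have he : L • (y - M) + G M - G y = L • (y - M) - e := by simp only [e]; abel
  rw [he, norm_sub_sq_real, inner_sub_left, real_inner_smul_left, real_inner_smul_left, norm_smul,
    real_inner_self_eq_norm_sq, real_inner_comm e, Real.norm_of_nonneg hL.le, one_div,
    inv_mul_le_iff₀ hL, mul_pow]
  rw [real_inner_comm] at hc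
  rw [real_inner_comm e] at hc
  nlinarith

/-- The estimate-sequence invariant of the accelerated method. -/
structure APGInv (X : Set (Vec d)) (f h : Vec d → ℝ) (μ Lf : ℝ) (w : Vec d) (s : APGState d) :
    Prop where
  x_mem : s.x ∈ X
  v_mem : s.v ∈ X
  A_nonneg : 0 ≤ s.A
  L_pos : 0 < s.L
  L_le : s.L ≤ Lf
  -- The affine function κ + ⟨s, ·⟩ is the accumulated sum of weighted tangents of f. The second
  -- clause says that the model majorizes A φ(x) with growth 1 + μA around v.
  est : ∃ κ : ℝ, (∀ u ∈ X, κ + inner ℝ s.s u ≤ s.A * f u) ∧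
    ∀ u ∈ X, s.A * (f s.x + h s.x) + (1 + μ * s.A) / 2 * ‖u - s.v‖ ^ 2 ≤
      κ + inner ℝ s.s u + s.A * h u + 1 / 2 * ‖u - w‖ ^ 2

theorem APGInv.init {w : Vec d} {L0 : ℝ} (hw : w ∈ X) (h0 : 0 < L0) (h1 : L0 ≤ Lf) :
    APGInv X f h μ Lf w (apgInit w L0) :=
  ⟨hw, hw, le_rfl, h0, h1, 0, by simp [apgInit], by simp [apgInit]⟩

theorem APGInv.mid_mem {w : Vec d} {s : APGState d} (hX : Convex ℝ X)
    (hs : APGInv X f h μ Lf w s) {a : ℝ} (ha : 0 < a) :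
    (s.A + a)⁻¹ • (s.A • s.x + a • s.v) ∈ X := by
  have h0 := hs.A_nonneg
  have hpos : 0 < s.A + a := by positivity
  rw [smul_add, smul_smul, smul_smul]
  exact hX hs.x_mem hs.v_mem (by positivity) (by positivity) (by field_simp)

theorem exists_isProx (hXc : IsCompact X) (hne : X.Nonempty) (hh : ContinuousOn h X) (t : ℝ)
    (w : Vec d) : ∃ x, IsProx X t h w x := by
  obtain ⟨x, hx, hmin⟩ := hXc.exists_isMinOn (f := fun z => h z + 1 / (2 * t) * ‖z - w‖ ^ 2) hne
    (hh.add (by fun_prop))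
  exact ⟨x, hx, fun z hz => hmin hz⟩

theorem APGInv.exists_trial {w : Vec d} {s : APGState d} (hμ : 0 < μ)
    (hXc : IsCompact X) (hh : ContinuousOn h X)
    (hs : APGInv X f h μ Lf w s) {L : ℝ} (hL : 0 < L) :
    ∃ a y M, IsTrial X f h μ s L a y M := by
  have hA := hs.A_nonneg
  -- The step equation is a² = c(A + a), with positive root a = (c + √(c² + 4cA))/2.
  set c := 2 * ((1 + μ * s.A) / L) with hc
  have hcpos : 0 < c := by positivity
  set q := Real.sqrt (c ^ 2 + 4 * c * s.A)
  have hq : q ^ 2 = c ^ 2 + 4 * c * s.A := Real.sq_sqrt (by positivity)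
  have hq0 : 0 ≤ q := Real.sqrt_nonneg _
  have ha : 0 < (c + q) / 2 := by positivity
  obtain ⟨M, hM⟩ := exists_isProx hXc ⟨_, hs.x_mem⟩ hh (1 / L)
    ((s.A + (c + q) / 2)⁻¹ • (s.A • s.x + ((c + q) / 2) • s.v) - (1 / L) •
      gradient f ((s.A + (c + q) / 2)⁻¹ • (s.A • s.x + ((c + q) / 2) • s.v)))
  refine ⟨(c + q) / 2, _, M, ha, ?_, rfl, hM⟩
  rw [div_eq_iff (by positivity)]
  nlinarith

theorem APGInv.exists_step {w : Vec d} {s : APGState d} {γd : ℝ} (hμ : 0 < μ)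
    (hXc : IsCompact X) (hX : Convex ℝ X) (hh : ContinuousOn h X)
    (hf : SmoothConvexOn X f G Lf) (hs : APGInv X f h μ Lf w s) :
    ∃ s', APGStep X f h μ 2 γd w s s' := by
  classical
  have hLpos : ∀ i : ℕ, 0 < s.L * 2 ^ i := fun i => mul_pos hs.L_pos (by positivity)
  have hex : ∃ j : ℕ, ∃ a y M, IsTrial X f h μ s (s.L * 2 ^ j) a y M ∧
      Accepts f (s.L * 2 ^ j) y M := by
    obtain ⟨j, hj⟩ := pow_unbounded_of_one_lt (Lf / s.L) (one_lt_two (α := ℝ))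
    obtain ⟨a, y, M, ht⟩ := hs.exists_trial hμ hXc hh (hLpos j)
    refine ⟨j, a, y, M, ht, hf.accepts (hLpos j) ?_ ?_ ht.2.2.2.1⟩
    · rw [div_lt_iff₀ hs.L_pos] at hj
      linarith
    · rw [ht.2.2.1]; exact hs.mid_mem hX ht.1
  obtain ⟨a, y, M, ht, hacc⟩ := Nat.find_spec hex
  obtain ⟨v', hv'⟩ := exists_isProx hXc ⟨_, hs.x_mem⟩ hh (s.A + a)
    (w - (s.s + a • gradient f M))
  refine ⟨⟨M, v', s.s + a • gradient f M, s.A + a, s.L * 2 ^ Nat.find hex / γd⟩,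
    Nat.find hex, fun i hi => ?_, a, y, M, ht, hacc, rfl, rfl, rfl, rfl, hv'⟩
  obtain ⟨a', y', M', ht'⟩ := hs.exists_trial hμ hXc hh (hLpos i)
  exact ⟨a', y', M', ht', fun hacc' => Nat.find_min hex hi ⟨a', y', M', ht', hacc'⟩⟩

/-- One accelerated step: the invariant is preserved, `A` grows, and the new point has a
subgradient that is controlled by the length of the proximal-gradient step. -/
theorem APGInv.step {w : Vec d} {s s' : APGState d} {γd : ℝ} (hγ : 2 ≤ γd) (hμ : 0 < μ)
    (hX : Convex ℝ X) (hh : ConvexOn ℝ X (fun u => h u - μ / 2 * ‖u‖ ^ 2))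
    (hf : SmoothConvexOn X f G Lf) (hs : APGInv X f h μ Lf w s)
    (hstep : APGStep X f h μ 2 γd w s s') :
    APGInv X f h μ Lf w s' ∧ s.A < s'.A ∧ (1 + μ * s.A) * s'.A ≤ Lf * (s'.A - s.A) ^ 2 ∧
    ∃ ξ ∈ subdiff X (fun u => f u + h u) s'.x,
      ‖ξ‖ ≤ 2 * Lf * ‖s'.A⁻¹ • (s.A • s.x + (s'.A - s.A) • s.v) - s'.x‖ := by
  obtain ⟨j, hrej, a, y, M, ⟨ha, haeq, hy, hMprox⟩, hacc, hx', hA', hL', hs', hv'⟩ := hstep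
  have hA := hs.A_nonneg
  set L := s.L * 2 ^ j with hLdef
  have hL : 0 < L := mul_pos hs.L_pos (by positivity)
  -- If the search doubled at all, then L/2 was rejected, and values ≥ Lf are never rejected;
  -- otherwise L is still the starting value.
  have hLle : L ≤ 2 * Lf := by
    rcases Nat.eq_zero_or_pos j with rfl | hj
    · have := hs.L_le
      have := hs.L_pos
      simp only [hLdef, pow_zero, mul_one]
      linarith
    · obtain ⟨i, rfl⟩ := Nat.exists_eq_succ_of_ne_zero hj.ne'
      obtain ⟨a', y', M', ht', hn⟩ := hrej i (Nat.lt_succ_self i)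
      by_contra hcon
      push Not at hcon
      refine hn (hf.accepts (mul_pos hs.L_pos (by positivity)) ?_ ?_ ht'.2.2.2.1)
      · rw [hLdef, pow_succ] at hcon
        linarith
      · rw [ht'.2.2.1]; exact hs.mid_mem hX ht'.1
  have hyX : y ∈ X := hy ▸ hs.mid_mem hX ha
  have hMX : M ∈ X := hMprox.1
  have hApos : 0 < s.A + a := by positivity
  rw [hA'] at hv'
  unfold Accepts at hacc
  rw [(hf.grad y hyX).gradient, (hf.grad M hMX).gradient] at hacc
  rw [(hf.grad y hyX).gradient] at hMprox
  rw [(hf.grad M hMX).gradient] at hs'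
  set ξ := L • (y - M) + G M - G y with hξ
  -- Optimality of the proximal step: ξ - ∇f(M) is a subgradient of h at M. Adding the gradient
  -- inequality of f makes ξ a subgradient of f + h.
  have hsub : ∀ u ∈ X, inner ℝ (ξ - G M) (u - M) ≤ h u - h M := fun u hu => by
    have h1 := hMprox.inner_le (by positivity) hh hu
    have h2 : ξ - G M = L • (y - (1 / L) • G y - M) := by
      have h3 : L • (y - (1 / L) • G y - M) = L • y - (L * (1 / L)) • G y - L • M := by module
      rw [h3, mul_one_div_cancel hL.ne', hξ]
      module
    rw [h2, real_inner_smul_left]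
    rw [one_div_one_div] at h1
    nlinarith [sq_nonneg ‖u - M‖]
  have hsub' : ∀ u ∈ X, inner ℝ ξ (u - M) ≤ (f u + h u) - (f M + h M) := fun u hu => by
    have h1 := hsub u hu
    have h2 := hf.le M hMX u hu
    rw [inner_sub_left] at h1
    linarith
  have haL : a ^ 2 * L = 2 * (1 + μ * s.A) * (s.A + a) := by
    rw [div_eq_iff hApos.ne'] at haeq
    rw [haeq]
    field_simp
  refine ⟨⟨hx' ▸ hMX, hv'.1, hA' ▸ hApos.le, ?_, ?_, ?_⟩, ?_, ?_, ?_⟩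
  · rw [hL']; exact div_pos hL (by linarith)
  -- Division by γd ≥ 2 undoes the possible factor 2, so the next search again starts at or below
  -- Lf.
  · rw [hL', div_le_iff₀ (by linarith)]
    have : 0 ≤ Lf := by linarith [hs.L_le, hs.L_pos]
    nlinarith
  · obtain ⟨κ, hup, hlow⟩ := hs.est
    -- The model gains the tangent of f at M, weighted by a.
    refine ⟨κ + a * (f M - inner ℝ (G M) M), fun u hu => ?_, fun u hu => ?_⟩
    · rw [hs', hA', inner_add_left, real_inner_smul_left]
      have h1 := hup u hu
      have h2 := hf.le M hMX u hu
      rw [inner_sub_right] at h2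
      nlinarith
    · have hvX := hv'.1
      have h1 := hlow _ hvX
      have h2 := hsub _ hvX
      have h3 := hsub' _ hs.x_mem
      have h4 := hv'.inner_le hApos hh hu
      rw [hx', hA']
      set v' := s'.v
      -- the quadratic growth of the model at its minimizer
      have h5 : inner ℝ (w - s'.s - v') (u - v') + (s.A + a) * (μ / 2 * ‖u - v'‖ ^ 2) ≤
          (s.A + a) * (h u - h v') := by
        have := mul_le_mul_of_nonneg_left h4 hApos.le
        rw [mul_add, ← mul_assoc, mul_one_div_cancel hApos.ne', one_mul] at this
        exact this
      have h6 := norm_sq_eq_add_inner u v' w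
      have h7 : inner ℝ (w - s'.s - v') (u - v') =
          - inner ℝ (v' - w) (u - v') - (inner ℝ s'.s u - inner ℝ s'.s v') := by
        rw [show w - s'.s - v' = -(v' - w) - s'.s by abel, inner_sub_left, inner_neg_left,
          inner_sub_right s'.s]
      -- the model at its minimizer is at least `A' φ(M)`
      have h8 : a * inner ℝ ξ (v' - M) + s.A * inner ℝ ξ (s.x - M) =
          (s.A + a) * inner ℝ ξ (y - M) + a * inner ℝ ξ (v' - s.v) := by
        rw [← real_inner_smul_right, ← real_inner_smul_right, ← real_inner_smul_right,
          ← real_inner_smul_right, ← inner_add_right, ← inner_add_right, hy]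
        congr 1
        rw [smul_sub (s.A + a), smul_smul, mul_inv_cancel₀ hApos.ne']
        module
      -- A completed square in v' - v: the equation for a makes the gain (A + a)‖ξ‖²/L from the
      -- acceptance test equal to a²‖ξ‖²/(2(1 + μA)), exactly the missing term.
      have h9 : 0 ≤ (1 + μ * s.A) / 2 * ‖v' - s.v‖ ^ 2 + a * inner ℝ ξ (v' - s.v) +
          (s.A + a) * (1 / L * ‖ξ‖ ^ 2) := by
        have hc : 0 < 1 + μ * s.A := by positivity
        have e1 : (s.A + a) * (1 / L * ‖ξ‖ ^ 2) = a ^ 2 / (2 * (1 + μ * s.A)) * ‖ξ‖ ^ 2 := by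
          field_simp
          linear_combination (-‖ξ‖ ^ 2) * haL
        have e2 : 0 ≤ ‖(1 + μ * s.A) • (v' - s.v) + a • ξ‖ ^ 2 := by positivity
        rw [norm_add_sq_real, norm_smul, norm_smul, real_inner_smul_left, real_inner_smul_right,
          real_inner_comm, Real.norm_of_nonneg hc.le, Real.norm_of_nonneg ha.le] at e2
        rw [e1]
        have e3 : (1 + μ * s.A) / 2 * ‖v' - s.v‖ ^ 2 + a * inner ℝ ξ (v' - s.v) +
            a ^ 2 / (2 * (1 + μ * s.A)) * ‖ξ‖ ^ 2 = (((1 + μ * s.A) * ‖v' - s.v‖) ^ 2 +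
            2 * ((1 + μ * s.A) * (a * inner ℝ ξ (v' - s.v))) + (a * ‖ξ‖) ^ 2) /
              (2 * (1 + μ * s.A)) := by
          field_simp
        rw [e3]
        positivity
      have h10 := mul_le_mul_of_nonneg_left hacc hApos.le
      have h11 := mul_le_mul_of_nonneg_left h2 ha.le
      have h12 := mul_le_mul_of_nonneg_left h3 hA
      rw [inner_sub_left] at h11
      have h13 : inner ℝ s'.s v' = inner ℝ s.s v' + a * inner ℝ (G M) v' := by
        rw [hs', inner_add_left, real_inner_smul_left]
      have h14 : inner ℝ (G M) (v' - M) = inner ℝ (G M) v' - inner ℝ (G M) M :=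
        inner_sub_right _ _ _
      rw [h6]
      rw [h7] at h5
      rw [h14] at h11
      linarith
  · rw [hA']; linarith
  · rw [hA', add_sub_cancel_left]
    nlinarith [mul_le_mul_of_nonneg_left hLle (sq_nonneg a)]
  · refine ⟨ξ, ⟨hx' ▸ hMX, fun u hu => hx' ▸ hsub' u hu⟩, ?_⟩
    rw [hA', add_sub_cancel_left, ← hy, hx']
    -- The acceptance test followed by Cauchy-Schwarz: the subgradient is at most L times the step
    -- length.
    have h1 : 1 / L * ‖ξ‖ ^ 2 ≤ ‖ξ‖ * ‖y - M‖ := hacc.trans (real_inner_le_norm _ _)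
    have h2 : ‖ξ‖ ≤ L * ‖y - M‖ := by
      rcases (norm_nonneg ξ).eq_or_lt with h0 | h0
      · rw [← h0]; positivity
      · rw [one_div, inv_mul_le_iff₀ hL] at h1
        refine le_of_mul_le_mul_left ?_ h0
        nlinarith
    exact h2.trans (by gcongr)

end AcceleratedProximalGradient

/-! ### Geometric decay of the stopping residual and iteration count -/

section AcceleratedComplexity

variable {d : ℕ} {X : Set (Vec d)} {f h : Vec d → ℝ} {G : Vec d → Vec d} {μ Lf D : ℝ}

theorem SmoothConvexOn.continuousOn (hf : SmoothConvexOn X f G Lf) : ContinuousOn f X :=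
  fun x hx => (hasGradientAt_iff_hasFDerivAt.1 (hf.grad x hx)).continuousAt.continuousWithinAt

/-- Both sequences of the accelerated method approach the minimizer at the rate `A_t^{-1/2}`. -/
theorem APGInv.dist_le {w xs : Vec d} {s : APGState d} (hμ : 0 < μ)
    (hh : ConvexOn ℝ X (fun u => h u - μ / 2 * ‖u‖ ^ 2))
    (hf : SmoothConvexOn X f G Lf) (hD : ∀ x ∈ X, ∀ y ∈ X, ‖x - y‖ ≤ D) (hw : w ∈ X)
    (hxs : xs ∈ X) (hmin : ∀ u ∈ X, f xs + h xs ≤ f u + h u) (hs : APGInv X f h μ Lf w s) :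
    Real.sqrt (μ * s.A) * ‖s.x - xs‖ ≤ D ∧ Real.sqrt (μ * s.A) * ‖s.v - xs‖ ≤ D := by
  obtain ⟨κ, hup, hlow⟩ := hs.est
  have hA := hs.A_nonneg
  have h1 := hlow xs hxs
  have h2 := hup xs hxs
  have h3 := hf.quad_growth_add hh hxs hmin hs.x_mem
  have h4 := mul_le_mul_of_nonneg_left h3 hA
  have hDw := hD xs hxs w hw
  have hD0 : 0 ≤ D := (norm_nonneg _).trans hDw
  have h5 : ‖xs - w‖ ^ 2 ≤ D ^ 2 := by gcongr
  have hmA : 0 ≤ μ * s.A := by positivity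
  rw [norm_sub_rev] at h1
  -- At the minimizer the model is at most A φ(x*) + ½‖x* - w‖², while quadratic growth of φ bounds
  -- A(φ(x) - φ(x*)) from below by (μA/2)‖x - x*‖².
  have key : μ * s.A * ‖s.x - xs‖ ^ 2 + (1 + μ * s.A) * ‖s.v - xs‖ ^ 2 ≤ D ^ 2 := by
    linarith
  have n1 := sq_nonneg ‖s.v - xs‖
  have n2 := mul_nonneg hmA (sq_nonneg ‖s.x - xs‖)
  have n3 := mul_nonneg hmA (sq_nonneg ‖s.v - xs‖)
  constructor
  · refine le_of_sq_le_sq ?_ hD0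
    rw [mul_pow, Real.sq_sqrt hmA]
    linarith
  · refine le_of_sq_le_sq ?_ hD0
    rw [mul_pow, Real.sq_sqrt hmA]
    linarith

theorem norm_convex_comb_sub_le {x v z : Vec d} {a b r R : ℝ} (ha : 0 ≤ a) (hb : 0 < b)
    (hr : 0 ≤ r) (hx : r * ‖x - z‖ ≤ R) (hv : r * ‖v - z‖ ≤ R) :
    r * ‖(a + b)⁻¹ • (a • x + b • v) - z‖ ≤ R := by
  have hab : 0 < a + b := by positivity
  have h1 : (a + b)⁻¹ • (a • x + b • v) - z = (a + b)⁻¹ • (a • (x - z) + b • (v - z)) := by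
    have : z = ((a + b)⁻¹ * (a + b)) • z := by rw [inv_mul_cancel₀ hab.ne', one_smul]
    nth_rw 1 [this]
    module
  have h2 : ‖a • (x - z) + b • (v - z)‖ ≤ a * ‖x - z‖ + b * ‖v - z‖ := by
    refine (norm_add_le _ _).trans ?_
    rw [norm_smul, norm_smul, Real.norm_of_nonneg ha, Real.norm_of_nonneg hb.le]
  rw [h1, norm_smul, Real.norm_of_nonneg (by positivity), mul_left_comm, inv_mul_le_iff₀ hab]
  calc r * ‖a • (x - z) + b • (v - z)‖ ≤ r * (a * ‖x - z‖ + b * ‖v - z‖) := by gcongr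
    _ = a * (r * ‖x - z‖) + b * (r * ‖v - z‖) := by ring
    _ ≤ a * R + b * R := by gcongr
    _ = _ := by ring

/-- For p = √A and p' = √A' the hypothesis gives r p p' ≤ p'² - p² ≤ 2p'(p' - p); cancel p'. This is
the source of the linear rate, with r = √(μ/Lf). -/
theorem sqrt_growth {A A' r : ℝ} (hA : 0 ≤ A) (hA' : A < A')
    (h : r ^ 2 * A * A' ≤ (A' - A) ^ 2) :
    (1 + 1 / 2 * r) * Real.sqrt A ≤ Real.sqrt A' := by
  set p := Real.sqrt A
  set p' := Real.sqrt A'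
  have e1 : p ^ 2 = A := Real.sq_sqrt hA
  have e2 : p' ^ 2 = A' := Real.sq_sqrt (hA.trans hA'.le)
  have hp : 0 ≤ p := Real.sqrt_nonneg _
  have hpp : p < p' := Real.sqrt_lt_sqrt hA hA'
  have h1 : r * p * p' ≤ p' ^ 2 - p ^ 2 := by
    refine le_of_sq_le_sq ?_ (by rw [e1, e2]; linarith)
    rw [e1, e2]
    calc _ = r ^ 2 * p ^ 2 * p' ^ 2 := by ring
      _ ≤ _ := by rw [e1, e2]; exact h
  have h2 : r * p * p' ≤ (2 * (p' - p)) * p' := by nlinarith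
  have h3 := le_of_mul_le_mul_right h2 (hp.trans_lt hpp)
  linarith

/-- The subgradients found by the accelerated method decrease linearly. -/
theorem apg_residual {w : Vec d} {L0 γd : ℝ} {σ : ℕ → APGState d} {N : ℕ}
    (hγ : 2 ≤ γd) (hμ : 0 < μ) (hXc : IsCompact X) (hX : Convex ℝ X)
    (hhc : ContinuousOn h X) (hh : ConvexOn ℝ X (fun u => h u - μ / 2 * ‖u‖ ^ 2))
    (hf : SmoothConvexOn X f G Lf) (hD : ∀ x ∈ X, ∀ y ∈ X, ‖x - y‖ ≤ D) (hw : w ∈ X)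
    (h0 : 0 < L0) (h1 : L0 ≤ Lf) (hσ : σ 0 = apgInit w L0)
    (hstep : ∀ t < N, APGStep X f h μ 2 γd w (σ t) (σ (t + 1))) :
    (∀ t ≤ N, APGInv X f h μ Lf w (σ t)) ∧
    ∀ t, t + 2 ≤ N → ∃ ξ ∈ subdiff X (fun u => f u + h u) (σ (t + 2)).x,
      ‖ξ‖ * (1 + 1 / 2 * Real.sqrt (μ / Lf)) ^ t ≤
        4 * (D * Real.sqrt (1 / μ) * Lf ^ (3 / 2 : ℝ)) := by
  have hLf : 0 < Lf := h0.trans_le h1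
  have hinv : ∀ t ≤ N, APGInv X f h μ Lf w (σ t) := by
    intro t
    induction t with
    | zero => intro _; rw [hσ]; exact APGInv.init hw h0 h1
    | succ t ih =>
      intro ht
      exact ((ih (by omega)).step hγ hμ hX hh hf (hstep t (by omega))).1
  refine ⟨hinv, fun t ht => ?_⟩
  have hgrow : ∀ t, t + 1 ≤ N → 0 < (σ (t + 1)).A ∧
      (1 + 1 / 2 * Real.sqrt (μ / Lf)) ^ t ≤ Real.sqrt Lf * Real.sqrt (σ (t + 1)).A := by
    intro t
    induction t with
    | zero =>
      intro ht
      obtain ⟨-, h2, h3, -⟩ := (hinv 0 (by omega)).step hγ hμ hX hh hf (hstep 0 (by omega))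
      -- From A₀ = 0 the growth inequality reads A₁ ≤ Lf A₁², so Lf A₁ ≥ 1 starts the geometric
      -- growth.
      have hA0 : (σ 0).A = 0 := by rw [hσ]; rfl
      rw [hA0] at h2 h3
      refine ⟨h2, ?_⟩
      rw [pow_zero, ← Real.sqrt_mul hLf.le, Real.one_le_sqrt]
      refine le_of_mul_le_mul_right ?_ h2
      simp only [mul_zero, add_zero, sub_zero] at h3
      linarith
    | succ t ih =>
      intro ht
      obtain ⟨h4, h5⟩ := ih (by omega)
      obtain ⟨-, h2, h3, -⟩ :=
        (hinv (t + 1) (by omega)).step hγ hμ hX hh hf (hstep (t + 1) (by omega))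
      refine ⟨h4.trans h2, ?_⟩
      have h6 := sqrt_growth (r := Real.sqrt (μ / Lf)) h4.le h2 (by
        rw [Real.sq_sqrt (by positivity), div_mul_eq_mul_div, div_mul_eq_mul_div,
          div_le_iff₀ hLf]
        nlinarith)
      calc (1 + 1 / 2 * Real.sqrt (μ / Lf)) ^ (t + 1)
          = (1 + 1 / 2 * Real.sqrt (μ / Lf)) ^ t * (1 + 1 / 2 * Real.sqrt (μ / Lf)) :=
            pow_succ _ _
        _ ≤ (Real.sqrt Lf * Real.sqrt (σ (t + 1)).A) * (1 + 1 / 2 * Real.sqrt (μ / Lf)) := by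
            gcongr
        _ = Real.sqrt Lf * ((1 + 1 / 2 * Real.sqrt (μ / Lf)) * Real.sqrt (σ (t + 1)).A) := by
            ring
        _ ≤ _ := by gcongr
  obtain ⟨xs, hxs, hmin⟩ := hXc.exists_isMinOn (f := fun z => f z + h z) ⟨w, hw⟩
    (hf.continuousOn.add hhc)
  have hmin' : ∀ u ∈ X, f xs + h xs ≤ f u + h u := fun u hu => hmin hu
  obtain ⟨hApos, hg⟩ := hgrow t (by omega)
  obtain ⟨hinv', hAlt, -, ξ, hξ, hξn⟩ :=
    (hinv (t + 1) (by omega)).step hγ hμ hX hh hf (hstep (t + 1) (by omega))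
  refine ⟨ξ, hξ, ?_⟩
  set A := (σ (t + 1)).A
  obtain ⟨hd1, hd2⟩ := (hinv (t + 1) (by omega)).dist_le hμ hh hf hD hw hxs hmin'
  obtain ⟨hd3, -⟩ := hinv'.dist_le hμ hh hf hD hw hxs hmin'
  set y := (σ (t + 1 + 1)).A⁻¹ •
    (A • (σ (t + 1)).x + ((σ (t + 1 + 1)).A - A) • (σ (t + 1)).v) with hy
  have hd4 : Real.sqrt (μ * A) * ‖y - xs‖ ≤ D := by
    have := norm_convex_comb_sub_le hApos.le (sub_pos.2 hAlt) (Real.sqrt_nonneg (μ * A)) hd1 hd2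
    rwa [add_sub_cancel] at this
  have hd5 : Real.sqrt (μ * A) * ‖(σ (t + 1 + 1)).x - xs‖ ≤ D := by
    refine le_trans ?_ hd3
    gcongr
  -- Since y is a convex combination of two points within D/√(μA) of the minimizer and A only grows,
  -- both ends of the proximal step lie in that ball.
  have hd6 : Real.sqrt (μ * A) * ‖y - (σ (t + 1 + 1)).x‖ ≤ 2 * D := by
    have : ‖y - (σ (t + 1 + 1)).x‖ ≤ ‖y - xs‖ + ‖(σ (t + 1 + 1)).x - xs‖ := by
      rw [norm_sub_rev (σ (t + 1 + 1)).x]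
      exact norm_sub_le_norm_sub_add_norm_sub _ _ _
    have := mul_le_mul_of_nonneg_left this (Real.sqrt_nonneg (μ * A))
    linarith
  have hsm : 0 < Real.sqrt μ := Real.sqrt_pos.2 hμ
  have hpow : Lf ^ (3 / 2 : ℝ) = Lf * Real.sqrt Lf := by
    rw [show (3 / 2 : ℝ) = 1 + 1 / 2 by norm_num, Real.rpow_add hLf, Real.rpow_one,
      Real.sqrt_eq_rpow]
  rw [hpow, Real.sqrt_div zero_le_one, Real.sqrt_one]
  rw [Real.sqrt_mul hμ.le] at hd6
  have : ‖ξ‖ * (1 + 1 / 2 * Real.sqrt (μ / Lf)) ^ t ≤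
      2 * Lf * ‖y - (σ (t + 1 + 1)).x‖ * (Real.sqrt Lf * Real.sqrt A) := by
    gcongr
  refine this.trans ?_
  have e : 4 * (D * (1 / Real.sqrt μ) * (Lf * Real.sqrt Lf)) =
      (2 * Lf * Real.sqrt Lf / Real.sqrt μ) * (2 * D) := by field_simp; ring
  have e' : 2 * Lf * ‖y - (σ (t + 1 + 1)).x‖ * (Real.sqrt Lf * Real.sqrt A) =
      (2 * Lf * Real.sqrt Lf / Real.sqrt μ) *
        (Real.sqrt μ * Real.sqrt A * ‖y - (σ (t + 1 + 1)).x‖) := by field_simp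
  rw [e, e']
  gcongr

theorem distZeroLE_of_mem {S : Set (Vec d)} {ξ : Vec d} {r : ℝ} (hξ : ξ ∈ S) (h : ‖ξ‖ ≤ r) :
    DistZeroLE S r := by
  refine (Metric.infEDist_le_edist_of_mem hξ).trans ?_
  rw [edist_dist, dist_zero_left]
  exact ENNReal.ofReal_le_ofReal h

/-- The number of iterations of the accelerated method. -/
theorem apg_iterations_le {w x : Vec d} {L0 γd Δ : ℝ} {N : ℕ} (hΔ : 0 < Δ)
    (hγ : 2 ≤ γd) (hμ : 0 < μ) (hXc : IsCompact X) (hX : Convex ℝ X)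
    (hhc : ContinuousOn h X) (hh : ConvexOn ℝ X (fun u => h u - μ / 2 * ‖u‖ ^ 2))
    (hf : SmoothConvexOn X f G Lf) (hD : ∀ x ∈ X, ∀ y ∈ X, ‖x - y‖ ≤ D) (hw : w ∈ X)
    (h0 : 0 < L0) (h1 : L0 ≤ Lf) (hout : APGOutputs X f h μ 2 γd Δ L0 w N x) :
    (N : ℝ) ≤ 2 + (2 * Real.sqrt (Lf / μ) + 1 / Real.log 2) *
      max 0 (Real.log (9 * Δ⁻¹ * D * Real.sqrt (1 / μ) * Lf ^ (3 / 2 : ℝ))) := by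
  have hLf : 0 < Lf := h0.trans_le h1
  have hlog2 : 0 < Real.log 2 := Real.log_pos one_lt_two
  obtain ⟨σ, hσ, hstep, -, hnot, -, -⟩ := hout
  rcases Nat.lt_or_ge N 3 with hN | hN
  · have : (N : ℝ) ≤ 2 := by exact_mod_cast (by omega : N ≤ 2)
    have : 0 ≤ (2 * Real.sqrt (Lf / μ) + 1 / Real.log 2) *
      max 0 (Real.log (9 * Δ⁻¹ * D * Real.sqrt (1 / μ) * Lf ^ (3 / 2 : ℝ))) := by positivity
    linarith
  -- Put N = n + 3: iterate n + 2 is the last one that fails the stopping test, and the residual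
  -- bound there carries the power n.
  obtain ⟨n, rfl⟩ := Nat.exists_eq_add_of_le' hN
  obtain ⟨-, hres⟩ := apg_residual hγ hμ hXc hX hhc hh hf hD hw h0 h1 hσ hstep
  obtain ⟨ξ, hξ, hξn⟩ := hres n (by omega)
  have hgt : Δ < ‖ξ‖ := by
    by_contra hcon
    exact hnot (n + 2) (by omega) (by omega) (distZeroLE_of_mem hξ (not_lt.1 hcon))
  set r := Real.sqrt (μ / Lf)
  have hr : 0 < r := Real.sqrt_pos.2 (by positivity)
  set R := Δ⁻¹ * (D * Real.sqrt (1 / μ) * Lf ^ (3 / 2 : ℝ)) with hR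
  have hq : (1 + 1 / 2 * r) ^ n ≤ 4 * R := by
    rw [hR, mul_left_comm, ← div_eq_inv_mul, le_div_iff₀ hΔ]
    refine le_trans ?_ hξn
    rw [mul_comm]
    gcongr
  have hqpos : 0 < (1 + 1 / 2 * r) ^ n := by positivity
  have hRpos : 0 < R := by linarith
  have hlog := Real.log_le_log hqpos hq
  rw [Real.log_pow] at hlog
  have h4R : 0 ≤ Real.log (4 * R) :=
    Real.log_nonneg ((one_le_pow₀ (by linarith)).trans hq)
  -- The bound log(1 + x) ≥ 2x/(x + 2) at x = r/2 has reciprocal exactly 2/r + 1/2.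
  have hl1 := Real.le_log_one_add_of_nonneg (x := 1 / 2 * r) (by positivity)
  have hn : (n : ℝ) ≤ (2 / r + 1 / 2) * Real.log (4 * R) := by
    have e1 : 2 * (1 / 2 * r) / (1 / 2 * r + 2) * (2 / r + 1 / 2) = 1 := by
      field_simp
      ring
    calc (n : ℝ) = n * (2 * (1 / 2 * r) / (1 / 2 * r + 2)) * (2 / r + 1 / 2) := by
          rw [mul_assoc, e1, mul_one]
      _ ≤ n * Real.log (1 + 1 / 2 * r) * (2 / r + 1 / 2) := by gcongr
      _ ≤ Real.log (4 * R) * (2 / r + 1 / 2) := by gcongr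
      _ = _ := mul_comm _ _
  have hinvr : 1 / r = Real.sqrt (Lf / μ) := by
    rw [← Real.sqrt_one, ← Real.sqrt_div zero_le_one, one_div_div]
  have h9 : Real.log (9 * Δ⁻¹ * D * Real.sqrt (1 / μ) * Lf ^ (3 / 2 : ℝ)) =
      Real.log (4 * R) + Real.log (9 / 4) := by
    rw [← Real.log_mul (by positivity) (by norm_num), hR]
    congr 1
    ring
  have h94 : Real.log 2 ≤ Real.log (9 / 4) := Real.log_le_log (by norm_num) (by norm_num)
  rw [h9, max_eq_right (by linarith), ← hinvr]
  have hl2 : 1 / 2 ≤ 1 / Real.log 2 := by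
    have : Real.log 2 ≤ 1 := by linarith [Real.log_two_lt_d9]
    rw [div_le_div_iff₀ two_pos hlog2]
    linarith
  -- Here 9 = 4 · (9/4): as log(9/4) ≥ log 2, the spare factor pays for the one step by which n + 3
  -- exceeds n + 2.
  have h11 : 1 ≤ 1 / Real.log 2 * Real.log (9 / 4) := by
    rw [one_div, ← div_eq_inv_mul, le_div_iff₀ hlog2]
    linarith
  have h12 : 0 ≤ 2 * (1 / r) * Real.log (9 / 4) :=
    mul_nonneg (by positivity) (hlog2.le.trans h94)
  have h13 : 1 / 2 * Real.log (4 * R) ≤ 1 / Real.log 2 * Real.log (4 * R) := by gcongr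
  have h14 : (2 / r + 1 / 2) * Real.log (4 * R) =
      2 * (1 / r) * Real.log (4 * R) + 1 / 2 * Real.log (4 * R) := by ring
  push_cast
  linarith

/-- The accelerated method stops. -/
theorem exists_apgOutputs {w : Vec d} {L0 γd Δ : ℝ} (hΔ : 0 < Δ)
    (hγ : 2 ≤ γd) (hμ : 0 < μ) (hXc : IsCompact X) (hX : Convex ℝ X)
    (hhc : ContinuousOn h X) (hh : ConvexOn ℝ X (fun u => h u - μ / 2 * ‖u‖ ^ 2))
    (hf : SmoothConvexOn X f G Lf) (hD : ∀ x ∈ X, ∀ y ∈ X, ‖x - y‖ ≤ D) (hw : w ∈ X)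
    (h0 : 0 < L0) (h1 : L0 ≤ Lf) :
    ∃ N x, APGOutputs X f h μ 2 γd Δ L0 w N x := by
  classical
  have hLf : 0 < Lf := h0.trans_le h1
  -- The iteration is continued forever on states satisfying the invariant, then cut at the first
  -- index that passes the test; the geometric bound supplies such an index.
  have hnext : ∀ s : {s : APGState d // APGInv X f h μ Lf w s},
      ∃ s' : {s : APGState d // APGInv X f h μ Lf w s}, APGStep X f h μ 2 γd w s.1 s'.1 := by
    rintro ⟨s, hs⟩
    obtain ⟨s', hs'⟩ := hs.exists_step (γd := γd) hμ hXc hX hhc hf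
    exact ⟨⟨s', (hs.step hγ hμ hX hh hf hs').1⟩, hs'⟩
  choose F hF using hnext
  set σ : ℕ → {s : APGState d // APGInv X f h μ Lf w s} :=
    fun t => F^[t] ⟨apgInit w L0, APGInv.init hw h0 h1⟩ with hσdef
  have hσ : ∀ t, APGStep X f h μ 2 γd w (σ t).1 (σ (t + 1)).1 := fun t => by
    simp only [hσdef, Function.iterate_succ_apply']
    exact hF _
  have hex : ∃ N, 0 < N ∧ DistZeroLE (subdiff X (fun u => f u + h u) (σ N).1.x) Δ := by
    have hq : 1 < 1 + 1 / 2 * Real.sqrt (μ / Lf) := by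
      have : 0 < Real.sqrt (μ / Lf) := Real.sqrt_pos.2 (by positivity)
      linarith
    obtain ⟨t, ht⟩ := pow_unbounded_of_one_lt
      (4 * (D * Real.sqrt (1 / μ) * Lf ^ (3 / 2 : ℝ)) / Δ) hq
    obtain ⟨-, hres⟩ := apg_residual (N := t + 2) (σ := fun t => (σ t).1)
      hγ hμ hXc hX hhc hh hf hD hw h0 h1 rfl (fun s _ => hσ s)
    obtain ⟨ξ, hξ, hξn⟩ := hres t le_rfl
    refine ⟨t + 2, by omega, distZeroLE_of_mem hξ ?_⟩
    rw [div_lt_iff₀ hΔ] at ht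
    have hqp : 0 < (1 + 1 / 2 * Real.sqrt (μ / Lf)) ^ t := by positivity
    refine le_of_mul_le_mul_right ?_ hqp
    linarith
  refine ⟨Nat.find hex, (σ (Nat.find hex)).1.x, fun t => (σ t).1, rfl, fun t _ => hσ t,
    (Nat.find_spec hex).1, fun t ht0 htN hd => Nat.find_min hex htN ⟨ht0, hd⟩,
    (Nat.find_spec hex).2, rfl⟩

end AcceleratedComplexity

/-! ### Cocoercivity of the pieces of the augmented Lagrangian -/

section SmoothFunctions

variable {d p : ℕ}

theorem hasGradientAt_of_quadratic {φ : Vec d → ℝ} {a x : Vec d} {C : ℝ}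
    (h : ∀ y, |φ y - φ x - inner ℝ a (y - x)| ≤ C * ‖y - x‖ ^ 2) : HasGradientAt φ a x := by
  rw [hasGradientAt_iff_isLittleO]
  refine Asymptotics.IsBigO.trans_isLittleO ?_ (Asymptotics.isLittleO_pow_sub_sub x one_lt_two)
  refine Asymptotics.IsBigO.of_bound C (Eventually.of_forall fun y => ?_)
  rw [Real.norm_eq_abs, Real.norm_of_nonneg (by positivity)]
  exact h y

/-- In every sign case the remainder of max(s, 0)² is at most (s - t)², so the kink at 0 is
harmless. -/
theorem hasDerivAt_half_sq_pos_part (β t : ℝ) :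
    HasDerivAt (fun s : ℝ => β / 2 * max s 0 ^ 2) (β * max t 0) t := by
  have h : HasDerivAt (fun s : ℝ => max s 0 ^ 2) (2 * max t 0) t := by
    rw [hasDerivAt_iff_isLittleO]
    refine Asymptotics.IsBigO.trans_isLittleO ?_
      (Asymptotics.isLittleO_pow_sub_sub t one_lt_two)
    refine Asymptotics.IsBigO.of_bound 1 (Eventually.of_forall fun s => ?_)
    rw [Real.norm_eq_abs, Real.norm_of_nonneg (by positivity), Real.norm_eq_abs, sq_abs, one_mul,
      smul_eq_mul, abs_le]
    rcases le_total s 0 with hs | hs <;> rcases le_total t 0 with ht | ht <;>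
      simp only [hs, ht, max_eq_left, max_eq_right] <;> constructor <;> nlinarith
  exact (h.const_mul (β / 2)).congr_deriv (by ring)

/-- The quadratic bound on the first-order Taylor remainder. -/
theorem norm_taylor_le {E F : Type*} [NormedAddCommGroup E] [NormedSpace ℝ E]
    [NormedAddCommGroup F] [NormedSpace ℝ F] {φ : E → F} {φ' : E → E →L[ℝ] F} {x y : E} {L : ℝ}
    (hd : ∀ t ∈ Set.Icc (0 : ℝ) 1, HasFDerivAt φ (φ' (x + t • (y - x))) (x + t • (y - x)))
    (hL : ∀ t ∈ Set.Icc (0 : ℝ) 1, ‖φ' (x + t • (y - x)) - φ' x‖ ≤ L * (t * ‖y - x‖)) :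
    ‖φ y - φ x - φ' x (y - x)‖ ≤ L / 2 * ‖y - x‖ ^ 2 := by
  set w := y - x with hw
  have hline : ∀ t : ℝ, HasDerivAt (fun s : ℝ => x + s • w) w t := fun t => by
    simpa using ((hasDerivAt_id t).smul_const w).const_add x
  have hder : ∀ t ∈ Set.Icc (0 : ℝ) 1,
      HasDerivAt (fun s : ℝ => φ (x + s • w) - φ x - s • φ' x w)
        (φ' (x + t • w) w - φ' x w) t := fun t ht => by
    have h1 := ((hd t ht).comp_hasDerivAt t (hline t)).sub_const (φ x)
    have h2 := (hasDerivAt_id t).smul_const (φ' x w)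
    rw [one_smul] at h2
    exact h1.sub h2
  have hB : ∀ t : ℝ, HasDerivAt (fun s : ℝ => L / 2 * ‖w‖ ^ 2 * s ^ 2) (L * ‖w‖ ^ 2 * t) t :=
    fun t => ((hasDerivAt_pow 2 t).const_mul (L / 2 * ‖w‖ ^ 2)).congr_deriv (by ring)
  have key := image_norm_le_of_norm_deriv_right_le_deriv_boundary
    (f := fun s : ℝ => φ (x + s • w) - φ x - s • φ' x w) (a := 0) (b := 1)
    (f' := fun t => φ' (x + t • w) w - φ' x w)
    (fun t ht => (hder t ht).continuousAt.continuousWithinAt)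
    (fun t ht => (hder t ⟨ht.1, ht.2.le⟩).hasDerivWithinAt)
    (by simp) hB (fun t ht => by
      rw [← sub_apply]
      refine (ContinuousLinearMap.le_opNorm _ _).trans ?_
      have := mul_le_mul_of_nonneg_right (hL t ⟨ht.1, ht.2.le⟩) (norm_nonneg w)
      calc _ ≤ _ := this
        _ = _ := by ring) (x := 1) (by simp)
  simpa [hw] using key

theorem norm_gradient_sub (φ : Vec d → ℝ) (x y : Vec d) :
    ‖fderiv ℝ φ x - fderiv ℝ φ y‖ = ‖gradient φ x - gradient φ y‖ := by
  rw [gradient, gradient, ← map_sub, LinearIsometryEquiv.norm_map]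

theorem convex_gradient_le {X : Set (Vec d)} {φ : Vec d → ℝ} (hφ : ConvexOn ℝ X φ)
    {a x y : Vec d} (hx : x ∈ X) (hy : y ∈ X) (hg : HasGradientAt φ a x) :
    φ x + inner ℝ a (y - x) ≤ φ y := by
  have h1 : HasGradientAt (fun u => -φ u) (-a) x := by
    rw [hasGradientAt_iff_hasFDerivAt] at hg ⊢
    rw [map_neg]
    exact hg.neg
  have := inner_sub_grad_le (ζ := 0) hφ hx h1 (fun u _ => by simp) hy
  rw [zero_sub, neg_neg] at this
  linarith

/-- Half of the cocoercivity inequality on a ball. -/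
theorem grad_sub_sq_le_aux {U : Set (Vec d)} {φ : Vec d → ℝ} {L r : ℝ} {x0 x y : Vec d}
    (hφ : ConvexOn ℝ Set.univ φ) (hd : ∀ x ∈ U, DifferentiableAt ℝ φ x) (hL : 0 < L)
    (hlip : ∀ x ∈ U, ∀ x' ∈ U, ‖gradient φ x - gradient φ x'‖ ≤ L * ‖x - x'‖)
    (hball : Metric.ball x0 r ⊆ U) (hx : x ∈ Metric.ball x0 (r / 3))
    (hy : y ∈ Metric.ball x0 (r / 3)) :
    ‖gradient φ y - gradient φ x‖ ^ 2 / (2 * L) ≤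
      φ y - φ x - inner ℝ (gradient φ x) (y - x) := by
  have hr : 0 < r / 3 := Metric.pos_of_mem_ball hx
  have hsub : Metric.ball x0 (r / 3) ⊆ U :=
    (Metric.ball_subset_ball (by linarith)).trans hball
  set Δ := gradient φ y - gradient φ x with hΔ
  -- A gradient-type step from y. The Lipschitz bound gives ‖z - y‖ ≤ ‖y - x‖, so z stays in the
  -- ball of radius r; hence the thirds. Convexity at x bounds φ(z) from below, Taylor at y from
  -- above.
  set z := y - (1 / L) • Δ with hz
  have hzy : ‖z - y‖ ≤ ‖y - x‖ := by
    rw [hz, sub_sub_cancel_left, norm_neg, norm_smul, Real.norm_of_nonneg (by positivity), one_div,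
      inv_mul_le_iff₀ hL]
    exact hlip y (hsub hy) x (hsub hx)
  have hzU : z ∈ Metric.ball x0 r := by
    rw [mem_ball_iff_norm] at hx hy ⊢
    have h1 : ‖z - x0‖ ≤ ‖z - y‖ + ‖y - x0‖ := norm_sub_le_norm_sub_add_norm_sub _ _ _
    have h2 : ‖y - x‖ ≤ ‖y - x0‖ + ‖x - x0‖ := by
      rw [norm_sub_rev x]
      exact norm_sub_le_norm_sub_add_norm_sub _ _ _
    linarith
  have hyB : y ∈ Metric.ball x0 r := Metric.ball_subset_ball (by linarith) hy
  have hseg : ∀ t ∈ Set.Icc (0 : ℝ) 1, y + t • (z - y) ∈ U := fun t ht =>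
    hball ((convex_ball x0 r).add_smul_sub_mem hyB hzU ht)
  have htay := norm_taylor_le (φ := φ) (φ' := fderiv ℝ φ) (x := y) (y := z) (L := L)
    (fun t ht => (hd _ (hseg t ht)).hasFDerivAt)
    (fun t ht => by
      rw [norm_gradient_sub]
      refine (hlip _ (hseg t ht) y (hball hyB)).trans_eq ?_
      rw [add_sub_cancel_left, norm_smul, Real.norm_of_nonneg ht.1])
  rw [← inner_gradient_left, Real.norm_eq_abs] at htay
  have h1 := (abs_le.1 htay).2
  have h2 := convex_gradient_le hφ (Set.mem_univ x) (Set.mem_univ z)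
    (hd x (hsub hx)).hasGradientAt
  have h3 : z - x = (y - x) - (1 / L) • Δ := by rw [hz]; abel
  have h4 : z - y = -((1 / L) • Δ) := by rw [hz]; abel
  rw [h3, inner_sub_right, real_inner_smul_right] at h2
  rw [h4, inner_neg_right, real_inner_smul_right, norm_neg, norm_smul,
    Real.norm_of_nonneg (by positivity)] at h1
  have h5 : inner ℝ (gradient φ y) Δ - inner ℝ (gradient φ x) Δ = ‖Δ‖ ^ 2 := by
    rw [← inner_sub_left, real_inner_self_eq_norm_sq]
  have h6 : 1 / L * inner ℝ (gradient φ y) Δ = 1 / L * inner ℝ (gradient φ x) Δ +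
      1 / L * ‖Δ‖ ^ 2 := by rw [← h5]; ring
  have h7 : L / 2 * (1 / L * ‖Δ‖) ^ 2 = 1 / L * ‖Δ‖ ^ 2 / 2 := by field_simp
  have h8 : ‖Δ‖ ^ 2 / (2 * L) = 1 / L * ‖Δ‖ ^ 2 / 2 := by field_simp
  linarith

/-- Adding the one-sided estimate for both orders of the points cancels the function values; for L =
0 the gradient is constant on the ball. -/
theorem gradient_coco_ball {U : Set (Vec d)} {φ : Vec d → ℝ} {L r : ℝ} {x0 x y : Vec d}
    (hφ : ConvexOn ℝ Set.univ φ) (hd : ∀ x ∈ U, DifferentiableAt ℝ φ x) (hL : 0 ≤ L)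
    (hlip : ∀ x ∈ U, ∀ x' ∈ U, ‖gradient φ x - gradient φ x'‖ ≤ L * ‖x - x'‖)
    (hball : Metric.ball x0 r ⊆ U) (hx : x ∈ Metric.ball x0 (r / 3))
    (hy : y ∈ Metric.ball x0 (r / 3)) :
    ‖gradient φ y - gradient φ x‖ ^ 2 ≤ L * inner ℝ (gradient φ y - gradient φ x) (y - x) := by
  rcases hL.eq_or_lt with rfl | hL
  · have hr : 0 < r / 3 := Metric.pos_of_mem_ball hx
    have hsub : Metric.ball x0 (r / 3) ⊆ U :=
      (Metric.ball_subset_ball (by linarith)).trans hball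
    have := hlip y (hsub hy) x (hsub hx)
    rw [zero_mul, norm_le_zero_iff] at this
    rw [this]
    simp
  have h1 := grad_sub_sq_le_aux hφ hd hL hlip hball hx hy
  have h2 := grad_sub_sq_le_aux hφ hd hL hlip hball hy hx
  rw [norm_sub_rev, ← neg_sub y x, inner_neg_right] at h2
  have h3 : ‖gradient φ y - gradient φ x‖ ^ 2 =
      L * (‖gradient φ y - gradient φ x‖ ^ 2 / (2 * L) +
        ‖gradient φ y - gradient φ x‖ ^ 2 / (2 * L)) := by field_simp; ring
  rw [h3]
  refine mul_le_mul_of_nonneg_left ?_ hL.le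
  rw [inner_sub_left]
  linarith

/-- A convex function whose gradient is Lipschitz near the convex set `X` has a cocoercive
gradient on `X`. -/
theorem smoothConvexOn_of_lipschitz {X U : Set (Vec d)} {φ : Vec d → ℝ} {L : ℝ}
    (hX : Convex ℝ X) (hU : IsOpen U) (hXU : X ⊆ U)
    (hφ : ConvexOn ℝ Set.univ φ) (hd : ∀ x ∈ U, DifferentiableAt ℝ φ x) (hL : 0 ≤ L)
    (hlip : ∀ x ∈ U, ∀ x' ∈ U, ‖gradient φ x - gradient φ x'‖ ≤ L * ‖x - x'‖) :
    SmoothConvexOn X φ (gradient φ) L where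
  grad x hx := (hd x (hXU hx)).hasGradientAt
  le x hx y _ := convex_gradient_le hφ (Set.mem_univ x) (Set.mem_univ y)
    (hd x (hXU hx)).hasGradientAt
  coco := by
    intro y hy x hx
    have hK : IsCompact (segment ℝ x y) := by
      rw [segment_eq_image']
      exact isCompact_Icc.image (by fun_prop)
    -- U need not be convex, so only local cocoercivity is available. The compact segment has a
    -- δ-tube inside U and is cut into N pieces shorter than δ/3.
    obtain ⟨δ, hδ, hδU⟩ := hK.exists_thickening_subset_open hU ((hX.segment_subset hx hy).trans hXU)
    obtain ⟨N, hN⟩ := exists_nat_gt (‖y - x‖ / (δ / 3))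
    have hNpos : (0 : ℝ) < N := (by positivity : 0 ≤ ‖y - x‖ / (δ / 3)).trans_lt hN
    set q : ℕ → Vec d := fun i => x + ((i : ℝ) / N) • (y - x) with hq
    have hqseg : ∀ i ≤ N, q i ∈ segment ℝ x y := fun i hi => by
      rw [segment_eq_image']
      exact ⟨(i : ℝ) / N, ⟨by positivity, by rw [div_le_one hNpos]; exact_mod_cast hi⟩, rfl⟩
    have hqstep : ∀ i, q (i + 1) - q i = (1 / (N : ℝ)) • (y - x) := fun i => by
      simp only [hq]
      push_cast
      module
    have hloc : ∀ i < N, ‖gradient φ (q (i + 1)) - gradient φ (q i)‖ ^ 2 ≤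
        L * (1 / N * inner ℝ (gradient φ (q (i + 1)) - gradient φ (q i)) (y - x)) := by
      intro i hi
      have h1 := gradient_coco_ball (x0 := q i) (r := δ) (x := q i) (y := q (i + 1)) hφ hd hL hlip
        (fun u hu => hδU (Metric.mem_thickening_iff.2 ⟨q i, hqseg i hi.le, hu⟩))
        (Metric.mem_ball_self (by positivity))
        (by
          rw [mem_ball_iff_norm, hqstep, norm_smul, Real.norm_of_nonneg (by positivity), one_div,
            inv_mul_lt_iff₀ hNpos]
          rwa [div_lt_iff₀ (by positivity)] at hN)
      rwa [hqstep, real_inner_smul_right] at h1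
    have htel : ∑ i ∈ Finset.range N, (gradient φ (q (i + 1)) - gradient φ (q i)) =
        gradient φ y - gradient φ x := by
      rw [Finset.sum_range_sub (fun i => gradient φ (q i))]
      simp [hq, hNpos.ne']
    rw [← htel]
    -- Squaring the sum of N norms costs a factor N, and each piece carries 1/N from its length: the
    -- constant L survives unchanged.
    calc ‖∑ i ∈ Finset.range N, (gradient φ (q (i + 1)) - gradient φ (q i))‖ ^ 2
        ≤ (∑ i ∈ Finset.range N, ‖gradient φ (q (i + 1)) - gradient φ (q i)‖) ^ 2 := by
          gcongr
          exact norm_sum_le _ _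
      _ ≤ N * ∑ i ∈ Finset.range N, ‖gradient φ (q (i + 1)) - gradient φ (q i)‖ ^ 2 := by
          simpa using sq_sum_le_card_mul_sum_sq (s := Finset.range N)
            (f := fun i => ‖gradient φ (q (i + 1)) - gradient φ (q i)‖)
      _ ≤ N * ∑ i ∈ Finset.range N,
          L * (1 / N * inner ℝ (gradient φ (q (i + 1)) - gradient φ (q i)) (y - x)) := by
          gcongr with i hi
          exact hloc i (Finset.mem_range.1 hi)
      _ = _ := by
          rw [sum_inner, ← Finset.mul_sum, ← Finset.mul_sum]
          field_simp

/-- Precomposition with an affine map. -/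
theorem SmoothConvexOn.comp_affine {φ : Vec p → ℝ} {H : Vec p → Vec p} {L : ℝ}
    (hφ : SmoothConvexOn Set.univ φ H L) (T : Vec d →L[ℝ] Vec p) (a : Vec p)
    (b : Vec d) (X : Set (Vec d)) :
    SmoothConvexOn X (fun x => φ (a + T (x - b)))
      (fun x => ContinuousLinearMap.adjoint T (H (a + T (x - b)))) (‖T‖ ^ 2 * L) where
  grad x _ := by
    have h1 := hasGradientAt_iff_hasFDerivAt.1 (hφ.grad (a + T (x - b)) (Set.mem_univ _))
    have h2 : HasFDerivAt (fun x => a + T (x - b)) T x :=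
      (T.hasFDerivAt.comp x ((hasFDerivAt_id x).sub_const b)).const_add a
    rw [hasGradientAt_iff_hasFDerivAt]
    refine (h1.comp x h2).congr_fderiv ?_
    ext v
    simp [ContinuousLinearMap.adjoint_inner_left]
  le x _ y _ := by
    have := hφ.le (a + T (x - b)) (Set.mem_univ _) (a + T (y - b)) (Set.mem_univ _)
    rw [ContinuousLinearMap.adjoint_inner_left]
    convert this using 3
    rw [add_sub_add_left_eq_sub, ← map_sub, sub_sub_sub_cancel_right]
  coco x _ y _ := by
    have := hφ.coco (a + T (x - b)) (Set.mem_univ _) (a + T (y - b)) (Set.mem_univ _)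
    rw [add_sub_add_left_eq_sub, ← map_sub, sub_sub_sub_cancel_right] at this
    rw [← map_sub, ContinuousLinearMap.adjoint_inner_left, mul_assoc]
    refine le_trans ?_ (mul_le_mul_of_nonneg_left this (by positivity))
    rw [← mul_pow]
    gcongr
    refine (ContinuousLinearMap.le_opNorm _ _).trans_eq ?_
    rw [LinearIsometryEquiv.norm_map]

/-- The augmented-Lagrangian term of one convex inequality constraint. -/
theorem SmoothConvexOn.half_sq_pos_part {X : Set (Vec d)} {g : Vec d → ℝ} {G : Vec d → Vec d}
    {L B β z : ℝ} (hg : SmoothConvexOn X g G L) (hL : 0 ≤ L) (hB : 0 ≤ B) (hβ : 0 < β)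
    (hz : 0 ≤ z) (hgB : ∀ x ∈ X, |g x| ≤ B) (hGB : ∀ x ∈ X, ‖G x‖ ≤ B) :
    SmoothConvexOn X (fun x => β / 2 * max (g x + z / β) 0 ^ 2)
      (fun x => max (z + β * g x) 0 • G x) (β * B ^ 2 + L * (β * B + z)) := by
  have hmax : ∀ x, max (z + β * g x) 0 = β * max (g x + z / β) 0 := fun x => by
    rw [mul_max_of_nonneg _ _ hβ.le, mul_zero, mul_add, mul_div_cancel₀ _ hβ.ne', add_comm]
  have hsq : ∀ s t : ℝ, β / 2 * max s 0 ^ 2 + β * max s 0 * (t - s) ≤ β / 2 * max t 0 ^ 2 := by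
    intro s t
    have : max s 0 ^ 2 + 2 * max s 0 * (t - s) ≤ max t 0 ^ 2 := by
      rcases le_total s 0 with hs | hs <;> rcases le_total t 0 with ht | ht <;>
        simp only [hs, ht, max_eq_left, max_eq_right] <;> nlinarith [sq_nonneg (t - s)]
    nlinarith
  -- cocoercivity when the multiplier at the first point is the larger one
  have hcoco : ∀ x ∈ X, ∀ y ∈ X, max (z + β * g y) 0 ≤ max (z + β * g x) 0 →
      ‖max (z + β * g x) 0 • G x - max (z + β * g y) 0 • G y‖ ^ 2 ≤
        (β * B ^ 2 + L * (β * B + z)) *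
          inner ℝ (max (z + β * g x) 0 • G x - max (z + β * g y) 0 • G y) (x - y) := by
    intro x hx y hy hle
    set a := max (z + β * g x) 0
    set a' := max (z + β * g y) 0
    have ha'0 : 0 ≤ a' := le_max_right _ _
    have ha'B : a' ≤ β * B + z := by
      refine max_le ?_ (by positivity)
      have := (abs_le.1 (hgB y hy)).2
      nlinarith
    -- If a > a' ≥ 0, then a is not truncated, and a - a' ≤ β(g x - g y) ≤ β⟨∇g(x), x - y⟩ by
    -- convexity.
    have hdiff : (a - a') * (a - a') ≤ (a - a') * (β * inner ℝ (G x) (x - y)) := by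
      rcases hle.eq_or_lt with h | h
      · rw [h]; simp
      · have hapos : 0 < a := ha'0.trans_lt h
        have ha : a = z + β * g x := by
          rcases le_total (z + β * g x) 0 with h0 | h0
          · exact absurd hapos (by simp [a, h0])
          · exact max_eq_left h0
        have ha' : z + β * g y ≤ a' := le_max_left _ _
        have h1 := hg.le x hx y hy
        rw [← neg_sub x y, inner_neg_right] at h1
        refine mul_le_mul_of_nonneg_left ?_ (by linarith)
        nlinarith
    -- The first piece is controlled with constant βB², the second with L a' ≤ L(βB + z); the two
    -- constants add.
    have e : a • G x - a' • G y = (a - a') • G x + a' • (G x - G y) := by module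
    have i1 : inner ℝ ((a - a') • G x) (x - y) = (a - a') * inner ℝ (G x) (x - y) :=
      real_inner_smul_left _ _ _
    have i2 : inner ℝ (a' • (G x - G y)) (x - y) = a' * inner ℝ (G x - G y) (x - y) :=
      real_inner_smul_left _ _ _
    have hmono := hg.mono_inner hx hy
    have hs : 0 ≤ (a - a') * inner ℝ (G x) (x - y) := by
      have : 0 ≤ β * ((a - a') * inner ℝ (G x) (x - y)) := by nlinarith [sq_nonneg (a - a')]
      exact nonneg_of_mul_nonneg_right this hβ
    rw [e, inner_add_left, i1, i2]
    refine norm_add_sq_le_of_coco (by positivity) (by positivity) hs (by positivity) ?_ ?_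
    · rw [norm_smul, mul_pow, Real.norm_eq_abs, sq_abs]
      have : ‖G x‖ ^ 2 ≤ B ^ 2 := by gcongr; exact hGB x hx
      calc (a - a') ^ 2 * ‖G x‖ ^ 2 ≤ (a - a') ^ 2 * B ^ 2 := by gcongr
        _ ≤ ((a - a') * (β * inner ℝ (G x) (x - y))) * B ^ 2 := by
            gcongr
            linarith
        _ = _ := by ring
    · rw [norm_smul, mul_pow, Real.norm_of_nonneg ha'0]
      calc a' ^ 2 * ‖G x - G y‖ ^ 2 ≤ a' ^ 2 * (L * inner ℝ (G x - G y) (x - y)) := by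
            gcongr
            exact hg.coco x hx y hy
        _ = L * a' * (a' * inner ℝ (G x - G y) (x - y)) := by ring
        _ ≤ _ := by gcongr
  refine ⟨fun x hx => ?_, fun x hx y hy => ?_, fun x hx y hy => ?_⟩
  · have h1 := hasGradientAt_iff_hasFDerivAt.1 (hg.grad x hx)
    have h2 := (hasDerivAt_half_sq_pos_part β (g x + z / β)).comp_hasFDerivAt x
      (h1.add_const (z / β))
    rw [hasGradientAt_iff_hasFDerivAt]
    refine h2.congr_fderiv ?_
    rw [hmax]
    ext v
    simp
  · rw [hmax, real_inner_smul_left]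
    have h1 := hsq (g x + z / β) (g y + z / β)
    have h2 := hg.le x hx y hy
    have h3 : 0 ≤ β * max (g x + z / β) 0 := by positivity
    nlinarith
  · rcases le_total (max (z + β * g y) 0) (max (z + β * g x) 0) with h | h
    · exact hcoco x hx y hy h
    · have := hcoco y hy x hx h
      rw [norm_sub_rev]
      refine this.trans_eq ?_
      rw [← neg_sub x y, inner_neg_right, ← inner_neg_left, neg_sub]

/-- The linear-quadratic penalty of the equality constraints. -/
theorem smoothConvexOn_penalty (y : Vec p) {β : ℝ} (hβ : 0 < β) :
    SmoothConvexOn Set.univ (fun r : Vec p => inner ℝ y r + β / 2 * ‖r‖ ^ 2)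
      (fun r => y + β • r) β where
  grad r _ := by
    have h1 := hasGradientAt_quad β (0 : Vec p) r
    simp only [sub_zero] at h1
    refine hasGradientAt_add ?_ h1
    rw [hasGradientAt_iff_hasFDerivAt]
    exact (InnerProductSpace.toDual ℝ (Vec p) y).hasFDerivAt
  le r _ s _ := by
    have h := norm_sq_eq_add_inner s r 0
    simp only [sub_zero] at h
    rw [h, inner_add_left, inner_sub_right y, real_inner_smul_left]
    nlinarith [sq_nonneg ‖s - r‖]
  coco r _ s _ := by
    have h : y + β • r - (y + β • s) = β • (r - s) := by module
    rw [h, real_inner_smul_left, real_inner_self_eq_norm_sq, norm_smul, mul_pow,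
      Real.norm_of_nonneg hβ.le]
    linarith

end SmoothFunctions

/-! ### The Moreau envelope of a convex Lipschitz function -/

section MoreauEnvelope

variable {p : ℕ} {l : Vec p → ℝ} {M ν : ℝ}

theorem moreau_objective_ge (hν : 0 < ν) (hl : ∀ u u', |l u - l u'| ≤ M * ‖u - u'‖)
    (u z : Vec p) : l u - ν * M ^ 2 / 2 ≤ l z + 1 / (2 * ν) * ‖z - u‖ ^ 2 := by
  have h1 := (abs_le.1 (hl z u)).1
  have h2 : 0 ≤ (‖z - u‖ - ν * M) ^ 2 / (2 * ν) := by positivity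
  have h3 : (‖z - u‖ - ν * M) ^ 2 / (2 * ν) =
      1 / (2 * ν) * ‖z - u‖ ^ 2 - M * ‖z - u‖ + ν * M ^ 2 / 2 := by
    field_simp
    ring
  linarith

/-- Outside the ball of radius 2νM around u the quadratic outweighs the Lipschitz decrease, so a
minimizer over that compact ball is global. The sign of M is not assumed, whence max M 0. -/
theorem exists_moreau_eq (hν : 0 < ν) (hl : ∀ u u', |l u - l u'| ≤ M * ‖u - u'‖) (u : Vec p) :
    ∃ x, moreau ν l u = l x + 1 / (2 * ν) * ‖x - u‖ ^ 2 ∧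
      ∀ z, l x + 1 / (2 * ν) * ‖x - u‖ ^ 2 ≤ l z + 1 / (2 * ν) * ‖z - u‖ ^ 2 := by
  have hcont : Continuous l :=
    (LipschitzWith.of_dist_le_mul (K := M.toNNReal) fun a b => by
      rw [Real.dist_eq, dist_eq_norm]
      exact (hl a b).trans (by gcongr; exact Real.le_coe_toNNReal M)).continuous
  have hM : 0 ≤ max M 0 := le_max_right _ _
  obtain ⟨x, -, hx⟩ := (isCompact_closedBall u (2 * ν * max M 0)).exists_isMinOn
    (f := fun z => l z + 1 / (2 * ν) * ‖z - u‖ ^ 2)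
    ⟨u, Metric.mem_closedBall_self (by positivity)⟩ (by fun_prop)
  have hall : ∀ z, l x + 1 / (2 * ν) * ‖x - u‖ ^ 2 ≤ l z + 1 / (2 * ν) * ‖z - u‖ ^ 2 := by
    intro z
    by_cases hz : z ∈ Metric.closedBall u (2 * ν * max M 0)
    · exact hx hz
    · rw [mem_closedBall_iff_norm, not_le] at hz
      have h1 : l x + 1 / (2 * ν) * ‖x - u‖ ^ 2 ≤ l u + 1 / (2 * ν) * ‖u - u‖ ^ 2 :=
        hx (Metric.mem_closedBall_self (by positivity))
      rw [sub_self, norm_zero, zero_pow two_ne_zero, mul_zero, add_zero] at h1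
      have h2 := (abs_le.1 (hl z u)).1
      have h3 : M * ‖z - u‖ ≤ 1 / (2 * ν) * ‖z - u‖ ^ 2 := by
        have h4 : M * ‖z - u‖ ≤ max M 0 * ‖z - u‖ := by gcongr; exact le_max_left _ _
        have h5 : max M 0 * ‖z - u‖ = 1 / (2 * ν) * ((2 * ν * max M 0) * ‖z - u‖) := by
          field_simp
        have h6 : 1 / (2 * ν) * ((2 * ν * max M 0) * ‖z - u‖) ≤
            1 / (2 * ν) * (‖z - u‖ * ‖z - u‖) := by gcongr
        rw [sq]
        linarith
      linarith
  refine ⟨x, le_antisymm (ciInf_le ⟨_, Set.forall_mem_range.2 hall⟩ x) (le_ciInf hall), hall⟩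

theorem moreau_le (hν : 0 < ν) (hl : ∀ u u', |l u - l u'| ≤ M * ‖u - u'‖) (u z : Vec p) :
    moreau ν l u ≤ l z + 1 / (2 * ν) * ‖z - u‖ ^ 2 := by
  obtain ⟨x, hx, hmin⟩ := exists_moreau_eq hν hl u
  rw [hx]
  exact hmin z

theorem moreau_le_self (hν : 0 < ν) (hl : ∀ u u', |l u - l u'| ≤ M * ‖u - u'‖) (u : Vec p) :
    moreau ν l u ≤ l u := by
  simpa using moreau_le hν hl u u

theorem le_moreau (hν : 0 < ν) (hl : ∀ u u', |l u - l u'| ≤ M * ‖u - u'‖) (u : Vec p) :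
    l u - ν * M ^ 2 / 2 ≤ moreau ν l u := by
  obtain ⟨x, hx, -⟩ := exists_moreau_eq hν hl u
  rw [hx]
  exact moreau_objective_ge hν hl u x

/-- Translating the minimizer for u' by u - u' leaves the quadratic unchanged and moves l by at most
M‖u - u'‖. -/
theorem moreau_lipschitz (hν : 0 < ν) (hl : ∀ u u', |l u - l u'| ≤ M * ‖u - u'‖)
    (u u' : Vec p) : moreau ν l u - moreau ν l u' ≤ M * ‖u - u'‖ := by
  obtain ⟨x, hx, -⟩ := exists_moreau_eq hν hl u'
  have h1 := moreau_le hν hl u (x + (u - u'))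
  have h2 := (abs_le.1 (hl (x + (u - u')) x)).2
  rw [add_sub_cancel_left] at h2
  rw [show x + (u - u') - u = x - u' by abel] at h1
  linarith

/-- The Moreau envelope of a convex Lipschitz function is convex and `1/ν`-smooth. -/
theorem exists_smoothConvexOn_moreau (hν : 0 < ν) (hc : ConvexOn ℝ Set.univ l)
    (hl : ∀ u u', |l u - l u'| ≤ M * ‖u - u'‖) :
    ∃ H : Vec p → Vec p, SmoothConvexOn Set.univ (moreau ν l) H (1 / ν) := by
  choose P hP hmin using exists_moreau_eq hν hl
  have hsub : ∀ u z, inner ℝ ((1 / ν) • (u - P u)) (z - P u) ≤ l z - l (P u) := by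
    intro u z
    have h1 := inner_sub_grad_le (ζ := 0) hc (Set.mem_univ (P u))
      (hasGradientAt_quad (1 / ν) u (P u)) (fun v _ => by
        have := hmin u v
        rw [show 1 / (2 * ν) = 1 / ν / 2 by field_simp] at this
        rw [inner_zero_left]
        linarith) (Set.mem_univ z)
    rwa [zero_sub, ← smul_neg, neg_sub] at h1
  -- The lower bound uses that (u - P u)/ν is a subgradient of l at the proximal point P u; the
  -- upper bound tests the envelope at u' with P u. Together they give differentiability.
  have hlow : ∀ u u', moreau ν l u + inner ℝ ((1 / ν) • (u - P u)) (u' - u) ≤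
      moreau ν l u' := by
    intro u u'
    have h1 := hsub u (P u')
    rw [hP u, hP u']
    have h2 := norm_sq_eq_add_inner (P u' - u') (P u - u) 0
    simp only [sub_zero] at h2
    have h3 : inner ℝ ((1 / ν) • (u - P u)) (P u' - P u) =
        - (1 / ν * inner ℝ (P u - u) (P u' - u' - (P u - u))) +
          inner ℝ ((1 / ν) • (u - P u)) (u' - u) := by
      rw [← real_inner_smul_left, ← inner_neg_left, ← smul_neg, neg_sub, ← inner_add_right]
      congr 1
      abel
    have h4 : 1 / (2 * ν) * ‖P u' - u'‖ ^ 2 = 1 / (2 * ν) * ‖P u' - u' - (P u - u)‖ ^ 2 +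
        1 / ν * inner ℝ (P u - u) (P u' - u' - (P u - u)) + 1 / (2 * ν) * ‖P u - u‖ ^ 2 := by
      rw [h2]
      field_simp
    have h5 : 0 ≤ 1 / (2 * ν) * ‖P u' - u' - (P u - u)‖ ^ 2 := by positivity
    linarith
  have hup : ∀ u u', moreau ν l u' ≤ moreau ν l u + inner ℝ ((1 / ν) • (u - P u)) (u' - u) +
      1 / (2 * ν) * ‖u' - u‖ ^ 2 := by
    intro u u'
    have h1 := moreau_le hν hl u' (P u)
    have h2 := norm_sub_sq_real (P u - u) (u' - u)
    rw [sub_sub_sub_cancel_right] at h2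
    rw [hP u]
    have h3 : inner ℝ ((1 / ν) • (u - P u)) (u' - u) = - (1 / ν * inner ℝ (P u - u) (u' - u)) := by
      rw [← real_inner_smul_left, ← inner_neg_left, ← smul_neg, neg_sub]
    have h4 : 1 / (2 * ν) * ‖P u - u'‖ ^ 2 = 1 / (2 * ν) * ‖P u - u‖ ^ 2 -
        1 / ν * inner ℝ (P u - u) (u' - u) + 1 / (2 * ν) * ‖u' - u‖ ^ 2 := by
      rw [h2]
      field_simp
    linarith
  refine ⟨fun u => (1 / ν) • (u - P u), fun u _ => ?_, fun u _ u' _ => hlow u u',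
    fun u _ u' _ => ?_⟩
  · refine hasGradientAt_of_quadratic (C := 1 / (2 * ν)) fun u' => ?_
    rw [abs_le]
    have h1 := hlow u u'
    have h2 := hup u u'
    have h3 : 0 ≤ 1 / (2 * ν) * ‖u' - u‖ ^ 2 := by positivity
    constructor <;> linarith
  · have h1 := hsub u (P u')
    have h2 := hsub u' (P u)
    set e := (1 / ν) • (u - P u) - (1 / ν) • (u' - P u') with he
    -- Subgradients of l are monotone, so ⟨e, P u - P u'⟩ ≥ 0 and ⟨e, u - u'⟩ ≥ ν‖e‖².
    have h3 : u - u' = (P u - P u') + ν • e := by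
      rw [he, ← smul_sub, smul_smul, mul_one_div_cancel hν.ne']
      module
    have h4 : 0 ≤ inner ℝ e (P u - P u') := by
      rw [← neg_sub (P u) (P u'), inner_neg_right] at h1
      rw [he, inner_sub_left]
      linarith
    rw [h3, inner_add_right, real_inner_smul_right, real_inner_self_eq_norm_sq, mul_add,
      ← mul_assoc, one_div_mul_cancel hν.ne', one_mul]
    have : 0 ≤ 1 / ν * inner ℝ e (P u - P u') := by positivity
    linarith

end MoreauEnvelope

theorem SmoothConvexOn.convexOn {d : ℕ} {X : Set (Vec d)} {φ : Vec d → ℝ} {G : Vec d → Vec d}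
    {L : ℝ} (hφ : SmoothConvexOn X φ G L) (hX : Convex ℝ X) : ConvexOn ℝ X φ := by
  refine ⟨hX, fun x hx y hy a b ha hb hab => ?_⟩
  have hz := hX hx hy ha hb hab
  set z := a • x + b • y with hzdef
  have h1 := mul_le_mul_of_nonneg_left (hφ.le z hz x hx) ha
  have h2 := mul_le_mul_of_nonneg_left (hφ.le z hz y hy) hb
  have h3 : a * inner ℝ (G z) (x - z) + b * inner ℝ (G z) (y - z) = 0 := by
    rw [← real_inner_smul_right, ← real_inner_smul_right, ← inner_add_right]
    have : a • (x - z) + b • (y - z) = 0 := by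
      have : a • (x - z) + b • (y - z) = (a • x + b • y) - (a + b) • z := by module
      rw [this, hab, one_smul, sub_self]
    rw [this, inner_zero_right]
  simp only [smul_eq_mul]
  have h4 : φ z = a * φ z + b * φ z := by rw [← add_mul, hab, one_mul]
  rw [h4]
  linarith

theorem opNorm_le_frobNorm {d p : ℕ} (T : Vec d →L[ℝ] Vec p) : ‖T‖ ≤ frobNorm T := by
  refine T.opNorm_le_bound (Real.sqrt_nonneg _) fun x => ?_
  refine le_of_sq_le_sq ?_ (mul_nonneg (Real.sqrt_nonneg _) (norm_nonneg _))
  rw [mul_pow, frobNorm, Real.sq_sqrt (by positivity), EuclideanSpace.real_norm_sq_eq (T x),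
    EuclideanSpace.real_norm_sq_eq x, Finset.sum_mul]
  refine Finset.sum_le_sum fun i _ => ?_
  have hx : x = ∑ j, x j • EuclideanSpace.single j (1 : ℝ) := by
    ext k
    simp [Finset.sum_apply, Pi.single_apply]
  have h1 : T x i = ∑ j, (T (EuclideanSpace.single j 1) i) * x j := by
    conv_lhs => rw [hx]
    simp [map_sum, mul_comm]
  rw [h1]
  exact Finset.sum_mul_sq_le_sq_mul_sq _ _ _

/-! ### Lipschitz and smoothness bounds for the problem data -/

namespace Setting

variable {d n m p : ℕ} {S : Setting d n m p}

theorem Assumptions.X_convex (hS : S.Assumptions) : Convex ℝ S.X := hS.h_convex.1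

theorem Assumptions.xfeas_mem_X (hS : S.Assumptions) : S.xfeas ∈ S.X :=
  interior_subset hS.xfeas_mem

theorem Assumptions.norm_sub_le_D (hS : S.Assumptions) :
    ∀ x ∈ S.X, ∀ y ∈ S.X, ‖x - y‖ ≤ S.D := fun x hx y hy => by
  rw [← dist_eq_norm]
  exact Metric.dist_le_diam_of_mem hS.X_compact.isBounded hx hy

theorem Assumptions.D_nonneg (_hS : S.Assumptions) : 0 ≤ S.D := Metric.diam_nonneg

/-- A second point of X allows the signs of L_c and L_g to be read off from their Lipschitz
inequalities. -/
theorem Assumptions.exists_ne (hS : S.Assumptions) : ∃ y ∈ S.X, y ≠ S.xfeas := by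
  have : Nonempty (Fin d) := ⟨⟨0, hS.d_pos⟩⟩
  have : (𝓝[≠] S.xfeas).NeBot := Module.punctured_nhds_neBot ℝ (Vec d) S.xfeas
  have h1 : S.X ∈ 𝓝[≠] S.xfeas := mem_nhdsWithin_of_mem_nhds (mem_interior_iff_mem_nhds.1 hS.xfeas_mem)
  obtain ⟨y, hy⟩ := Filter.nonempty_of_mem (Filter.inter_mem h1 self_mem_nhdsWithin)
  exact ⟨y, hy.1, hy.2⟩

theorem Assumptions.Lc_nonneg (hS : S.Assumptions) : 0 ≤ S.Lc := by
  obtain ⟨y, -, hy⟩ := hS.exists_ne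
  have h := (Real.sqrt_nonneg _).trans (hS.c_smooth y S.xfeas)
  exact nonneg_of_mul_nonneg_left h (norm_pos_iff.2 (sub_ne_zero.2 hy))

theorem Assumptions.Lg_nonneg (hS : S.Assumptions) (i : Fin m) : 0 ≤ S.Lg := by
  obtain ⟨y, hyX, hy⟩ := hS.exists_ne
  obtain ⟨U, -, hXU, hU⟩ := hS.g_smooth
  have h := (norm_nonneg _).trans ((hU i).2 y (hXU hyX) S.xfeas (hXU hS.xfeas_mem_X))
  exact nonneg_of_mul_nonneg_left h (norm_pos_iff.2 (sub_ne_zero.2 hy))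

theorem Assumptions.normDc_nonneg (hS : S.Assumptions) : 0 ≤ S.normDc :=
  add_nonneg (Real.sqrt_nonneg _) (mul_nonneg hS.Lc_nonneg hS.D_nonneg)

theorem Assumptions.Bf_nonneg (hS : S.Assumptions) : 0 ≤ S.Bf :=
  mul_nonneg hS.Ml_pos.le hS.normDc_nonneg

theorem Assumptions.norm_fderiv_c_le (hS : S.Assumptions) {x : Vec d} (hx : x ∈ S.X) :
    ‖fderiv ℝ S.c x‖ ≤ S.normDc := by
  have h1 := (opNorm_le_frobNorm _).trans (hS.c_smooth x S.xfeas)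
  have h2 := mul_le_mul_of_nonneg_left (hS.norm_sub_le_D x hx _ hS.xfeas_mem_X) hS.Lc_nonneg
  have h3 := opNorm_le_frobNorm (fderiv ℝ S.c S.xfeas)
  have h4 := norm_le_norm_sub_add (fderiv ℝ S.c x) (fderiv ℝ S.c S.xfeas)
  unfold normDc
  linarith

/-- The linearization error of the objective. -/
theorem Assumptions.abs_f_sub_le (hS : S.Assumptions) (xb x : Vec d) :
    |S.f x - S.l (S.c xb + fderiv ℝ S.c xb (x - xb))| ≤ S.ρ / 2 * ‖x - xb‖ ^ 2 := by
  have h1 := norm_taylor_le (φ := S.c) (φ' := fderiv ℝ S.c) (x := xb) (y := x) (L := S.Lc)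
    (fun t _ => (hS.c_differentiable _).hasFDerivAt)
    (fun t ht => by
      refine ((opNorm_le_frobNorm _).trans (hS.c_smooth _ _)).trans_eq ?_
      rw [add_sub_cancel_left, norm_smul, Real.norm_of_nonneg ht.1])
  refine (hS.l_lipschitz _ _).trans ?_
  rw [← sub_sub]
  calc _ ≤ S.Ml * (S.Lc / 2 * ‖x - xb‖ ^ 2) := by gcongr; exact hS.Ml_pos.le
    _ = S.Ml * S.Lc / 2 * ‖x - xb‖ ^ 2 := by ring
    _ ≤ _ := by gcongr; exact hS.ρ_ge

theorem Assumptions.f_lipschitz (hS : S.Assumptions) {x y : Vec d} (hx : x ∈ S.X) (hy : y ∈ S.X) :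
    S.f x - S.f y ≤ S.Bf * ‖x - y‖ := by
  have h1 := hS.X_convex.norm_image_sub_le_of_norm_fderiv_le (𝕜 := ℝ) (f := S.c)
    (fun z _ => hS.c_differentiable z) (fun z hz => hS.norm_fderiv_c_le hz) hy hx
  refine (le_abs_self _).trans ((hS.l_lipschitz _ _).trans ?_)
  unfold Bf
  rw [mul_assoc]
  exact mul_le_mul_of_nonneg_left h1 hS.Ml_pos.le

theorem Assumptions.f_continuous (hS : S.Assumptions) : Continuous S.f := by
  have hl : Continuous S.l :=
    (LipschitzWith.of_dist_le_mul (K := S.Ml.toNNReal) fun a b => by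
      rw [Real.dist_eq, dist_eq_norm]
      exact (hS.l_lipschitz a b).trans (by gcongr; exact Real.le_coe_toNNReal _)).continuous
  exact hl.comp hS.c_differentiable.continuous

theorem Assumptions.h_continuousOn (hS : S.Assumptions) : ContinuousOn S.h S.X := by
  refine (hS.F_continuous.sub hS.f_continuous.continuousOn).congr fun x _ => ?_
  simp [F]

/-- At an interior point the normal cone is trivial, so h has a subgradient of norm at most r_h. A
boundary point is reached along the segment to the Slater point, whose open part is interior. -/
theorem Assumptions.h_lipschitz (hS : S.Assumptions) {x y : Vec d} (hx : x ∈ S.X)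
    (hy : y ∈ S.X) : S.h x - S.h y ≤ S.rh * ‖x - y‖ := by
  -- first at interior points
  have hint : ∀ x ∈ interior S.X, S.h x - S.h y ≤ S.rh * ‖x - y‖ := by
    intro x hx
    obtain ⟨⟨ξ, hξ⟩, hsub⟩ := hS.h_subdiff x (interior_subset hx)
    obtain ⟨a, ha, r, hr, har⟩ := Set.mem_add.1 (hsub hξ)
    have ha0 : a = 0 := by
      have hnhds : ∀ᶠ t : ℝ in 𝓝[>] 0, x + t • a ∈ S.X := by
        have hc : Tendsto (fun t : ℝ => x + t • a) (𝓝[>] 0) (𝓝 x) := by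
          have : Tendsto (fun t : ℝ => x + t • a) (𝓝 0) (𝓝 (x + (0 : ℝ) • a)) :=
            (Continuous.tendsto (by fun_prop) 0)
          rw [zero_smul, add_zero] at this
          exact this.mono_left nhdsWithin_le_nhds
        exact hc (mem_interior_iff_mem_nhds.1 hx)
      obtain ⟨t, ht, ht0⟩ := (hnhds.and self_mem_nhdsWithin).exists
      have h1 := ha _ ht
      rw [add_sub_cancel_left, real_inner_smul_right, real_inner_self_eq_norm_sq] at h1
      have h2 : ‖a‖ ^ 2 ≤ 0 := nonpos_of_mul_nonpos_right h1 ht0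
      have h3 : ‖a‖ = 0 := by nlinarith [norm_nonneg a]
      exact norm_eq_zero.1 h3
    rw [ha0, zero_add] at har
    have h1 := hξ.2 y hy
    rw [← har] at h1
    have h2 := (abs_le.1 (abs_real_inner_le_norm r (y - x))).1
    have h3 : ‖r‖ * ‖y - x‖ ≤ S.rh * ‖y - x‖ := by
      gcongr
      simpa using hr
    rw [norm_sub_rev] at h3 h2
    linarith
  -- then by continuity along a segment
  have hcont : ContinuousWithinAt S.h S.X x := hS.h_continuousOn x hx
  have hmem : ∀ t ∈ Set.Ioo (0 : ℝ) 1, x + t • (S.xfeas - x) ∈ interior S.X := fun t ht => by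
    have := hS.X_convex.combo_self_interior_mem_interior hx hS.xfeas_mem
      (sub_nonneg.2 ht.2.le) ht.1 (by ring)
    convert this using 1
    module
  have hev : ∀ᶠ t : ℝ in 𝓝[>] 0, x + t • (S.xfeas - x) ∈ interior S.X := by
    filter_upwards [Ioo_mem_nhdsGT (zero_lt_one (α := ℝ))] with t ht using hmem t ht
  have htend : Tendsto (fun t : ℝ => x + t • (S.xfeas - x)) (𝓝[>] 0) (𝓝 x) := by
    have : Tendsto (fun t : ℝ => x + t • (S.xfeas - x)) (𝓝 0)
        (𝓝 (x + (0 : ℝ) • (S.xfeas - x))) := (Continuous.tendsto (by fun_prop) 0)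
    rw [zero_smul, add_zero] at this
    exact this.mono_left nhdsWithin_le_nhds
  have h1 : Tendsto (fun t : ℝ => S.h (x + t • (S.xfeas - x)) - S.h y) (𝓝[>] 0)
      (𝓝 (S.h x - S.h y)) :=
    (hcont.tendsto.comp (tendsto_nhdsWithin_iff.2
      ⟨htend, hev.mono fun t ht => interior_subset ht⟩)).sub_const _
  have h2 : Tendsto (fun t : ℝ => S.rh * ‖x + t • (S.xfeas - x) - y‖) (𝓝[>] 0)
      (𝓝 (S.rh * ‖x - y‖)) := ((htend.sub_const y).norm).const_mul _
  exact le_of_tendsto_of_tendsto h1 h2 (hev.mono fun t ht => hint _ ht)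

/-! #### The smoothed objective -/

theorem Assumptions.exists_smooth_fSmooth (hS : S.Assumptions) {ν : ℝ} (hν : 0 < ν) {xb : Vec d}
    (hxb : xb ∈ S.X) :
    ∃ G, SmoothConvexOn S.X (S.fSmooth ν xb) G (S.normDc ^ 2 / ν) := by
  obtain ⟨H, hH⟩ := exists_smoothConvexOn_moreau hν hS.l_convex hS.l_lipschitz
  refine ⟨_, (hH.comp_affine (fderiv ℝ S.c xb) (S.c xb) xb S.X).mono ?_⟩
  rw [mul_one_div]
  gcongr
  exact hS.norm_fderiv_c_le hxb

theorem Assumptions.fSmooth_lipschitz (hS : S.Assumptions) {ν : ℝ} (hν : 0 < ν) {xb : Vec d}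
    (hxb : xb ∈ S.X) (x y : Vec d) :
    S.fSmooth ν xb x - S.fSmooth ν xb y ≤ S.Bf * ‖x - y‖ := by
  refine (moreau_lipschitz hν hS.l_lipschitz _ _).trans ?_
  rw [add_sub_add_left_eq_sub, ← map_sub, sub_sub_sub_cancel_right, Bf, mul_assoc]
  refine mul_le_mul_of_nonneg_left ?_ hS.Ml_pos.le
  refine (ContinuousLinearMap.le_opNorm _ _).trans ?_
  gcongr
  exact hS.norm_fderiv_c_le hxb

theorem Assumptions.fSmooth_le (hS : S.Assumptions) {ν : ℝ} (hν : 0 < ν) (xb x : Vec d) :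
    S.fSmooth ν xb x ≤ S.f x + S.ρ / 2 * ‖x - xb‖ ^ 2 := by
  have h1 := (abs_le.1 (hS.abs_f_sub_le xb x)).1
  have h2 := moreau_le_self hν hS.l_lipschitz (S.c xb + fderiv ℝ S.c xb (x - xb))
  unfold fSmooth
  linarith

theorem Assumptions.le_fSmooth (hS : S.Assumptions) {ν : ℝ} (hν : 0 < ν) (xb x : Vec d) :
    S.f x - S.ρ / 2 * ‖x - xb‖ ^ 2 - ν * S.Ml ^ 2 / 2 ≤ S.fSmooth ν xb x := by
  have h1 := (abs_le.1 (hS.abs_f_sub_le xb x)).2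
  have h2 := le_moreau hν hS.l_lipschitz (S.c xb + fderiv ℝ S.c xb (x - xb))
  unfold fSmooth
  linarith

/-! #### The augmented Lagrangian terms -/

theorem Amul_eq (x : Vec d) :
    S.Amul x = LinearMap.toContinuousLinearMap (Matrix.toEuclideanLin S.A) x := rfl

theorem inner_ATmul (y : Vec n) (x : Vec d) :
    inner ℝ (S.ATmul y) x = inner ℝ y (S.Amul x) := by
  unfold ATmul Amul
  rw [← Matrix.conjTranspose_eq_transpose_of_trivial, Matrix.toEuclideanLin_conjTranspose_eq_adjoint,
    LinearMap.adjoint_inner_left]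

theorem adjoint_Amul (y : Vec n) :
    ContinuousLinearMap.adjoint
      (LinearMap.toContinuousLinearMap (Matrix.toEuclideanLin S.A)) y = S.ATmul y := by
  refine ext_inner_right ℝ fun v => ?_
  rw [ContinuousLinearMap.adjoint_inner_left, inner_ATmul, Amul_eq]

theorem Amul_sub (x y : Vec d) : S.Amul (x - y) = S.Amul x - S.Amul y := map_sub _ _ _

/-- The augmented Lagrangian term `⟨y, Ax - b⟩ + (β/2)‖Ax - b‖² + (β/2)‖[g(x) + z/β]₊‖²`. -/
noncomputable def al (S : Setting d n m p) (β : ℝ) (y : Vec n) (z : Vec m) (x : Vec d) : ℝ :=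
  inner ℝ y (S.Amul x - S.b) + β / 2 * ‖S.Amul x - S.b‖ ^ 2 +
    ∑ i, β / 2 * max (S.g i x + z i / β) 0 ^ 2

/-- The updated multiplier `y + β(Ax - b)`. -/
noncomputable def yNew (S : Setting d n m p) (β : ℝ) (y : Vec n) (x : Vec d) : Vec n :=
  y + β • (S.Amul x - S.b)

/-- The updated multiplier `[z + β g(x)]₊`. -/
noncomputable def zNew (S : Setting d n m p) (β : ℝ) (z : Vec m) (x : Vec d) : Vec m :=
  WithLp.toLp 2 fun i => max (z i + β * S.g i x) 0

theorem zNew_apply (β : ℝ) (z : Vec m) (x : Vec d) (i : Fin m) :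
    S.zNew β z x i = max (z i + β * S.g i x) 0 := rfl

theorem zNew_nonneg (β : ℝ) (z : Vec m) (x : Vec d) (i : Fin m) : 0 ≤ S.zNew β z x i :=
  le_max_right _ _

/-- `Aᵀy + ∑ zᵢ ∇gᵢ(x)`. -/
noncomputable def multGrad (S : Setting d n m p) (y : Vec n) (z : Vec m) (x : Vec d) : Vec d :=
  S.ATmul y + ∑ i, z i • gradient (S.g i) x

theorem Assumptions.smooth_g (hS : S.Assumptions) (i : Fin m) :
    SmoothConvexOn S.X (S.g i) (gradient (S.g i)) S.Lg := by
  obtain ⟨U, hU, hXU, hg⟩ := hS.g_smooth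
  exact smoothConvexOn_of_lipschitz hS.X_convex hU hXU (hS.g_convex i) (hg i).1 (hS.Lg_nonneg i)
    (hg i).2

theorem norm_A_sq : ‖LinearMap.toContinuousLinearMap (Matrix.toEuclideanLin S.A)‖ ^ 2 =
    ‖S.A.transpose * S.A‖ := by
  rw [← Matrix.conjTranspose_eq_transpose_of_trivial, Matrix.l2_opNorm_conjTranspose_mul_self, sq]
  rfl

theorem Assumptions.smooth_al (hS : S.Assumptions) {β : ℝ} (hβ : 0 < β) (y : Vec n) {z : Vec m}
    (hz : ∀ i, 0 ≤ z i) :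
    SmoothConvexOn S.X (S.al β y z) (fun x => S.multGrad (S.yNew β y x) (S.zNew β z x) x)
      (‖S.A.transpose * S.A‖ * β + ∑ i, (β * S.Bg ^ 2 + S.Lg * (β * S.Bg + z i))) := by
  have h1 := (smoothConvexOn_penalty y hβ).comp_affine
    (LinearMap.toContinuousLinearMap (Matrix.toEuclideanLin S.A)) (-S.b) 0 S.X
  rw [norm_A_sq] at h1
  have hBg := hS.Bg_pos
  have h2 := SmoothConvexOn.sum (Finset.univ : Finset (Fin m)) (X := S.X)
    (φ := fun i x => β / 2 * max (S.g i x + z i / β) 0 ^ 2)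
    (G := fun i x => max (z i + β * S.g i x) 0 • gradient (S.g i) x)
    (L := fun i => β * S.Bg ^ 2 + S.Lg * (β * S.Bg + z i))
    (fun i _ => (hS.smooth_g i).half_sq_pos_part (hS.Lg_nonneg i) hBg.le hβ (hz i)
      (fun x hx => (hS.Bg_bound i x hx).1) (fun x hx => (hS.Bg_bound i x hx).2.1))
    (fun i _ => by have := hS.Lg_nonneg i; have := hz i; positivity)
  have h3 := h1.add h2 (by positivity)
    (Finset.sum_nonneg fun i _ => by have := hS.Lg_nonneg i; have := hz i; positivity)
  convert h3 using 1
  · funext x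
    simp only [al, sub_zero, neg_add_eq_sub, Amul_eq]
  · funext x
    simp only [adjoint_Amul, multGrad, yNew, zNew_apply, sub_zero, neg_add_eq_sub, Amul_eq]

theorem fHat_eq (ν : ℝ) (k : ℕ) (xk : Vec d) (yk : Vec n) (zk : Vec m) (x : Vec d) :
    S.fHat ν k xk yk zk x =
      S.fSmooth ν xk x + S.al (S.β k) yk zk x - ‖zk‖ ^ 2 / (2 * S.β k) := by
  simp only [fHat, al, ← Finset.mul_sum]
  ring

theorem Assumptions.β_pos (hS : S.Assumptions) (k : ℕ) : 0 < S.β k :=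
  mul_pos hS.β0_pos (Real.sqrt_pos.2 (by positivity))

theorem sum_le_sqrt_mul_norm (z : Vec m) : ∑ i, z i ≤ Real.sqrt m * ‖z‖ := by
  refine le_of_sq_le_sq ?_ (by positivity)
  rw [mul_pow, Real.sq_sqrt (by positivity), EuclideanSpace.real_norm_sq_eq]
  simpa using sq_sum_le_card_mul_sum_sq (s := (Finset.univ : Finset (Fin m))) (f := fun i => z i)

/-- The multiplier bound is what keeps the constant independent of the iterate: L_g ∑ zᵢ ≤ √m L_g
B_p is the second part of C₆. The case m = 0 is separate because the sign of L_g is then unknown. -/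
theorem Assumptions.exists_smooth_fHat (hS : S.Assumptions) {ε : ℝ} (hν : 0 < S.ν ε) (k : ℕ)
    {xk : Vec d} (hxk : xk ∈ S.X) (yk : Vec n) {zk : Vec m} (hz : ∀ i, 0 ≤ zk i)
    (hzB : ‖zk‖ ≤ S.Bp) :
    ∃ G, SmoothConvexOn S.X (S.fHat (S.ν ε) k xk yk zk) G (S.Lhat ε k) := by
  obtain ⟨G, hG⟩ := hS.exists_smooth_fSmooth hν hxk
  have hβ := hS.β_pos k
  have hBg := hS.Bg_pos
  have hal := hS.smooth_al hβ yk hz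
  have hsum : 0 ≤ ∑ i, (S.β k * S.Bg ^ 2 + S.Lg * (S.β k * S.Bg + zk i)) :=
    Finset.sum_nonneg fun i _ => by have := hS.Lg_nonneg i; have := hz i; positivity
  have h := (hG.add hal (by positivity) (by positivity)).add
    (SmoothConvexOn.const S.X (-(‖zk‖ ^ 2 / (2 * S.β k)))) (by positivity) le_rfl
  have heq : S.fHat (S.ν ε) k xk yk zk = fun x =>
      S.fSmooth (S.ν ε) xk x + S.al (S.β k) yk zk x + -(‖zk‖ ^ 2 / (2 * S.β k)) := by
    funext x
    rw [fHat_eq, sub_eq_add_neg]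
  rw [heq]
  refine ⟨_, h.mono ?_⟩
  have h1 : S.Lg * ∑ i, zk i ≤ Real.sqrt m * S.Lg * S.Bp := by
    rcases Nat.eq_zero_or_pos m with rfl | hm
    · simp
    · have hLg := hS.Lg_nonneg ⟨0, hm⟩
      calc S.Lg * ∑ i, zk i ≤ S.Lg * (Real.sqrt m * ‖zk‖) := by
            gcongr; exact sum_le_sqrt_mul_norm zk
        _ ≤ S.Lg * (Real.sqrt m * S.Bp) := by gcongr
        _ = _ := by ring
  have h2 : ∑ i, (S.β k * S.Bg ^ 2 + S.Lg * (S.β k * S.Bg + zk i)) =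
      m * (S.β k * S.Bg ^ 2 + S.Lg * (S.β k * S.Bg)) + S.Lg * ∑ i, zk i := by
    rw [Finset.mul_sum]
    simp only [mul_add, ← add_assoc]
    rw [Finset.sum_add_distrib]
    simp
  rw [h2]
  have h3 : S.Lhat ε k = S.normDc ^ 2 / S.ν ε + Real.sqrt m * S.Lg * S.Bp +
      ‖S.A.transpose * S.A‖ * S.β k +
        m * (S.β k * S.Bg ^ 2 + S.Lg * (S.β k * S.Bg)) := by
    unfold Lhat C6 C2 β
    ring
  rw [h3]
  linarith

theorem Assumptions.hHat_convex (hS : S.Assumptions) (xk : Vec d) :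
    ConvexOn ℝ S.X (fun u => S.hHat xk u - S.ρ / 2 * ‖u‖ ^ 2) := by
  refine ⟨hS.X_convex, fun x hx y hy a b ha hb hab => ?_⟩
  have h1 := hS.h_convex.2 hx hy ha hb hab
  have h2 : ∀ u : Vec d, S.hHat xk u - S.ρ / 2 * ‖u‖ ^ 2 =
      S.h u - S.ρ * inner ℝ u xk + S.ρ / 2 * ‖xk‖ ^ 2 := fun u => by
    unfold hHat
    rw [norm_sub_sq_real]
    ring
  simp only [h2, inner_add_left, real_inner_smul_left, smul_eq_mul] at h1 ⊢
  have h3 : a * (S.ρ / 2 * ‖xk‖ ^ 2) + b * (S.ρ / 2 * ‖xk‖ ^ 2) = S.ρ / 2 * ‖xk‖ ^ 2 := by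
    rw [← add_mul, hab, one_mul]
  linarith

theorem Assumptions.hHat_continuousOn (hS : S.Assumptions) (xk : Vec d) :
    ContinuousOn (S.hHat xk) S.X :=
  hS.h_continuousOn.add (by fun_prop)

end Setting

/-! ### Uniform multiplier bounds from Slater's condition -/

namespace Setting

variable {d n m p : ℕ} {S : Setting d n m p}

/-! #### The smallest positive eigenvalue of `A Aᵀ` -/

theorem lamMinPos_pos {n : ℕ} (M : Matrix (Fin n) (Fin n) ℝ) : 0 < lamMinPos M := by
  have hfin : Set.Finite {μ : ℝ | 0 < μ ∧ Module.End.HasEigenvalue (Matrix.toLin' M) μ} :=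
    (Module.End.finite_hasEigenvalue (f := Matrix.toLin' M)).subset fun μ h => h.2
  by_cases hne : {μ : ℝ | 0 < μ ∧ Module.End.HasEigenvalue (Matrix.toLin' M) μ}.Nonempty
  · obtain ⟨μ0, h0, hmin⟩ := hfin.exists_minimalFor id _ hne
    refine (ENNReal.ofReal_pos.2 h0.1).trans_le (le_iInf₂ fun μ hμ => ?_)
    refine ENNReal.ofReal_le_ofReal ?_
    by_contra hlt
    exact hlt (hmin hμ (not_le.1 hlt).le)
  · have : lamMinPos M = ⊤ := by
      unfold lamMinPos
      simp only [iInf_eq_top]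
      exact fun μ hμ => absurd ⟨μ, hμ⟩ hne
    rw [this]
    exact ENNReal.zero_lt_top

theorem Amul_ATmul_apply (y : Vec n) :
    S.Amul (S.ATmul y) = WithLp.toLp 2 ((S.A * S.A.transpose).mulVec y.ofLp) := by
  simp [Amul, ATmul, Matrix.toLpLin_apply, Matrix.mulVec_mulVec]

/-- `Aᵀ` is bounded below on the range of `A`. -/
theorem lamMinPos_mul_le {s : ℝ} (hs : ENNReal.ofReal s ≤ lamMinPos (S.A * S.A.transpose))
    (v : Vec d) : s * ‖S.Amul v‖ ^ 2 ≤ ‖S.ATmul (S.Amul v)‖ ^ 2 := by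
  set Y := S.Amul v
  have hM := isHermitian_mul_transpose S.A
  set B := hM.eigenvectorBasis
  have hB : ∀ i, S.Amul (S.ATmul (B i)) = hM.eigenvalues i • B i := fun i => by
    rw [Amul_ATmul_apply, hM.mulVec_eigenvectorBasis i]
    rfl
  have hnorm : ∀ i, ‖S.ATmul (B i)‖ ^ 2 = hM.eigenvalues i := fun i => by
    rw [← real_inner_self_eq_norm_sq, inner_ATmul, hB, real_inner_smul_right,
      real_inner_self_eq_norm_sq, B.orthonormal.1 i]
    ring
  have h1 : ‖S.ATmul Y‖ ^ 2 = ∑ i, hM.eigenvalues i * (inner ℝ (B i) Y) ^ 2 := by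
    rw [← real_inner_self_eq_norm_sq, inner_ATmul, ← B.sum_inner_mul_inner]
    refine Finset.sum_congr rfl fun i _ => ?_
    rw [← inner_ATmul, real_inner_comm (S.ATmul Y), inner_ATmul, hB, real_inner_smul_right,
      real_inner_comm (B i) Y]
    ring
  rw [h1, ← B.sum_sq_inner_right Y, Finset.mul_sum]
  refine Finset.sum_le_sum fun i _ => ?_
  -- Eigenvectors for the eigenvalue 0 are killed by Aᵀ, hence orthogonal to the range of A; only
  -- positive eigenvalues matter.
  rcases (sq_nonneg ‖S.ATmul (B i)‖).eq_or_lt with h0 | h0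
  · have h2 : S.ATmul (B i) = 0 := by
      have : ‖S.ATmul (B i)‖ = 0 := by
        rw [eq_comm] at h0
        exact pow_eq_zero_iff two_ne_zero |>.1 h0
      exact norm_eq_zero.1 this
    have h3 : inner ℝ (B i) Y = 0 := by rw [← inner_ATmul, h2, inner_zero_left]
    rw [h3]
    simp
  · rw [hnorm] at h0
    refine mul_le_mul_of_nonneg_right ?_ (sq_nonneg _)
    have hev : Module.End.HasEigenvalue (Matrix.toLin' (S.A * S.A.transpose))
        (hM.eigenvalues i) := by
      refine Module.End.hasEigenvalue_of_hasEigenvector (x := (B i).ofLp) ⟨?_, ?_⟩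
      · rw [Module.End.mem_eigenspace_iff, Matrix.toLin'_apply]
        exact hM.mulVec_eigenvectorBasis i
      · intro h
        have h4 : B i = 0 := by ext j; exact congrFun h j
        have h5 := B.orthonormal.1 i
        rw [h4, norm_zero] at h5
        exact zero_ne_one h5
    have h6 : lamMinPos (S.A * S.A.transpose) ≤ ENNReal.ofReal (hM.eigenvalues i) :=
      iInf₂_le (hM.eigenvalues i) ⟨h0, hev⟩
    exact (ENNReal.ofReal_le_ofReal_iff h0.le).1 (hs.trans h6)

/-! #### The Slater point -/

theorem Assumptions.frontier_nonempty (hS : S.Assumptions) : (frontier S.X).Nonempty := by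
  have : Nonempty (Fin d) := ⟨⟨0, hS.d_pos⟩⟩
  refine nonempty_frontier_iff.2 ⟨⟨_, hS.xfeas_mem_X⟩, fun h => ?_⟩
  have h1 := hS.X_compact
  rw [h] at h1
  exact noncompact_univ (Vec d) h1

theorem Assumptions.distBd_pos (hS : S.Assumptions) : 0 < S.distBd := by
  refine (isClosed_frontier.notMem_iff_infDist_pos hS.frontier_nonempty).1 fun h => ?_
  exact h.2 hS.xfeas_mem

/-- The open ball is connected, meets the interior and misses the frontier, so it lies in the
interior; closedness of X adds the sphere. -/
theorem Assumptions.mem_of_norm_le (hS : S.Assumptions) {u : Vec d}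
    (hu : ‖u - S.xfeas‖ ≤ S.distBd) : u ∈ S.X := by
  have hball : Metric.ball S.xfeas S.distBd ⊆ interior S.X := by
    refine (convex_ball S.xfeas S.distBd).isPreconnected.subset_left_of_subset_union
      isOpen_interior (isClosed_closure (s := S.X)).isOpen_compl ?_ ?_
      ⟨S.xfeas, Metric.mem_ball_self hS.distBd_pos, hS.xfeas_mem⟩
    · exact disjoint_compl_right.mono_left (interior_subset.trans subset_closure)
    · intro y hy
      by_contra hcon
      simp only [Set.mem_union, Set.mem_compl_iff, not_or, not_not] at hcon
      have h1 : Metric.infDist S.xfeas (frontier S.X) ≤ dist S.xfeas y :=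
        Metric.infDist_le_dist_of_mem ⟨hcon.2, hcon.1⟩
      rw [Metric.mem_ball, dist_comm] at hy
      exact absurd hy (not_lt.2 h1)
  have h2 : u ∈ closure (Metric.ball S.xfeas S.distBd) := by
    rw [closure_ball _ hS.distBd_pos.ne', mem_closedBall_iff_norm]
    exact hu
  exact hS.X_compact.isClosed.closure_subset_iff.2 (hball.trans interior_subset) h2

theorem Assumptions.gMin_pos (hS : S.Assumptions) : 0 < S.gMin := by
  rcases isEmpty_or_nonempty (Fin m) with h | h
  · rw [gMin, iInf_of_empty]
    exact ENNReal.zero_lt_top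
  · obtain ⟨i, hi⟩ := exists_eq_ciInf_of_finite (f := fun i => ENNReal.ofReal (-S.g i S.xfeas))
    unfold gMin
    rw [← hi]
    exact ENNReal.ofReal_pos.2 (neg_pos.2 (hS.xfeas_lt i))

theorem Assumptions.τ_pos (hS : S.Assumptions) : 0 < S.τ :=
  lt_min (ENNReal.div_pos hS.gMin_pos.ne' ENNReal.ofReal_ne_top)
    (ENNReal.ofReal_pos.2 hS.distBd_pos)

theorem τ_ne_top : S.τ ≠ ⊤ :=
  ((min_le_right _ _).trans_lt ENNReal.ofReal_lt_top).ne

theorem Assumptions.τ_le_distBd (hS : S.Assumptions) : S.τ.toReal ≤ S.distBd :=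
  ENNReal.toReal_le_of_le_ofReal hS.distBd_pos.le (min_le_right _ _)

/-- A displacement of length τ may consume at most half of the Slater slack of each constraint. -/
theorem Assumptions.τ_mul_Bg_le (hS : S.Assumptions) (i : Fin m) :
    S.τ.toReal * S.Bg ≤ -S.g i S.xfeas / 2 := by
  have hm : (1 : ℝ) ≤ Real.sqrt m := by
    rw [Real.one_le_sqrt]
    exact_mod_cast Fin.pos i
  have hg := neg_pos.2 (hS.xfeas_lt i)
  have hpos : 0 < 2 * Real.sqrt m * S.Bg := mul_pos (by positivity) hS.Bg_pos
  have h1 : S.τ ≤ ENNReal.ofReal (-S.g i S.xfeas / (2 * Real.sqrt m * S.Bg)) := by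
    rw [ENNReal.ofReal_div_of_pos hpos]
    exact (min_le_left _ _).trans (ENNReal.div_le_div_right (iInf_le _ i) _)
  have h2 := ENNReal.toReal_le_of_le_ofReal (by positivity) h1
  rw [le_div_iff₀ hpos] at h2
  have h3 : S.τ.toReal * (2 * 1 * S.Bg) ≤ S.τ.toReal * (2 * Real.sqrt m * S.Bg) := by
    have := hS.Bg_pos
    gcongr
  linarith

theorem Assumptions.Bbar_nonneg (hS : S.Assumptions) : 0 ≤ S.Bbar := by
  have := hS.D_nonneg
  have := hS.rh_pos
  have := hS.Bf_nonneg
  have := hS.ρ_pos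
  unfold Bbar
  positivity

/-- Multipliers of points that are nearly stationary for the augmented Lagrangian, tested with the
Slater point. -/
theorem Assumptions.multiplier_test (hS : S.Assumptions) {x : Vec d} (hx : x ∈ S.X) {κ : ℝ}
    {Y : Vec n} {Z : Vec m} (hZ : ∀ i, 0 ≤ Z i)
    (hstat : ∀ u ∈ S.X, inner ℝ (S.multGrad Y Z x) (x - u) ≤ κ)
    (hpos : 0 ≤ inner ℝ Y (S.Amul x - S.b) + ∑ i, Z i * S.g i x) :
    S.τ.toReal * ‖S.ATmul Y‖ + ∑ i, Z i * (-S.g i S.xfeas / 2) ≤ κ := by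
  set t := S.τ.toReal
  have ht : 0 ≤ t := ENNReal.toReal_nonneg
  set w := S.ATmul Y with hw
  -- The test point is the Slater point moved by τ against AᵀY. If AᵀY = 0, division by zero gives q
  -- = 0, the Slater point itself.
  set q := t / ‖w‖ with hq
  have hq0 : 0 ≤ q := by positivity
  have hqw : q * ‖w‖ ≤ t := by
    rcases (norm_nonneg w).eq_or_lt with h | h
    · rw [← h, mul_zero]; exact ht
    · rw [hq, div_mul_cancel₀ _ h.ne']
  have hqw' : q * ‖w‖ ^ 2 = t * ‖w‖ := by
    rcases (norm_nonneg w).eq_or_lt with h | h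
    · rw [← h]; simp
    · rw [hq]; field_simp
  have hu : S.xfeas - q • w ∈ S.X := by
    refine hS.mem_of_norm_le ?_
    rw [sub_sub_cancel_left, norm_neg, norm_smul, Real.norm_of_nonneg hq0]
    exact hqw.trans hS.τ_le_distBd
  have h1 := hstat _ hu
  have h2 : x - (S.xfeas - q • w) = (x - S.xfeas) + q • w := by abel
  rw [h2, multGrad, ← hw, inner_add_left, inner_add_right w, real_inner_smul_right,
    real_inner_self_eq_norm_sq, hqw', sum_inner, hw, inner_ATmul, Amul_sub, hS.xfeas_eq,
    ← hw] at h1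
  -- Convexity gives ⟨∇gᵢ(x), x - x_feas⟩ ≥ gᵢ(x) - gᵢ(x_feas), and the displacement loses at most
  -- τB_g, half of the slack.
  have h3 : ∑ i, Z i * (-S.g i S.xfeas / 2) + ∑ i, Z i * S.g i x ≤
      ∑ i, inner ℝ (Z i • gradient (S.g i) x) (x - S.xfeas + q • w) := by
    rw [← Finset.sum_add_distrib]
    refine Finset.sum_le_sum fun i _ => ?_
    rw [real_inner_smul_left, ← mul_add]
    refine mul_le_mul_of_nonneg_left ?_ (hZ i)
    have h4 := (hS.smooth_g i).le x hx _ hS.xfeas_mem_X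
    rw [← neg_sub x, inner_neg_right] at h4
    have h5 := (abs_le.1 (abs_real_inner_le_norm (gradient (S.g i) x) (q • w))).1
    have h6 : ‖gradient (S.g i) x‖ * ‖q • w‖ ≤ S.Bg * t := by
      rw [norm_smul, Real.norm_of_nonneg hq0]
      have := (hS.Bg_bound i x hx).2.1
      have := hS.Bg_pos
      gcongr
    have h7 := hS.τ_mul_Bg_le i
    rw [inner_add_right]
    linarith
  linarith

/-- The bound on the multipliers. -/
theorem Assumptions.multiplier_bound (hS : S.Assumptions) {x : Vec d} (hx : x ∈ S.X) {β : ℝ}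
    (hβ : 0 < β) {y : Vec n} {z : Vec m} (hy : ∃ v, y = S.Amul v)
    (hyz : ‖y‖ ^ 2 + ‖z‖ ^ 2 ≤ S.Bp ^ 2)
    (hstat : ∀ u ∈ S.X, inner ℝ (S.multGrad (S.yNew β y x) (S.zNew β z x) x) (x - u) ≤ S.Bbar) :
    ‖S.yNew β y x‖ ^ 2 + ‖S.zNew β z x‖ ^ 2 ≤ S.Bp ^ 2 := by
  set Y := S.yNew β y x with hY
  set Z := S.zNew β z x with hZ
  -- Only growing multipliers need work. Then β times the complementarity term is ‖Y‖² - ⟨Y, y⟩ +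
  -- ‖Z‖² - ⟨Z, z⟩, at least half of the growth of the squared norm.
  rcases le_total (‖Y‖ ^ 2 + ‖Z‖ ^ 2) (‖y‖ ^ 2 + ‖z‖ ^ 2) with hle | hle
  · exact hle.trans hyz
  have hZ0 : ∀ i, 0 ≤ Z i := zNew_nonneg β z x
  -- the complementarity term is nonnegative
  have hpos : 0 ≤ inner ℝ Y (S.Amul x - S.b) + ∑ i, Z i * S.g i x := by
    refine nonneg_of_mul_nonneg_right (a := β) ?_ hβ
    have h1 : β * inner ℝ Y (S.Amul x - S.b) = ‖Y‖ ^ 2 - inner ℝ Y y := by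
      rw [← real_inner_smul_right, ← real_inner_self_eq_norm_sq, ← inner_sub_right]
      congr 1
      rw [hY, yNew]
      abel
    have h2 : β * ∑ i, Z i * S.g i x = ‖Z‖ ^ 2 - ∑ i, Z i * z i := by
      rw [EuclideanSpace.real_norm_sq_eq, ← Finset.sum_sub_distrib, Finset.mul_sum]
      refine Finset.sum_congr rfl fun i _ => ?_
      rw [hZ, zNew_apply]
      rcases le_total (z i + β * S.g i x) 0 with h | h
      · rw [max_eq_right h]; ring
      · rw [max_eq_left h]; ring
    have h3 : ∑ i, Z i * z i = inner ℝ Z z := by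
      rw [PiLp.inner_apply]
      refine Finset.sum_congr rfl fun i _ => ?_
      simp [mul_comm]
    have h4 := norm_sub_sq_real Y y
    have h5 := norm_sub_sq_real Z z
    have h6 := sq_nonneg ‖Y - y‖
    have h7 := sq_nonneg ‖Z - z‖
    rw [mul_add, h1, h2, h3]
    linarith
  have htest := hS.multiplier_test hx hZ0 hstat hpos
  -- Since b = A x_feas, the update stays in the range of A, where Aᵀ is bounded below.
  have hYr : ∃ v, Y = S.Amul v := by
    obtain ⟨v, rfl⟩ := hy
    refine ⟨v + β • (x - S.xfeas), ?_⟩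
    rw [hY, yNew, ← hS.xfeas_eq, ← Amul_sub]
    unfold Amul
    rw [map_add, map_smul]
  have hτ : 0 < S.τ.toReal := ENNReal.toReal_pos hS.τ_pos.ne' τ_ne_top
  have hsumZ : ‖Z‖ ≤ ∑ i, Z i := by
    refine le_of_sq_le_sq ?_ (Finset.sum_nonneg fun i _ => hZ0 i)
    rw [EuclideanSpace.real_norm_sq_eq]
    exact Finset.sum_sq_le_sq_sum_of_nonneg fun i _ => hZ0 i
  set C := min (S.τ * lamMinPos (S.A * S.A.transpose) ^ (1 / 2 : ℝ)) (S.gMin / 2) with hC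
  -- Stated for real r ≤ C because C may be +∞ (A = 0 and m = 0); then every r is allowed and the
  -- multipliers vanish.
  have hclaim : ∀ r : ℝ, 0 ≤ r → ENNReal.ofReal r ≤ C → r * (‖Y‖ + ‖Z‖) ≤ S.Bbar := by
    intro r hr hrC
    have h1 : r * ‖Y‖ ≤ S.τ.toReal * ‖S.ATmul Y‖ := by
      have h2 : ENNReal.ofReal (r / S.τ.toReal) ≤
          lamMinPos (S.A * S.A.transpose) ^ (1 / 2 : ℝ) := by
        rw [ENNReal.ofReal_div_of_pos hτ, ENNReal.ofReal_toReal τ_ne_top]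
        exact ENNReal.div_le_of_le_mul' (hrC.trans (min_le_left _ _))
      have h3 : ENNReal.ofReal ((r / S.τ.toReal) ^ 2) ≤ lamMinPos (S.A * S.A.transpose) := by
        rw [ENNReal.ofReal_pow (by positivity)]
        refine (pow_le_pow_left' h2 2).trans_eq ?_
        rw [← ENNReal.rpow_natCast, ← ENNReal.rpow_mul]
        norm_num
      obtain ⟨v, hv⟩ := hYr
      have h4 := lamMinPos_mul_le h3 v
      rw [← hv, ← mul_pow] at h4
      have h5 := le_of_sq_le_sq h4 (norm_nonneg _)
      rw [div_mul_eq_mul_div, div_le_iff₀ hτ] at h5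
      linarith
    have h6 : r * ‖Z‖ ≤ ∑ i, Z i * (-S.g i S.xfeas / 2) := by
      calc r * ‖Z‖ ≤ r * ∑ i, Z i := by gcongr
        _ = ∑ i, Z i * r := by rw [Finset.mul_sum]; simp only [mul_comm]
        _ ≤ _ := by
          refine Finset.sum_le_sum fun i _ => mul_le_mul_of_nonneg_left ?_ (hZ0 i)
          have h7 : ENNReal.ofReal r ≤ ENNReal.ofReal (-S.g i S.xfeas / 2) := by
            rw [ENNReal.ofReal_div_of_pos two_pos, ENNReal.ofReal_ofNat]
            exact (hrC.trans (min_le_right _ _)).trans (ENNReal.div_le_div_right (iInf_le _ i) _)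
          have h8 := neg_pos.2 (hS.xfeas_lt i)
          exact (ENNReal.ofReal_le_ofReal_iff (by positivity)).1 h7
    rw [mul_add]
    linarith
  have hsum : ‖Y‖ + ‖Z‖ ≤ S.Bp := by
    have hYZ : 0 ≤ ‖Y‖ + ‖Z‖ := by positivity
    by_cases hCtop : C = ⊤
    · have h0 : ‖Y‖ + ‖Z‖ ≤ 0 := by
        by_contra hcon
        push Not at hcon
        have h1 := hclaim ((S.Bbar + 1) / (‖Y‖ + ‖Z‖))
          (div_nonneg (by linarith [hS.Bbar_nonneg]) hYZ) (hCtop ▸ le_top)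
        rw [div_mul_cancel₀ _ hcon.ne'] at h1
        linarith
      exact h0.trans ((Real.sqrt_nonneg _).trans (le_max_left _ _))
    · have hCpos : 0 < C := by
        refine lt_min (ENNReal.mul_pos hS.τ_pos.ne' ?_) (ENNReal.div_pos hS.gMin_pos.ne' (by simp))
        exact (ENNReal.rpow_pos_of_nonneg (lamMinPos_pos _) (by norm_num)).ne'
      have hCr : 0 < C.toReal := ENNReal.toReal_pos hCpos.ne' hCtop
      have h1 := hclaim C.toReal hCr.le (ENNReal.ofReal_toReal hCtop).le
      have h2 : S.θ = S.Bbar / C.toReal := by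
        unfold θ
        rw [ENNReal.toReal_div, ENNReal.toReal_ofReal hS.Bbar_nonneg]
      refine le_trans ?_ (le_max_right _ _)
      rw [h2, le_div_iff₀ hCr]
      linarith
  have h1 : (‖Y‖ + ‖Z‖) ^ 2 ≤ S.Bp ^ 2 := by gcongr
  nlinarith [norm_nonneg Y, norm_nonneg Z, mul_nonneg (norm_nonneg Y) (norm_nonneg Z)]

end Setting

/-! ### The dual step, feasibility and drift of the augmented Lagrangian -/

namespace Setting

variable {d n m p : ℕ} {S : Setting d n m p}

theorem Bp_nonneg : 0 ≤ S.Bp := (Real.sqrt_nonneg _).trans (le_max_left _ _)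

/-! #### The dual step -/

theorem Assumptions.infeasSq_nonneg (x : Vec d) : 0 ≤ S.infeasSq x :=
  add_nonneg (sq_nonneg _) (Finset.sum_nonneg fun _ _ => sq_nonneg _)

theorem Assumptions.v_pos (hS : S.Assumptions) (k : ℕ) : 0 < S.v k := by
  unfold v
  split_ifs with h
  · exact hS.v0_pos
  · have hk : (1 : ℝ) < k + 1 := by
      have : (0 : ℝ) < k := by exact_mod_cast Nat.pos_of_ne_zero h
      linarith
    have := Real.log_pos hk
    have := hS.v0_pos
    positivity

theorem Assumptions.α_nonneg (hS : S.Assumptions) (k : ℕ) (x : Vec d) : 0 ≤ S.α k x := by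
  have := hS.β_pos k
  have := hS.v_pos k
  unfold α
  split_ifs <;> positivity

theorem α_le (k : ℕ) (x : Vec d) : S.α k x ≤ S.β k := by
  unfold α
  split_ifs
  · exact le_rfl
  · exact min_le_left _ _

theorem Assumptions.α_mul_le (hS : S.Assumptions) (k : ℕ) (x : Vec d) :
    S.α k x * Real.sqrt (S.infeasSq x) ≤ S.v k := by
  unfold α
  split_ifs with h
  · rw [h, Real.sqrt_zero, mul_zero]
    exact (hS.v_pos k).le
  · have hpos : 0 < Real.sqrt (S.infeasSq x) :=
      Real.sqrt_pos.2 (lt_of_le_of_ne (Assumptions.infeasSq_nonneg x) (Ne.symm h))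
    rw [← le_div_iff₀ hpos]
    exact min_le_right _ _

theorem zNew_eq {β : ℝ} (hβ : 0 < β) (z : Vec m) (x : Vec d) (i : Fin m) :
    S.zNew β z x i = z i + β * max (-(z i) / β) (S.g i x) := by
  rw [zNew_apply, mul_max_of_nonneg _ _ hβ.le, mul_div_cancel₀ _ hβ.ne', ← max_add_add_left,
    add_neg_cancel, max_comm]

/-- What is known about the iterates. -/
structure Inv (S : Setting d n m p) (x : Vec d) (y : Vec n) (z : Vec m) : Prop where
  x_mem : x ∈ S.X
  y_mem : ∃ v, y = S.Amul v
  z_nonneg : ∀ i, 0 ≤ z i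
  bound : ‖y‖ ^ 2 + ‖z‖ ^ 2 ≤ S.Bp ^ 2

theorem Inv.norm_z_le {x : Vec d} {y : Vec n} {z : Vec m} (h : S.Inv x y z) : ‖z‖ ≤ S.Bp := by
  refine le_of_sq_le_sq ?_ Bp_nonneg
  linarith [h.bound, sq_nonneg ‖y‖]

theorem Assumptions.inv_init (hS : S.Assumptions) : S.Inv S.x0 S.y0 S.z0 := by
  refine ⟨hS.x0_mem, hS.y0_mem, hS.z0_nonneg, ?_⟩
  have h1 : Real.sqrt (‖S.y0‖ ^ 2 + ‖S.z0‖ ^ 2) ≤ S.Bp := le_max_left _ _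
  exact (Real.sqrt_le_left Bp_nonneg).1 h1

theorem norm_sq_convex_comb_le {E : Type*} [NormedAddCommGroup E] [InnerProductSpace ℝ E]
    (a b : E) {s : ℝ} (hs0 : 0 ≤ s) (hs1 : s ≤ 1) :
    ‖a + s • (b - a)‖ ^ 2 ≤ (1 - s) * ‖a‖ ^ 2 + s * ‖b‖ ^ 2 := by
  have h1 : ‖a + s • (b - a)‖ ^ 2 =
      (1 - s) * ‖a‖ ^ 2 + s * ‖b‖ ^ 2 - s * (1 - s) * ‖b - a‖ ^ 2 := by
    rw [norm_add_sq_real, norm_smul, mul_pow, Real.norm_eq_abs, sq_abs, real_inner_smul_right,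
      inner_sub_right, real_inner_self_eq_norm_sq, norm_sub_sq_real b a, real_inner_comm b a]
    ring
  have h2 : 0 ≤ s * (1 - s) * ‖b - a‖ ^ 2 :=
    mul_nonneg (mul_nonneg hs0 (sub_nonneg.2 hs1)) (sq_nonneg _)
  linarith

/-- With weight a/β ≤ 1 the new pair is a convex combination of the old pair and the full update, so
the norm bound and nonnegativity are inherited. -/
theorem Inv.dual_step {x x' : Vec d} {y y' : Vec n} {z z' : Vec m} (hI : S.Inv x y z)
    (hS : S.Assumptions) {a β : ℝ} (hβ : 0 < β) (ha : 0 ≤ a) (haβ : a ≤ β) (hx' : x' ∈ S.X)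
    (hnew : ‖S.yNew β y x'‖ ^ 2 + ‖S.zNew β z x'‖ ^ 2 ≤ S.Bp ^ 2)
    (hy' : y' = y + a • (S.Amul x' - S.b))
    (hz' : ∀ i, z' i = z i + a * max (-(z i) / β) (S.g i x')) : S.Inv x' y' z' := by
  have hs0 : 0 ≤ a / β := by positivity
  have hs1 : a / β ≤ 1 := (div_le_one hβ).2 haβ
  have hy : y' = y + (a / β) • (S.yNew β y x' - y) := by
    rw [hy', yNew, add_sub_cancel_left, smul_smul, div_mul_cancel₀ _ hβ.ne']
  have hz : z' = z + (a / β) • (S.zNew β z x' - z) := by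
    ext i
    simp only [PiLp.add_apply, PiLp.smul_apply, PiLp.sub_apply, smul_eq_mul]
    rw [hz', zNew_eq hβ, add_sub_cancel_left, ← mul_assoc, div_mul_cancel₀ _ hβ.ne']
  refine ⟨hx', ?_, fun i => ?_, ?_⟩
  · obtain ⟨v, rfl⟩ := hI.y_mem
    refine ⟨v + a • (x' - S.xfeas), ?_⟩
    rw [hy', ← hS.xfeas_eq, ← Amul_sub]
    unfold Amul
    rw [map_add, map_smul]
  · have h1 : z' i = (1 - a / β) * z i + a / β * S.zNew β z x' i := by
      rw [hz]
      simp only [PiLp.add_apply, PiLp.smul_apply, PiLp.sub_apply, smul_eq_mul]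
      ring
    rw [h1]
    exact add_nonneg (mul_nonneg (sub_nonneg.2 hs1) (hI.z_nonneg i))
      (mul_nonneg hs0 (zNew_nonneg _ _ _ i))
  · have h1 := norm_sq_convex_comb_le y (S.yNew β y x') hs0 hs1
    have h2 := norm_sq_convex_comb_le z (S.zNew β z x') hs0 hs1
    rw [← hy] at h1
    rw [← hz] at h2
    have h3 := mul_le_mul_of_nonneg_left hI.bound (sub_nonneg.2 hs1)
    have h4 := mul_le_mul_of_nonneg_left hnew hs0
    linarith

/-! #### Feasibility and complementarity -/

/-- Scaled by β, the constraint violation is dominated by the difference of two multiplier pairs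
from the ball of radius B_p. -/
theorem Inv.infeas_le {x x' : Vec d} {y : Vec n} {z : Vec m} (hI : S.Inv x y z) {β : ℝ}
    (hβ : 0 < β) (hnew : ‖S.yNew β y x'‖ ^ 2 + ‖S.zNew β z x'‖ ^ 2 ≤ S.Bp ^ 2) :
    Real.sqrt (S.infeasSq x') ≤ 2 * S.Bp / β := by
  have hB := S.Bp_nonneg
  rw [Real.sqrt_le_left (by positivity), div_pow, le_div_iff₀ (by positivity)]
  have h1 : ‖S.Amul x' - S.b‖ ^ 2 * β ^ 2 = ‖S.yNew β y x' - y‖ ^ 2 := by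
    rw [yNew, add_sub_cancel_left, norm_smul, mul_pow, Real.norm_eq_abs, sq_abs, mul_comm]
  have h2 : (∑ i, max (S.g i x') 0 ^ 2) * β ^ 2 ≤ ‖S.zNew β z x' - z‖ ^ 2 := by
    rw [EuclideanSpace.real_norm_sq_eq, Finset.sum_mul]
    refine Finset.sum_le_sum fun i _ => ?_
    rw [PiLp.sub_apply, zNew_eq hβ, add_sub_cancel_left, mul_pow, mul_comm]
    refine mul_le_mul_of_nonneg_left ?_ (sq_nonneg _)
    rcases le_total (S.g i x') 0 with h | h
    · rw [max_eq_right h, zero_pow two_ne_zero]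
      positivity
    · rw [max_eq_left h]
      refine pow_le_pow_left₀ h (le_max_right _ _) 2
  have h3 := parallelogram_law_with_norm ℝ (S.yNew β y x') y
  have h4 := parallelogram_law_with_norm ℝ (S.zNew β z x') z
  have h5 := hI.bound
  have h6 := sq_nonneg ‖S.yNew β y x' + y‖
  have h7 := sq_nonneg ‖S.zNew β z x' + z‖
  unfold infeasSq
  rw [add_mul, h1, mul_pow]
  nlinarith

/-- A truncated multiplier contributes 0; otherwise βgᵢ = Zᵢ - zᵢ, and Zᵢ|Zᵢ - zᵢ| ≤ Zᵢ² + zᵢ² for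
nonnegative numbers. -/
theorem Inv.compl_le {x x' : Vec d} {y : Vec n} {z : Vec m} (hI : S.Inv x y z) {β : ℝ}
    (hβ : 0 < β) (hnew : ‖S.yNew β y x'‖ ^ 2 + ‖S.zNew β z x'‖ ^ 2 ≤ S.Bp ^ 2) :
    ∑ i, |S.zNew β z x' i * S.g i x'| ≤ 2 * S.Bp ^ 2 / β := by
  rw [le_div_iff₀ hβ, Finset.sum_mul]
  have h1 : ∀ i, |S.zNew β z x' i * S.g i x'| * β ≤ S.zNew β z x' i ^ 2 + z i ^ 2 := by
    intro i
    have hz := hI.z_nonneg i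
    rw [zNew_apply]
    rcases le_total (z i + β * S.g i x') 0 with h | h
    · rw [max_eq_right h]
      simp only [zero_mul, abs_zero]
      positivity
    · rw [max_eq_left h, abs_mul, abs_of_nonneg h, mul_assoc, mul_comm _ β]
      set Z := z i + β * S.g i x' with hZ
      have h2 : β * |S.g i x'| = |Z - z i| := by
        rw [hZ, add_sub_cancel_left, abs_mul, abs_of_pos hβ]
      rw [h2]
      rcases abs_cases (Z - z i) with ⟨h3, h4⟩ | ⟨h3, h4⟩ <;> rw [h3] <;>
        nlinarith [mul_nonneg h hz, sq_nonneg Z, sq_nonneg (z i)]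
  calc _ ≤ ∑ i, (S.zNew β z x' i ^ 2 + z i ^ 2) := Finset.sum_le_sum fun i _ => h1 i
    _ = ‖S.zNew β z x'‖ ^ 2 + ‖z‖ ^ 2 := by
      rw [Finset.sum_add_distrib, ← EuclideanSpace.real_norm_sq_eq,
        ← EuclideanSpace.real_norm_sq_eq]
    _ ≤ _ := by linarith [hI.bound, sq_nonneg ‖y‖, sq_nonneg ‖S.yNew β y x'‖]

/-! #### The augmented Lagrangian along the iterates -/

/-- Completing the square expresses the term through multipliers alone, which bounds it by
±B_p²/(2β). -/
theorem al_eq {β : ℝ} (hβ : 0 < β) (y : Vec n) (z : Vec m) (x : Vec d) :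
    S.al β y z x =
      (‖S.yNew β y x‖ ^ 2 - ‖y‖ ^ 2) / (2 * β) + ‖S.zNew β z x‖ ^ 2 / (2 * β) := by
  have h1 : ‖S.zNew β z x‖ ^ 2 / (2 * β) = ∑ i, β / 2 * max (S.g i x + z i / β) 0 ^ 2 := by
    rw [EuclideanSpace.real_norm_sq_eq, Finset.sum_div]
    refine Finset.sum_congr rfl fun i _ => ?_
    have h2 : S.zNew β z x i = β * max (S.g i x + z i / β) 0 := by
      rw [zNew_apply, mul_max_of_nonneg _ _ hβ.le, mul_zero, mul_add, mul_div_cancel₀ _ hβ.ne',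
        add_comm]
    rw [h2]
    field_simp
  rw [h1, al, yNew, norm_add_sq_real, norm_smul, mul_pow, Real.norm_of_nonneg hβ.le,
    real_inner_smul_right]
  congr 1
  field_simp
  ring

theorem Inv.neg_le_al {x : Vec d} {y : Vec n} {z : Vec m} (hI : S.Inv x y z) {β : ℝ}
    (hβ : 0 < β) (x' : Vec d) : -(S.Bp ^ 2 / (2 * β)) ≤ S.al β y z x' := by
  rw [al_eq hβ, ← add_div, ← neg_div]
  have := hI.bound
  gcongr
  linarith [sq_nonneg ‖S.yNew β y x'‖, sq_nonneg ‖S.zNew β z x'‖, sq_nonneg ‖z‖]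

theorem al_le {β : ℝ} (hβ : 0 < β) {y : Vec n} {z : Vec m} {x : Vec d}
    (hnew : ‖S.yNew β y x‖ ^ 2 + ‖S.zNew β z x‖ ^ 2 ≤ S.Bp ^ 2) :
    S.al β y z x ≤ S.Bp ^ 2 / (2 * β) := by
  rw [al_eq hβ, ← add_div]
  gcongr
  linarith [sq_nonneg ‖y‖]

theorem sum_pos_part_mul_le {x : Vec d} {z : Vec m} (hz : ‖z‖ ≤ S.Bp) :
    ∑ i, max (S.g i x) 0 * z i ≤ Real.sqrt (S.infeasSq x) * S.Bp := by
  have h1 := Real.sum_mul_le_sqrt_mul_sqrt Finset.univ (fun i => max (S.g i x) 0) (fun i => z i)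
  refine h1.trans ?_
  rw [← EuclideanSpace.real_norm_sq_eq, Real.sqrt_sq (norm_nonneg _)]
  gcongr
  unfold infeasSq
  linarith [sq_nonneg ‖S.Amul x - S.b‖]

/-- The change of the augmented Lagrangian in the dual step. -/
theorem Inv.al_dual_step_le {x x' : Vec d} {y y' : Vec n} {z z' : Vec m} (hI : S.Inv x y z)
    (hI' : S.Inv x' y' z') {a β v : ℝ} (hβ : 0 < β) (ha : 0 ≤ a)
    (hv : a * Real.sqrt (S.infeasSq x') ≤ v)
    (hnew : ‖S.yNew β y x'‖ ^ 2 + ‖S.zNew β z x'‖ ^ 2 ≤ S.Bp ^ 2)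
    (hy' : y' = y + a • (S.Amul x' - S.b))
    (hz' : ∀ i, z' i = z i + a * max (-(z i) / β) (S.g i x')) :
    S.al β y' z' x' - S.al β y z x' ≤ 3 * S.Bp * (v / β) := by
  have hterm : ∀ i, β / 2 * max (S.g i x' + z' i / β) 0 ^ 2 -
      β / 2 * max (S.g i x' + z i / β) 0 ^ 2 ≤
      a * max (S.g i x') 0 ^ 2 + a / (2 * β) * (max (S.g i x') 0 * z i + max (S.g i x') 0 * z' i) := by
    intro i
    have hz := hI.z_nonneg i
    have hz2 := hI'.z_nonneg i
    -- For gᵢ ≤ 0 the multiplier, hence the term, can only decrease. For gᵢ ≥ 0 nothing is truncated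
    -- and the bound is an identity.
    rcases le_total (S.g i x') 0 with h | h
    · have h1 : z' i ≤ z i := by
        rw [hz']
        have : max (-(z i) / β) (S.g i x') ≤ 0 :=
          max_le (div_nonpos_of_nonpos_of_nonneg (by linarith) hβ.le) h
        nlinarith
      have h2 : max (S.g i x' + z' i / β) 0 ≤ max (S.g i x' + z i / β) 0 := by gcongr
      have h3 : β / 2 * max (S.g i x' + z' i / β) 0 ^ 2 ≤
          β / 2 * max (S.g i x' + z i / β) 0 ^ 2 := by gcongr
      rw [max_eq_right h]
      simp only [zero_mul, add_zero, mul_zero, zero_pow two_ne_zero]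
      linarith
    · have h1 : z' i = z i + a * S.g i x' := by
        rw [hz', max_eq_right]
        exact (div_nonpos_of_nonpos_of_nonneg (by linarith) hβ.le).trans h
      rw [max_eq_left h, max_eq_left (by positivity), max_eq_left (by positivity), h1]
      refine le_of_eq ?_
      field_simp
      ring
  have hsum := Finset.sum_le_sum fun i (_ : i ∈ Finset.univ) => hterm i
  simp only [Finset.sum_sub_distrib, Finset.sum_add_distrib, ← Finset.mul_sum] at hsum
  have hy : inner ℝ y' (S.Amul x' - S.b) - inner ℝ y (S.Amul x' - S.b) =
      a * ‖S.Amul x' - S.b‖ ^ 2 := by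
    rw [hy', ← inner_sub_left, add_sub_cancel_left, real_inner_smul_left,
      real_inner_self_eq_norm_sq]
  have h1 := S.sum_pos_part_mul_le (x := x') hI.norm_z_le
  have h2 := S.sum_pos_part_mul_le (x := x') hI'.norm_z_le
  set I := Real.sqrt (S.infeasSq x') with hIdef
  have hI0 : 0 ≤ I := Real.sqrt_nonneg _
  have h3 : I ^ 2 = ‖S.Amul x' - S.b‖ ^ 2 + ∑ i, max (S.g i x') 0 ^ 2 :=
    Real.sq_sqrt (Assumptions.infeasSq_nonneg x')
  have h4 := hI.infeas_le hβ hnew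
  have hB := S.Bp_nonneg
  have h5 : a / (2 * β) * (∑ i, max (S.g i x') 0 * z i + ∑ i, max (S.g i x') 0 * z' i) ≤
      a / (2 * β) * (2 * (I * S.Bp)) := by gcongr; linarith
  -- One factor aI is capped by v through the damping, while the other I is at most 2B_p/β: in total
  -- 3B_p v/β.
  have h6 : a * I ^ 2 + a / (2 * β) * (2 * (I * S.Bp)) = (a * I) * (I + S.Bp / β) := by
    field_simp
  have h7 : (a * I) * (I + S.Bp / β) ≤ v * (2 * S.Bp / β + S.Bp / β) := by
    have : 0 ≤ a * I := by positivity
    have : 0 ≤ v := this.trans hv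
    gcongr
  have h8 : v * (2 * S.Bp / β + S.Bp / β) = 3 * S.Bp * (v / β) := by ring
  simp only [al, ← Finset.mul_sum]
  rw [h3] at h6
  linarith

/-- The change of the augmented Lagrangian when the penalty parameter increases. -/
theorem al_penalty_step_le {β β' : ℝ} (hβ : 0 < β) (hββ' : β ≤ β') (y : Vec n) {z : Vec m}
    (hz : ∀ i, 0 ≤ z i) (x : Vec d) :
    S.al β' y z x - S.al β y z x ≤ (β' - β) / 2 * S.infeasSq x := by
  have hβ' : 0 < β' := hβ.trans_le hββ'
  have hterm : ∀ i, β' / 2 * max (S.g i x + z i / β') 0 ^ 2 -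
      β / 2 * max (S.g i x + z i / β) 0 ^ 2 ≤ (β' - β) / 2 * max (S.g i x) 0 ^ 2 := by
    intro i
    have hzi := hz i
    have e : ∀ b : ℝ, 0 < b → b / 2 * max (S.g i x + z i / b) 0 ^ 2 =
        max (z i + b * S.g i x) 0 ^ 2 / (2 * b) := fun b hb => by
      have : max (z i + b * S.g i x) 0 = b * max (S.g i x + z i / b) 0 := by
        rw [mul_max_of_nonneg _ _ hb.le, mul_zero, mul_add, mul_div_cancel₀ _ hb.ne', add_comm]
      rw [this]
      field_simp
    -- For gᵢ ≤ 0 the form [z + bg]₊²/(2b) is decreasing in b. For gᵢ ≥ 0 there is no truncation,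
    -- and z²/(2b) decreases.
    rcases le_total (S.g i x) 0 with h | h
    · rw [max_eq_right h, zero_pow two_ne_zero, mul_zero, e _ hβ, e _ hβ', sub_nonpos]
      gcongr ?_ ^ 2 / (2 * ?_)
      exact max_le_max (by nlinarith) le_rfl
    · rw [max_eq_left h, max_eq_left (by positivity), max_eq_left (by positivity)]
      have h1 : z i ^ 2 / β' ≤ z i ^ 2 / β := by gcongr
      have h2 : ∀ b : ℝ, 0 < b → b / 2 * (S.g i x + z i / b) ^ 2 =
          b / 2 * S.g i x ^ 2 + S.g i x * z i + (z i ^ 2 / b) / 2 := fun b hb => by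
        field_simp
        ring
      rw [h2 _ hβ, h2 _ hβ']
      linarith
  have hsum := Finset.sum_le_sum fun i (_ : i ∈ Finset.univ) => hterm i
  simp only [Finset.sum_sub_distrib, ← Finset.mul_sum] at hsum
  simp only [al, infeasSq, ← Finset.mul_sum]
  linarith

/-! #### The sums of the errors -/

/-- The summand is (v₀/β₀)/((k+1)log²(k+1)), which telescopes against 1/log. The first two terms
together with the final 1/log 2 stay below 4. -/
theorem Assumptions.sum_v_div_β_le (hS : S.Assumptions) (N : ℕ) :
    ∑ k ∈ Finset.range N, S.v k / S.β k ≤ 4 * (S.v0 / S.β0) := by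
  have hv := hS.v0_pos
  have hβ := hS.β0_pos
  have hpos : 0 < S.v0 / S.β0 := by positivity
  have hterm0 : S.v 0 / S.β 0 = S.v0 / S.β0 := by simp [v, β]
  have hterm : ∀ k : ℕ, k ≠ 0 →
      S.v k / S.β k = S.v0 / S.β0 * (1 / ((k + 1) * Real.log (k + 1) ^ 2)) := by
    intro k hk
    have h1 : Real.sqrt ((k : ℝ) + 1) ^ 2 = k + 1 := Real.sq_sqrt (by positivity)
    rw [v, if_neg hk, β]
    nth_rw 4 [← h1]
    have : 0 < Real.sqrt ((k : ℝ) + 1) := Real.sqrt_pos.2 (by positivity)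
    field_simp
  have hl := Real.log_two_gt_d9
  have key : ∀ N : ℕ, ∑ k ∈ Finset.range (N + 2), S.v k / S.β k ≤
      S.v0 / S.β0 * (4 - 1 / Real.log ((N : ℝ) + 2)) := by
    intro N
    induction N with
    | zero =>
      rw [zero_add, Finset.sum_range_succ, Finset.sum_range_one, hterm0, hterm 1 one_ne_zero]
      have h0 : S.v0 / S.β0 + S.v0 / S.β0 * (1 / (((1 : ℕ) + 1) * Real.log ((1 : ℕ) + 1) ^ 2)) =
          S.v0 / S.β0 * (1 + 1 / (2 * Real.log 2 ^ 2)) := by norm_num; ring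
      rw [h0]
      refine mul_le_mul_of_nonneg_left ?_ hpos.le
      rw [Nat.cast_zero, zero_add]
      have h1 : 1 / Real.log 2 ≤ 1.5 := by
        rw [div_le_iff₀ (by linarith)]
        linarith
      have h2 : 1 / (2 * Real.log 2 ^ 2) ≤ 1.5 := by
        rw [div_le_iff₀ (by nlinarith)]
        nlinarith
      linarith
    | succ N ih =>
      rw [show N + 1 + 2 = N + 2 + 1 by ring, Finset.sum_range_succ, hterm (N + 2) (by omega)]
      have hN2 : (1 : ℝ) < N + 2 := by
        have : (0 : ℝ) ≤ N := Nat.cast_nonneg N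
        linarith
      have hl1 : 0 < Real.log ((N : ℝ) + 2) := Real.log_pos hN2
      have hl2 : Real.log ((N : ℝ) + 2) ≤ Real.log ((N : ℝ) + 3) :=
        Real.log_le_log (by linarith) (by linarith)
      have hl3 : 0 < Real.log ((N : ℝ) + 3) := hl1.trans_le hl2
      have hN3 : (0 : ℝ) < N + 3 := by linarith
      have hdiff : 1 / ((N : ℝ) + 3) ≤ Real.log ((N : ℝ) + 3) - Real.log ((N : ℝ) + 2) := by
        rw [← Real.log_div (by linarith) (by linarith)]
        have h1 := Real.one_sub_inv_le_log_of_pos (x := ((N : ℝ) + 3) / (N + 2))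
          (div_pos hN3 (by linarith))
        refine le_trans (le_of_eq ?_) h1
        rw [inv_div]
        field_simp
        ring
      have hmain : 1 / (((N : ℝ) + 3) * Real.log ((N : ℝ) + 3) ^ 2) ≤
          1 / Real.log ((N : ℝ) + 2) - 1 / Real.log ((N : ℝ) + 3) := by
        rw [div_sub_div _ _ hl1.ne' hl3.ne']
        calc 1 / (((N : ℝ) + 3) * Real.log ((N : ℝ) + 3) ^ 2)
            = 1 / ((N : ℝ) + 3) / (Real.log ((N : ℝ) + 3) * Real.log ((N : ℝ) + 3)) := by
              rw [div_div, sq]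
          _ ≤ (Real.log ((N : ℝ) + 3) - Real.log ((N : ℝ) + 2)) /
              (Real.log ((N : ℝ) + 2) * Real.log ((N : ℝ) + 3)) := by
              gcongr
          _ = _ := by ring
      have e1 : (((N + 2 : ℕ) : ℝ) + 1) = N + 3 := by push_cast; ring
      have e2 : (((N + 1 : ℕ) : ℝ) + 2) = N + 3 := by push_cast; ring
      rw [e1, e2]
      have h2 := mul_le_mul_of_nonneg_left hmain hpos.le
      rw [mul_sub] at h2 ih ⊢
      linarith
  have hmono : ∑ k ∈ Finset.range N, S.v k / S.β k ≤
      ∑ k ∈ Finset.range (N + 2), S.v k / S.β k :=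
    Finset.sum_le_sum_of_subset_of_nonneg (Finset.range_mono (by omega)) fun k _ _ =>
      (div_pos (hS.v_pos k) (hS.β_pos k)).le
  refine (hmono.trans (key N)).trans ?_
  have : 0 < Real.log ((N : ℝ) + 2) := Real.log_pos (by
    have : (0 : ℝ) ≤ N := Nat.cast_nonneg N
    linarith)
  have h3 : 0 ≤ S.v0 / S.β0 * (1 / Real.log ((N : ℝ) + 2)) := by positivity
  linarith

theorem Assumptions.β_mono (hS : S.Assumptions) : Monotone S.β := fun i j hij => by
  have := hS.β0_pos
  unfold β
  gcongr

theorem Assumptions.β0_le (hS : S.Assumptions) (k : ℕ) : S.β0 ≤ S.β k := by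
  have := hS.β_mono (Nat.zero_le k)
  simpa [β] using this

/-- As β_{k+1} ≤ 2β_k, each summand is at most 2/β_k - 2/β_{k+1}. -/
theorem Assumptions.sum_β_diff_le (hS : S.Assumptions) (N : ℕ) :
    ∑ k ∈ Finset.range N, (S.β (k + 1) - S.β k) / S.β k ^ 2 ≤ 2 / S.β0 := by
  have key : ∑ k ∈ Finset.range N, (S.β (k + 1) - S.β k) / S.β k ^ 2 ≤
      ∑ k ∈ Finset.range N, (2 / S.β k - 2 / S.β (k + 1)) := by
    refine Finset.sum_le_sum fun k _ => ?_
    have h0 := hS.β_pos k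
    have h1 := hS.β_pos (k + 1)
    have h2 := hS.β_mono (Nat.le_succ k)
    have h3 : S.β (k + 1) ≤ 2 * S.β k := by
      have hb := hS.β0_pos
      unfold β
      rw [mul_left_comm]
      refine mul_le_mul_of_nonneg_left ?_ hb.le
      rw [Real.sqrt_le_left (by positivity), mul_pow, Real.sq_sqrt (by positivity)]
      push_cast
      have : (0 : ℝ) ≤ k := Nat.cast_nonneg k
      linarith
    rw [div_sub_div _ _ h0.ne' h1.ne', div_le_div_iff₀ (by positivity) (by positivity)]
    have h4 : 0 ≤ S.β (k + 1) - S.β k := sub_nonneg.2 h2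
    have h5 : 0 ≤ S.β k * ((S.β (k + 1) - S.β k) * (2 * S.β k - S.β (k + 1))) :=
      mul_nonneg h0.le (mul_nonneg h4 (by linarith))
    nlinarith
  refine key.trans ?_
  rw [Finset.sum_range_sub' (fun k => 2 / S.β k)]
  have h0 : S.β 0 = S.β0 := by simp [β]
  have := hS.β_pos N
  rw [h0]
  have : 0 ≤ 2 / S.β N := by positivity
  linarith

end Setting

/-- A subdifferential at a point of X is an intersection of closed half-spaces, so the distance is
attained; a finite bound excludes the empty set. -/
theorem DistZeroLE.exists_mem {d : ℕ} {X : Set (Vec d)} {φ : Vec d → ℝ} {x : Vec d} {r : ℝ}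
    (hr : 0 ≤ r) (h : DistZeroLE (subdiff X φ x) r) : ∃ ζ ∈ subdiff X φ x, ‖ζ‖ ≤ r := by
  unfold DistZeroLE at h
  have hne : (subdiff X φ x).Nonempty := by
    by_contra hcon
    rw [Set.not_nonempty_iff_eq_empty.1 hcon, Metric.infEDist_empty, top_le_iff] at h
    exact ENNReal.ofReal_ne_top h
  have hx : x ∈ X := hne.some_mem.1
  have hcl : IsClosed (subdiff X φ x) := by
    have : subdiff X φ x = ⋂ x' ∈ X, {ξ | inner ℝ ξ (x' - x) ≤ φ x' - φ x} := by
      ext ξ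
      simp [subdiff, hx]
    rw [this]
    exact isClosed_biInter fun x' _ => isClosed_le (by fun_prop) continuous_const
  obtain ⟨ζ, hζ, hd⟩ := hcl.exists_infDist_eq_dist hne 0
  refine ⟨ζ, hζ, ?_⟩
  rw [← dist_zero_left, ← hd]
  exact ENNReal.toReal_le_of_le_ofReal hr h

/-! ### One outer iteration, total decrease and the near-KKT point -/

namespace Setting

variable {d n m p : ℕ} {S : Setting d n m p}

theorem Assumptions.F_add_quad_convex (hS : S.Assumptions) (xk : Vec d) :
    ConvexOn ℝ S.X (fun u => S.F u + S.ρ / 2 * ‖u - xk‖ ^ 2) := by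
  refine ⟨hS.X_convex, fun x hx y hy a b ha hb hab => ?_⟩
  have h0 := hS.f_weaklyConvex.2 hx hy ha hb hab
  have h1 := hS.h_convex.2 hx hy ha hb hab
  have h2 : ∀ u : Vec d, S.F u + S.ρ / 2 * ‖u - xk‖ ^ 2 =
      (S.f u + S.ρ / 2 * ‖u‖ ^ 2) + S.h u - S.ρ * inner ℝ u xk + S.ρ / 2 * ‖xk‖ ^ 2 := fun u => by
    unfold F
    rw [norm_sub_sq_real]
    ring
  simp only [h2, inner_add_left, real_inner_smul_left, smul_eq_mul] at h0 h1 ⊢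
  have h3 : a * (S.ρ / 2 * ‖xk‖ ^ 2) + b * (S.ρ / 2 * ‖xk‖ ^ 2) = S.ρ / 2 * ‖xk‖ ^ 2 := by
    rw [← add_mul, hab, one_mul]
  linarith

/-- Multipliers stay bounded at approximate minimizers of the proximal augmented Lagrangian. -/
theorem Inv.new_multiplier_le {x x' : Vec d} {y : Vec n} {z : Vec m} (hI : S.Inv x y z)
    (hS : S.Assumptions) {β : ℝ} (hβ : 0 < β) (hx' : x' ∈ S.X) {P : Vec d → ℝ}
    (hP : ConvexOn ℝ S.X P)
    (hPl : ∀ u ∈ S.X, P u - P x' ≤ (S.rh + S.Bf) * S.D + S.ρ / 2 * S.D ^ 2) {ζ : Vec d}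
    (hζ : ‖ζ‖ ≤ 1)
    (h : ∀ u ∈ S.X, inner ℝ ζ (u - x') ≤ (P u + (S.al β y z u + S.ρ / 2 * ‖u - x‖ ^ 2)) -
      (P x' + (S.al β y z x' + S.ρ / 2 * ‖x' - x‖ ^ 2))) :
    ‖S.yNew β y x'‖ ^ 2 + ‖S.zNew β z x'‖ ^ 2 ≤ S.Bp ^ 2 := by
  refine hS.multiplier_bound hx' hβ hI.y_mem hI.bound fun u hu => ?_
  have hR := hasGradientAt_add ((hS.smooth_al hβ y hI.z_nonneg).grad x' hx')
    (hasGradientAt_quad S.ρ x x')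
  have h1 := inner_sub_grad_le hP hx' hR h hu
  have h2 := hPl u hu
  have hD := hS.D_nonneg
  have hD1 := hS.norm_sub_le_D u hu x' hx'
  have hD2 := hS.norm_sub_le_D x' hx' x hI.x_mem
  have hρ := hS.ρ_pos
  have h3 := (abs_le.1 (abs_real_inner_le_norm ζ (u - x'))).1
  have h4 : ‖ζ‖ * ‖u - x'‖ ≤ 1 * S.D := by gcongr
  have h5 := (abs_le.1 (abs_real_inner_le_norm (x' - x) (u - x'))).2
  have h6 : ‖x' - x‖ * ‖u - x'‖ ≤ S.D * S.D := by gcongr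
  have h7 : S.ρ * inner ℝ (x' - x) (u - x') ≤ S.ρ * (S.D * S.D) := by
    gcongr
    exact h5.trans h6
  rw [inner_sub_left, inner_add_left, real_inner_smul_left] at h1
  rw [← neg_sub u x', inner_neg_right]
  have h8 : 0 ≤ S.τ.toReal * (1 + S.rh + S.Bf + 2 * S.ρ * S.D) := by
    have := hS.rh_pos
    have := hS.Bf_nonneg
    positivity
  have h9 : 0 ≤ S.ρ * (S.D * S.D) := by positivity
  -- The contributions add up to D(r_h + B_f) + (3/2)ρD² + D, within the budget even without its τ
  -- part.
  unfold Bbar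
  nlinarith

/-- One outer iteration: the new multipliers are bounded, and the minimizer of the exact proximal
augmented Lagrangian is a nearly stationary point close to the current iterate. -/
theorem Inv.outer_step {xk xn : Vec d} {yk : Vec n} {zk : Vec m} (hI : S.Inv xk yk zk)
    (hS : S.Assumptions) {ν r : ℝ} (hν : 0 < ν) (hr0 : 0 ≤ r) (hr1 : r ≤ 1) {k : ℕ}
    (hx : DistZeroLE (subdiff S.X (fun u => S.fHat ν k xk yk zk u + S.hHat xk u) xn) r) :
    xn ∈ S.X ∧ ‖S.yNew (S.β k) yk xn‖ ^ 2 + ‖S.zNew (S.β k) zk xn‖ ^ 2 ≤ S.Bp ^ 2 ∧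
    ∃ xh ∈ S.X, ‖S.yNew (S.β k) yk xh‖ ^ 2 + ‖S.zNew (S.β k) zk xh‖ ^ 2 ≤ S.Bp ^ 2 ∧
      (-S.multGrad (S.yNew (S.β k) yk xh) (S.zNew (S.β k) zk xh) xh -
        (2 * S.ρ) • (xh - xk)) ∈ weakSubdiff S.X S.ρ S.F xh ∧
      S.ρ / 2 * ‖xk - xh‖ ^ 2 ≤ (S.F xk + S.al (S.β k) yk zk xk) -
        (S.F xn + S.al (S.β k) yk zk xn) + ν * S.Ml ^ 2 / 2 + r ^ 2 / (2 * S.ρ) := by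
  obtain ⟨ζ, ⟨hxn, hζ⟩, hζr⟩ := hx.exists_mem hr0
  have hβ := hS.β_pos k
  have hρ := hS.ρ_pos
  have hD := hS.D_nonneg
  have hal := hS.smooth_al hβ yk hI.z_nonneg
  obtain ⟨G, hG⟩ := hS.exists_smooth_fSmooth hν hI.x_mem
  have hfc : ConvexOn ℝ S.X (S.fSmooth ν xk) := hG.convexOn hS.X_convex
  have hζ' : ∀ u ∈ S.X, inner ℝ ζ (u - xn) ≤
      (S.fSmooth ν xk u + S.h u + (S.al (S.β k) yk zk u + S.ρ / 2 * ‖u - xk‖ ^ 2)) -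
      (S.fSmooth ν xk xn + S.h xn + (S.al (S.β k) yk zk xn + S.ρ / 2 * ‖xn - xk‖ ^ 2)) := by
    intro u hu
    have := hζ u hu
    simp only [fHat_eq, hHat] at this
    linarith
  refine ⟨hxn, ?_, ?_⟩
  · refine hI.new_multiplier_le hS hβ hxn (hfc.add hS.h_convex) (fun u hu => ?_)
      (hζr.trans hr1) hζ'
    have h1 := hS.fSmooth_lipschitz hν hI.x_mem u xn
    have h2 := hS.h_lipschitz hu hxn
    have h3 : (S.rh + S.Bf) * ‖u - xn‖ ≤ (S.rh + S.Bf) * S.D := by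
      have := hS.rh_pos
      have := hS.Bf_nonneg
      have := hS.norm_sub_le_D u hu xn hxn
      gcongr
    have h4 : 0 ≤ S.ρ / 2 * S.D ^ 2 := by positivity
    simp only [Pi.add_apply]
    linarith
  -- The proximal weight is doubled: one ρ/2 convexifies F, the other makes the problem strongly
  -- convex.
  · obtain ⟨xh, hxh, hmin⟩ := hS.X_compact.exists_isMinOn
      (f := fun u => S.F u + S.ρ / 2 * ‖u - xk‖ ^ 2 +
        (S.al (S.β k) yk zk u + S.ρ / 2 * ‖u - xk‖ ^ 2)) ⟨_, hI.x_mem⟩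
      ((hS.F_continuous.add (by fun_prop)).add (hal.continuousOn.add (by fun_prop)))
    have hmin' : ∀ u ∈ S.X, inner ℝ (0 : Vec d) (u - xh) ≤
        (S.F u + S.ρ / 2 * ‖u - xk‖ ^ 2 + (S.al (S.β k) yk zk u + S.ρ / 2 * ‖u - xk‖ ^ 2)) -
        (S.F xh + S.ρ / 2 * ‖xh - xk‖ ^ 2 +
          (S.al (S.β k) yk zk xh + S.ρ / 2 * ‖xh - xk‖ ^ 2)) := fun u hu => by
      rw [inner_zero_left, sub_nonneg]
      exact hmin hu
    have hPc := hS.F_add_quad_convex xk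
    refine ⟨xh, hxh, ?_, ⟨hxh, fun u hu => ?_⟩, ?_⟩
    · refine hI.new_multiplier_le hS hβ hxh hPc (fun u hu => ?_) (by simp) hmin'
      have h1 := hS.f_lipschitz hu hxh
      have h2 := hS.h_lipschitz hu hxh
      have h3 : (S.rh + S.Bf) * ‖u - xh‖ ≤ (S.rh + S.Bf) * S.D := by
        have := hS.rh_pos
        have := hS.Bf_nonneg
        have := hS.norm_sub_le_D u hu xh hxh
        gcongr
      have h4 : S.ρ / 2 * ‖u - xk‖ ^ 2 ≤ S.ρ / 2 * S.D ^ 2 := by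
        have := hS.norm_sub_le_D u hu xk hI.x_mem
        gcongr
      have h5 : 0 ≤ S.ρ / 2 * ‖xh - xk‖ ^ 2 := by positivity
      unfold F
      linarith
    · have hR := hasGradientAt_add (hal.grad xh hxh) (hasGradientAt_quad S.ρ xk xh)
      have h1 := inner_sub_grad_le hPc hxh hR hmin' hu
      set g := S.multGrad (S.yNew (S.β k) yk xh) (S.zNew (S.β k) zk xh) xh
      have h2 : -g - (2 * S.ρ) • (xh - xk) + S.ρ • xh =
          (0 - (g + S.ρ • (xh - xk))) + S.ρ • xk := by module
      rw [h2, inner_add_left, real_inner_smul_left, inner_sub_right xk, real_inner_comm u xk,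
        real_inner_comm xh xk]
      rw [norm_sub_sq_real u xk, norm_sub_sq_real xh xk] at h1
      linarith
    -- Growth of the exact problem at x̂ is tested at x^k, growth of the smoothed one at the new
    -- iterate is tested at x̂. The linearization errors cancel all squared distances to x^k except
    -- the one claimed; Young's inequality absorbs ζ.
    · have h1 := quad_growth (hPc.add (hal.convexOn hS.X_convex)) (c := S.ρ) (w := xk) (ζ := 0)
        hxh (fun u hu => by
          have := hmin' u hu
          simp only [Pi.add_apply]
          linarith) hI.x_mem
      have h2 := quad_growth ((hfc.add hS.h_convex).add (hal.convexOn hS.X_convex)) (c := S.ρ)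
        (w := xk) (ζ := ζ) hxn (fun u hu => by
          have := hζ' u hu
          simp only [Pi.add_apply]
          linarith) hxh
      simp only [Pi.add_apply, sub_self, norm_zero, inner_zero_left] at h1 h2
      have h3 := hS.fSmooth_le hν xk xh
      have h4 := hS.le_fSmooth hν xk xn
      have h5 := (abs_le.1 (abs_real_inner_le_norm ζ (xh - xn))).1
      have h6 : ‖ζ‖ * ‖xh - xn‖ ≤ r * ‖xh - xn‖ := by gcongr
      have h7 : r * ‖xh - xn‖ ≤ S.ρ / 2 * ‖xh - xn‖ ^ 2 + r ^ 2 / (2 * S.ρ) := by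
        have h8 : 0 ≤ (S.ρ * ‖xh - xn‖ - r) ^ 2 / (2 * S.ρ) := by positivity
        have h9 : (S.ρ * ‖xh - xn‖ - r) ^ 2 / (2 * S.ρ) =
            S.ρ / 2 * ‖xh - xn‖ ^ 2 + r ^ 2 / (2 * S.ρ) - r * ‖xh - xn‖ := by
          field_simp
          ring
        linarith
      unfold F at *
      linarith

/-! #### Constants -/

/-- This is all that is needed of the explicit constant C_p. -/
theorem four_mul_Bp_le : 4 * S.Bp + 2 ≤ S.Cp := by
  unfold Cp CpHat
  have := Real.sqrt_nonneg ((ENNReal.ofReal S.Q / S.gMin).toReal ^ 2 +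
    S.Q ^ 2 * ‖pinv (isHermitian_mul_transpose S.A) * S.A‖ ^ 2 * S.C1 ^ 2)
  linarith

theorem C4_ge : 3 / 2 ≤ S.C4 := le_max_left _ _

theorem C4_pos : 0 < S.C4 := lt_of_lt_of_le (by norm_num) C4_ge

theorem Assumptions.ρ_mul_C4_ge (hS : S.Assumptions) : 3 / 4 ≤ S.ρ * S.C4 := by
  have hρ := hS.ρ_pos
  have h : 3 / (4 * S.ρ) ≤ S.C4 := by
    unfold C4
    repeat' first | exact le_rfl | refine le_max_of_le_right ?_
  rw [div_le_iff₀ (by positivity)] at h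
  linarith

theorem Assumptions.C5_pos (hS : S.Assumptions) : 0 < S.C5 := by
  have := S.four_mul_Bp_le
  have := S.Bp_nonneg
  have hCp : 0 < S.Cp := by linarith
  have := hS.β0_pos
  exact lt_max_of_lt_left (by positivity)

/-- The budget for the total decrease: the range of F, 12B_p v₀/β₀ for dual steps, 4B_p²/β₀ for
penalty increases and B_p²/β₀ for the two end values; 14/β₀ gives positivity. -/
theorem Assumptions.Cx_ge (hS : S.Assumptions) :
    2 * sSup ((fun x => |S.F x|) '' S.X) + 12 * S.Bp * (S.v0 / S.β0) + 5 * S.Bp ^ 2 / S.β0 +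
      14 / S.β0 ≤ S.Cx := by
  have h1 := S.four_mul_Bp_le
  have h2 := S.Bp_nonneg
  have hβ := hS.β0_pos
  have hv := hS.v0_pos
  have h3 : 12 * S.Bp * (S.v0 / S.β0) ≤ (10 * S.Cp + 4 * S.Bp) * (S.v0 / S.β0) := by
    gcongr
    linarith
  have h4 : 5 * S.Bp ^ 2 / S.β0 + 14 / S.β0 ≤
      1 / (4 * S.β0) * (14 * S.Cp ^ 2 + 8 * S.Bp * S.Cp + 7 * S.Bp ^ 2) := by
    rw [← add_div, div_mul_eq_mul_div, one_mul, div_le_div_iff₀ hβ (by positivity)]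
    have h5 : 0 ≤ S.Bp * S.Cp := mul_nonneg h2 (by linarith)
    have h6 : 16 * S.Bp ^ 2 + 4 ≤ S.Cp ^ 2 := by nlinarith
    have h7 : 4 * (5 * S.Bp ^ 2 + 14) ≤ 14 * S.Cp ^ 2 + 8 * S.Bp * S.Cp + 7 * S.Bp ^ 2 := by
      nlinarith
    nlinarith
  have h8 : 0 ≤ S.β0 / 2 * (‖S.Amul S.x0 - S.b‖ ^ 2 +
      ∑ i, (max (S.g i S.x0 + S.z0 i / S.β0) 0) ^ 2) := by positivity
  have h9 := abs_nonneg (inner ℝ S.y0 (S.Amul S.x0 - S.b))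
  unfold Cx
  linarith

theorem Assumptions.abs_F_le (hS : S.Assumptions) {x : Vec d} (hx : x ∈ S.X) :
    |S.F x| ≤ sSup ((fun x => |S.F x|) '' S.X) :=
  le_csSup (hS.X_compact.image_of_continuousOn hS.F_continuous.abs).bddAbove
    (Set.mem_image_of_mem _ hx)

theorem Assumptions.Cx_pos (hS : S.Assumptions) : 0 < S.Cx := by
  have h1 := hS.Cx_ge
  have h2 := (abs_nonneg _).trans (hS.abs_F_le hS.x0_mem)
  have h3 := S.Bp_nonneg
  have hβ := hS.β0_pos
  have hv := hS.v0_pos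
  have h4 : 0 ≤ 12 * S.Bp * (S.v0 / S.β0) + 5 * S.Bp ^ 2 / S.β0 := by positivity
  have h5 : 0 < 14 / S.β0 := by positivity
  linarith

theorem Assumptions.ν_pos (hS : S.Assumptions) {ε : ℝ} (hε : 0 < ε) : 0 < S.ν ε := by
  have := hS.ρ_pos
  have := hS.Ml_pos
  have := S.C4_pos
  exact lt_min one_pos (by positivity)

theorem Assumptions.εk_pos (hS : S.Assumptions) {ε : ℝ} (hε : 0 < ε) (k : ℕ) : 0 < S.εk ε k := by
  have := hS.ρ_pos
  have := hS.β_pos k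
  have := S.C4_pos
  exact lt_min (by positivity) (lt_min (Real.sqrt_pos.2 (by positivity)) one_pos)

theorem εk_le_one (ε : ℝ) (k : ℕ) : S.εk ε k ≤ 1 :=
  (min_le_right _ _).trans (min_le_right _ _)

/-! #### Runs of the method -/

theorem Inv.next {x xn : Vec d} {y yn : Vec n} {z zn : Vec m} (hI : S.Inv x y z)
    (hS : S.Assumptions) {ε γd L0 : ℝ} (hε : 0 < ε) {k N : ℕ} {w : Vec d}
    (hout : APGOutputs S.X (S.fHat (S.ν ε) k x y z) (S.hHat x) S.ρ 2 γd (S.εk ε k) L0 w N xn)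
    (hy : yn = y + S.α k xn • (S.Amul xn - S.b))
    (hz : ∀ i, zn i = z i + S.α k xn * max (-(z i) / S.β k) (S.g i xn)) : S.Inv xn yn zn := by
  obtain ⟨σ, -, -, -, -, hd, hx⟩ := hout
  rw [← hx] at hd
  obtain ⟨h1, h2, -⟩ := hI.outer_step hS (hS.ν_pos hε) (hS.εk_pos hε k).le (S.εk_le_one ε k) hd
  exact hI.dual_step hS (hS.β_pos k) (hS.α_nonneg k xn) (S.α_le k xn) h1 h2 hy hz

theorem IsRun.inv {ε γd : ℝ} {L0 : ℕ → ℝ} {w : ℕ → Vec d → Vec d} {R : Run d n m}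
    (hR : S.IsRun ε γd L0 w R) (hS : S.Assumptions) (hε : 0 < ε) (k : ℕ) :
    S.Inv (R.x k) (R.y k) (R.z k) := by
  induction k with
  | zero => rw [hR.x_zero, hR.y_zero, hR.z_zero]; exact hS.inv_init
  | succ k ih => exact ih.next hS hε (hR.x_succ k) (hR.y_succ k) (hR.z_succ k)

/-- The decrease of the augmented Lagrangian in the `k`-th iteration. -/
noncomputable def decrease (S : Setting d n m p) (R : Run d n m) (k : ℕ) : ℝ :=
  (S.F (R.x k) + S.al (S.β k) (R.y k) (R.z k) (R.x k)) -
    (S.F (R.x (k + 1)) + S.al (S.β k) (R.y k) (R.z k) (R.x (k + 1)))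

/-- The window starts at a + 1 ≥ 1, where the iterate solves a subproblem approximately and its
augmented Lagrangian term is at most B_p²/(2β₀). Hence the bound is uniform in a. -/
theorem IsRun.sum_decrease_le {ε γd : ℝ} {L0 : ℕ → ℝ} {w : ℕ → Vec d → Vec d} {R : Run d n m}
    (hR : S.IsRun ε γd L0 w R) (hS : S.Assumptions) (hε : 0 < ε) (a N : ℕ) :
    ∑ j ∈ Finset.range N, S.decrease R (a + 1 + j) ≤ S.Cx := by
  have hI := hR.inv hS hε
  have hnew : ∀ k, ‖S.yNew (S.β k) (R.y k) (R.x (k + 1))‖ ^ 2 +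
      ‖S.zNew (S.β k) (R.z k) (R.x (k + 1))‖ ^ 2 ≤ S.Bp ^ 2 := fun k => by
    obtain ⟨σ, -, -, -, -, hd, hx⟩ := hR.x_succ k
    rw [← hx] at hd
    exact ((hI k).outer_step hS (hS.ν_pos hε) (hS.εk_pos hε k).le (S.εk_le_one ε k) hd).2.1
  have hB := S.Bp_nonneg
  set e : ℕ → ℝ := fun k =>
    3 * S.Bp * (S.v k / S.β k) + 2 * S.Bp ^ 2 * ((S.β (k + 1) - S.β k) / S.β k ^ 2) with he
  have he0 : ∀ k, 0 ≤ e k := fun k => by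
    have h1 := hS.β_pos k
    have h2 := hS.v_pos k
    have h3 := sub_nonneg.2 (hS.β_mono (Nat.le_succ k))
    have h4 : 0 ≤ (S.β (k + 1) - S.β k) / S.β k ^ 2 := div_nonneg h3 (by positivity)
    simp only [he]
    positivity
  have hstep : ∀ k, S.al (S.β (k + 1)) (R.y (k + 1)) (R.z (k + 1)) (R.x (k + 1)) ≤
      S.al (S.β k) (R.y k) (R.z k) (R.x (k + 1)) + e k := by
    intro k
    have hβ := hS.β_pos k
    have h1 := (hI k).al_dual_step_le (hI (k + 1)) hβ (hS.α_nonneg k (R.x (k + 1)))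
      (hS.α_mul_le k (R.x (k + 1))) (hnew k) (hR.y_succ k) (hR.z_succ k)
    have h2 := S.al_penalty_step_le hβ (hS.β_mono (Nat.le_succ k)) (R.y (k + 1))
      (hI (k + 1)).z_nonneg (R.x (k + 1))
    have h3 := (hI k).infeas_le hβ (hnew k)
    have h4 : S.infeasSq (R.x (k + 1)) ≤ (2 * S.Bp / S.β k) ^ 2 :=
      (Real.sqrt_le_left (by positivity)).1 h3
    have h5 := sub_nonneg.2 (hS.β_mono (Nat.le_succ k))
    have h6 : (S.β (k + 1) - S.β k) / 2 * S.infeasSq (R.x (k + 1)) ≤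
        (S.β (k + 1) - S.β k) / 2 * (2 * S.Bp / S.β k) ^ 2 := by gcongr
    have h7 : (S.β (k + 1) - S.β k) / 2 * (2 * S.Bp / S.β k) ^ 2 =
        2 * S.Bp ^ 2 * ((S.β (k + 1) - S.β k) / S.β k ^ 2) := by
      field_simp
    simp only [he]
    linarith
  have hβ0 := hS.β0_pos
  have hq : ∀ k, S.Bp ^ 2 / (2 * S.β k) ≤ S.Bp ^ 2 / (2 * S.β0) := fun k => by
    have := hS.β0_le k
    gcongr
  have htel : ∀ N, ∑ j ∈ Finset.range N, S.decrease R (a + 1 + j) ≤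
      S.F (R.x (a + 1)) + S.Bp ^ 2 / (2 * S.β0) - (S.F (R.x (a + 1 + N)) +
        S.al (S.β (a + 1 + N)) (R.y (a + 1 + N)) (R.z (a + 1 + N)) (R.x (a + 1 + N))) +
        ∑ k ∈ Finset.range (a + 1 + N), e k := by
    intro N
    induction N with
    | zero =>
      have h1 := hstep a
      have h2 := al_le (hS.β_pos a) (hnew a)
      have h3 := hq a
      have h4 : e a ≤ ∑ k ∈ Finset.range (a + 1), e k :=
        Finset.single_le_sum (fun k _ => he0 k) (Finset.self_mem_range_succ a)
      simp only [Finset.range_zero, Finset.sum_empty, add_zero]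
      linarith
    | succ N ih =>
      rw [Finset.sum_range_succ, ← add_assoc, Finset.sum_range_succ]
      have h1 := hstep (a + 1 + N)
      unfold decrease at *
      linarith
  have hsum : ∑ k ∈ Finset.range (a + 1 + N), e k ≤
      12 * S.Bp * (S.v0 / S.β0) + 4 * S.Bp ^ 2 / S.β0 := by
    simp only [he]
    rw [Finset.sum_add_distrib, ← Finset.mul_sum, ← Finset.mul_sum]
    have h1 := mul_le_mul_of_nonneg_left (hS.sum_v_div_β_le (a + 1 + N))
      (by positivity : 0 ≤ 3 * S.Bp)
    have h2 := mul_le_mul_of_nonneg_left (hS.sum_β_diff_le (a + 1 + N))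
      (by positivity : 0 ≤ 2 * S.Bp ^ 2)
    have h3 : 3 * S.Bp * (4 * (S.v0 / S.β0)) + 2 * S.Bp ^ 2 * (2 / S.β0) =
        12 * S.Bp * (S.v0 / S.β0) + 4 * S.Bp ^ 2 / S.β0 := by ring
    linarith
  have h1 := htel N
  have h2 := (hI (a + 1 + N)).neg_le_al (hS.β_pos (a + 1 + N)) (R.x (a + 1 + N))
  have h3 := hq (a + 1 + N)
  have h4 := (abs_le.1 (hS.abs_F_le (hI (a + 1)).x_mem)).2
  have h5 := (abs_le.1 (hS.abs_F_le (hI (a + 1 + N)).x_mem)).1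
  have h6 := hS.Cx_ge
  have h7 : S.Bp ^ 2 / (2 * S.β0) + S.Bp ^ 2 / (2 * S.β0) + 4 * S.Bp ^ 2 / S.β0 =
      5 * S.Bp ^ 2 / S.β0 := by
    field_simp
    ring
  have h8 : 0 ≤ 14 / S.β0 := by positivity
  linarith

/-- Within the first `K` iterations a near `ε`-KKT point is found. -/
theorem IsRun.exists_isNearKKT {ε γd : ℝ} {L0 : ℕ → ℝ} {w : ℕ → Vec d → Vec d} {R : Run d n m}
    (hR : S.IsRun ε γd L0 w R) (hS : S.Assumptions) (hε : 0 < ε) :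
    ∃ k ≤ S.K ε, S.IsNearKKT ε (R.x k) := by
  have hI := hR.inv hS hε
  have hρ := hS.ρ_pos
  have hC4 := S.C4_pos
  have hCx := hS.Cx_pos
  have hC5 := hS.C5_pos
  have hMl := hS.Ml_pos
  have hB := S.Bp_nonneg
  have hβ0 := hS.β0_pos
  set K1 := ⌈S.C5 / ε ^ 2⌉₊ with hK1
  set N := ⌈64 * S.ρ * S.Cx * S.C4 ^ 2 / ε ^ 2⌉₊ with hN
  have hK1pos : 0 < K1 := Nat.ceil_pos.2 (by positivity)
  have hNpos : 0 < N := Nat.ceil_pos.2 (by positivity)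
  obtain ⟨a, ha⟩ := Nat.exists_eq_add_of_le' hK1pos
  have hNle : 64 * S.ρ * S.Cx * S.C4 ^ 2 / ε ^ 2 ≤ N := Nat.le_ceil _
  -- Averaging over the N iterations from K1 on, where the penalty is already large: some decrease
  -- is at most C_x/N.
  obtain ⟨j, hj, hjle⟩ : ∃ j ∈ Finset.range N,
      S.decrease R (a + 1 + j) ≤ ε ^ 2 / (64 * S.ρ * S.C4 ^ 2) := by
    refine Finset.exists_le_of_sum_le (Finset.nonempty_range_iff.2 hNpos.ne') ?_
    refine (hR.sum_decrease_le hS hε a N).trans ?_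
    rw [Finset.sum_const, Finset.card_range, nsmul_eq_mul]
    rw [div_le_iff₀ (by positivity)] at hNle
    rw [mul_div_assoc', le_div_iff₀ (by positivity)]
    linarith
  set k := a + 1 + j with hk
  have hkK : k ≤ S.K ε := by
    have := Finset.mem_range.1 hj
    unfold K
    omega
  have hβ := hS.β_pos k
  obtain ⟨σ, -, -, -, -, hd, hx⟩ := hR.x_succ k
  rw [← hx] at hd
  obtain ⟨-, -, xh, hxh, hnew, hsub, hdist⟩ :=
    (hI k).outer_step hS (hS.ν_pos hε) (hS.εk_pos hε k).le (S.εk_le_one ε k) hd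
  -- the distance to the nearby point
  have hν : S.ν ε * S.Ml ^ 2 / 2 ≤ ε ^ 2 / (128 * S.ρ * S.C4 ^ 2) := by
    have h1 : S.ν ε ≤ ε ^ 2 / (64 * S.C4 ^ 2 * S.ρ * S.Ml ^ 2) := min_le_right _ _
    calc S.ν ε * S.Ml ^ 2 / 2 ≤ ε ^ 2 / (64 * S.C4 ^ 2 * S.ρ * S.Ml ^ 2) * S.Ml ^ 2 / 2 := by
          gcongr
      _ = _ := by field_simp; norm_num
  have hεk : S.εk ε k ^ 2 / (2 * S.ρ) ≤ ε ^ 2 / (512 * S.ρ * S.C4 ^ 2) := by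
    have h1 : S.εk ε k ≤ ε / (16 * S.C4) := min_le_left _ _
    have h0 := (hS.εk_pos hε k).le
    calc S.εk ε k ^ 2 / (2 * S.ρ) ≤ (ε / (16 * S.C4)) ^ 2 / (2 * S.ρ) := by gcongr
      _ = _ := by field_simp; norm_num
  have hclose : S.ρ * S.C4 * ‖R.x k - xh‖ ≤ ε / 4 := by
    refine le_of_sq_le_sq ?_ (by positivity)
    -- Decrease, smoothing and inexactness add to 1/64 + 1/128 + 1/512 = 13/512, and 2 · 13/512 <
    -- (1/4)².
    have h1 : S.ρ / 2 * ‖R.x k - xh‖ ^ 2 ≤ 13 * ε ^ 2 / (512 * S.ρ * S.C4 ^ 2) := by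
      have e1 : 13 * ε ^ 2 / (512 * S.ρ * S.C4 ^ 2) = ε ^ 2 / (64 * S.ρ * S.C4 ^ 2) +
          ε ^ 2 / (128 * S.ρ * S.C4 ^ 2) + ε ^ 2 / (512 * S.ρ * S.C4 ^ 2) := by
        field_simp
        norm_num
      unfold decrease at hjle
      rw [e1]
      linarith
    rw [le_div_iff₀ (by positivity)] at h1
    nlinarith [sq_nonneg ε]
  have hC4' := S.C4_ge
  have hρC4 := hS.ρ_mul_C4_ge
  have hn0 := norm_nonneg (R.x k - xh)
  -- Since k ≥ K1, ε²β_k² ≥ C₅β₀². This is used with t = B_p for feasibility and t = B_p² for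
  -- complementarity, one for each entry of C₅.
  have hkβ : ∀ t : ℝ, 0 ≤ t → 4 * t ^ 2 / S.β0 ^ 2 ≤ S.C5 → 2 * t ≤ ε * S.β k := by
    intro t ht hle
    refine le_of_sq_le_sq ?_ (by positivity)
    have h1 : S.C5 / ε ^ 2 ≤ (k : ℝ) + 1 := by
      have h2 : S.C5 / ε ^ 2 ≤ K1 := Nat.le_ceil _
      have h3 : (K1 : ℝ) ≤ k := by exact_mod_cast (by omega : K1 ≤ k)
      linarith
    have h4 : S.β k ^ 2 = S.β0 ^ 2 * (k + 1) := by
      unfold β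
      rw [mul_pow, Real.sq_sqrt (by positivity)]
    rw [div_le_iff₀ (by positivity)] at h1
    rw [div_le_iff₀ (by positivity)] at hle
    rw [mul_pow, mul_pow, h4]
    have h5 : S.C5 * S.β0 ^ 2 ≤ ((k : ℝ) + 1) * ε ^ 2 * S.β0 ^ 2 := by gcongr
    linarith
  have hCp := S.four_mul_Bp_le
  refine ⟨k, hkK, xh, ⟨hxh, S.yNew (S.β k) (R.y k) xh, S.zNew (S.β k) (R.z k) xh,
    S.zNew_nonneg _ _ _, ?_, ?_, ?_⟩, ?_⟩
  · refine distZeroLE_of_mem (Set.mem_image_of_mem _ hsub) ?_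
    have h1 : -S.multGrad (S.yNew (S.β k) (R.y k) xh) (S.zNew (S.β k) (R.z k) xh) xh -
        (2 * S.ρ) • (xh - R.x k) + ∑ i, S.zNew (S.β k) (R.z k) xh i • gradient (S.g i) xh +
        S.ATmul (S.yNew (S.β k) (R.y k) xh) = -((2 * S.ρ) • (xh - R.x k)) := by
      unfold multGrad
      abel
    rw [h1, norm_neg, norm_smul, Real.norm_of_nonneg (by positivity), norm_sub_rev]
    have h2 : 3 / 2 * (S.ρ * ‖R.x k - xh‖) ≤ S.C4 * (S.ρ * ‖R.x k - xh‖) := by gcongr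
    linarith
  · refine ((hI k).infeas_le hβ hnew).trans ?_
    rw [div_le_iff₀ hβ]
    exact hkβ S.Bp hB ((div_le_div_of_nonneg_right (by nlinarith) (by positivity)).trans
      (le_max_left _ _))
  · refine ((hI k).compl_le hβ hnew).trans ?_
    rw [div_le_iff₀ hβ]
    refine hkβ (S.Bp ^ 2) (by positivity)
      (le_trans ?_ (le_max_right _ _))
    gcongr
    nlinarith [sq_nonneg S.Cp]
  · have h2 : 3 / 4 * ‖R.x k - xh‖ ≤ S.ρ * S.C4 * ‖R.x k - xh‖ := by gcongr
    linarith

end Setting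

/-! ### Existence of runs and the total step count -/

namespace Setting

variable {d n m p : ℕ} {S : Setting d n m p}

theorem Assumptions.exists_isRun (hS : S.Assumptions) {ε γd : ℝ} (hε : 0 < ε) (hγ : 2 ≤ γd)
    {L0 : ℕ → ℝ} (hL0 : ∀ k, 0 < L0 k ∧ L0 k ≤ S.Lhat ε k) {w : ℕ → Vec d → Vec d}
    (hw : ∀ k, ∀ x ∈ S.X, w k x ∈ S.X) : ∃ R : Run d n m, S.IsRun ε γd L0 w R := by
  -- The smoothness constant of a subproblem relies on the multiplier bound, so the recursion runs
  -- on triples that carry the invariant.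
  have hex : ∀ (k : ℕ) (s : {q : Vec d × Vec n × Vec m // S.Inv q.1 q.2.1 q.2.2}),
      ∃ (N : ℕ) (xn : Vec d), APGOutputs S.X (S.fHat (S.ν ε) k s.1.1 s.1.2.1 s.1.2.2)
        (S.hHat s.1.1) S.ρ 2 γd (S.εk ε k) (L0 k) (w k s.1.1) N xn := by
    rintro k ⟨⟨x, y, z⟩, hI⟩
    obtain ⟨G, hG⟩ := hS.exists_smooth_fHat (hS.ν_pos hε) k hI.x_mem y hI.z_nonneg hI.norm_z_le
    exact exists_apgOutputs (hS.εk_pos hε k) hγ hS.ρ_pos hS.X_compact hS.X_convex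
      (hS.hHat_continuousOn x) (hS.hHat_convex x) hG hS.norm_sub_le_D (hw k x hI.x_mem)
      (hL0 k).1 (hL0 k).2
  choose T xn hT using hex
  let next : ℕ → {q : Vec d × Vec n × Vec m // S.Inv q.1 q.2.1 q.2.2} →
      {q : Vec d × Vec n × Vec m // S.Inv q.1 q.2.1 q.2.2} := fun k s =>
    ⟨(xn k s, s.1.2.1 + S.α k (xn k s) • (S.Amul (xn k s) - S.b),
      WithLp.toLp 2 fun i => s.1.2.2 i +
        S.α k (xn k s) * max (-(s.1.2.2 i) / S.β k) (S.g i (xn k s))),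
      s.2.next hS hε (hT k s) rfl fun _ => rfl⟩
  let σ : ℕ → {q : Vec d × Vec n × Vec m // S.Inv q.1 q.2.1 q.2.2} := fun k =>
    Nat.rec ⟨(S.x0, S.y0, S.z0), hS.inv_init⟩ next k
  exact ⟨⟨fun k => (σ k).1.1, fun k => (σ k).1.2.1, fun k => (σ k).1.2.2, fun k => T k (σ k)⟩,
    rfl, rfl, rfl, fun k => hT k (σ k), fun _ => rfl, fun _ _ => rfl⟩

/-! #### The total number of proximal-gradient steps -/

theorem Assumptions.sqrt_mul_Lg_mul_Bp_nonneg (hS : S.Assumptions) :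
    0 ≤ Real.sqrt m * S.Lg * S.Bp := by
  rcases Nat.eq_zero_or_pos m with rfl | hm
  · simp
  · have := hS.Lg_nonneg ⟨0, hm⟩
    have := S.Bp_nonneg
    positivity

theorem Assumptions.C6_nonneg (hS : S.Assumptions) {ε : ℝ} (hε : 0 < ε) : 0 ≤ S.C6 ε := by
  have := hS.ν_pos hε
  exact add_nonneg (by positivity) hS.sqrt_mul_Lg_mul_Bp_nonneg

theorem Assumptions.C2_nonneg (hS : S.Assumptions) : 0 ≤ S.C2 := by
  refine add_nonneg (norm_nonneg _) ?_
  rcases Nat.eq_zero_or_pos m with rfl | hm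
  · simp
  · have := hS.Lg_nonneg ⟨0, hm⟩
    have := hS.Bg_pos
    positivity

theorem max_zero_log_mono {a b : ℝ} (ha : 0 ≤ a) (hab : a ≤ b) :
    max 0 (Real.log a) ≤ max 0 (Real.log b) := by
  rcases ha.eq_or_lt with rfl | ha
  · simp
  · exact max_le_max le_rfl (Real.log_le_log ha hab)

theorem Assumptions.εk_antitone (hS : S.Assumptions) (ε : ℝ) : Antitone (S.εk ε) := by
  intro i j hij
  have := hS.β_pos i
  have := hS.β_mono hij
  have := hS.ρ_pos
  unfold εk
  gcongr

theorem IsRun.total_le {ε γd : ℝ} {L0 : ℕ → ℝ} {w : ℕ → Vec d → Vec d} {R : Run d n m}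
    (hR : S.IsRun ε γd L0 w R) (hS : S.Assumptions) (hε : 0 < ε) (hγ : 2 ≤ γd)
    (hL0 : ∀ k, 0 < L0 k ∧ L0 k ≤ S.Lhat ε k) (hw : ∀ k, ∀ x ∈ S.X, w k x ∈ S.X) :
    ((∑ k ∈ Finset.range (S.K ε), R.T k : ℕ) : ℝ) ≤ S.totalBound ε := by
  have hI := hR.inv hS hε
  have hC6 := hS.C6_nonneg hε
  have hC2 := hS.C2_nonneg
  have hβ0 := hS.β0_pos
  have hρ := hS.ρ_pos
  have hD := hS.D_nonneg
  have hlog2 : 0 < Real.log 2 := Real.log_pos one_lt_two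
  have hterm : ∀ k ∈ Finset.range (S.K ε), (R.T k : ℝ) ≤
      2 + (2 * Real.sqrt (S.C6 ε / S.ρ) +
        2 * Real.sqrt (Real.sqrt (S.K ε) * S.β0 * S.C2 / S.ρ) + 1 / Real.log 2) *
      max 0 (Real.log (9 * (S.εk ε (S.K ε))⁻¹ * S.D * Real.sqrt (1 / S.ρ) *
        (S.C6 ε + Real.sqrt (S.K ε) * S.β0 * S.C2) ^ (3 / 2 : ℝ))) := by
    intro k hk
    have hkK := Finset.mem_range.1 hk
    obtain ⟨G, hG⟩ := hS.exists_smooth_fHat (hS.ν_pos hε) k (hI k).x_mem (R.y k)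
      (hI k).z_nonneg (hI k).norm_z_le
    have h1 := apg_iterations_le (hS.εk_pos hε k) hγ hρ hS.X_compact hS.X_convex
      (hS.hHat_continuousOn (R.x k)) (hS.hHat_convex (R.x k)) hG hS.norm_sub_le_D
      (hw k _ (hI k).x_mem) (hL0 k).1 (hL0 k).2 (hR.x_succ k)
    have hLpos : 0 < S.Lhat ε k := (hL0 k).1.trans_le (hL0 k).2
    -- Here k < K, so k + 1 ≤ K, and the bound involves √K rather than √(K + 1).
    have hsq : Real.sqrt ((k : ℝ) + 1) ≤ Real.sqrt (S.K ε) :=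
      Real.sqrt_le_sqrt (by exact_mod_cast hkK)
    have hL : S.Lhat ε k ≤ S.C6 ε + Real.sqrt (S.K ε) * S.β0 * S.C2 := by
      unfold Lhat
      gcongr
    have hεK := hS.εk_pos hε (S.K ε)
    have hεle := hS.εk_antitone ε hkK.le
    have hεk := hS.εk_pos hε k
    refine h1.trans ?_
    have h2 : Real.sqrt (S.Lhat ε k / S.ρ) ≤ Real.sqrt (S.C6 ε / S.ρ) +
        Real.sqrt (Real.sqrt (S.K ε) * S.β0 * S.C2 / S.ρ) := by
      refine (Real.sqrt_le_sqrt (div_le_div_of_nonneg_right hL hρ.le)).trans ?_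
      rw [add_div, Real.sqrt_le_left (by positivity), add_sq, Real.sq_sqrt (by positivity),
        Real.sq_sqrt (by positivity)]
      have : 0 ≤ 2 * Real.sqrt (S.C6 ε / S.ρ) *
        Real.sqrt (Real.sqrt (S.K ε) * S.β0 * S.C2 / S.ρ) := by positivity
      linarith
    have h3 := max_zero_log_mono
      (a := 9 * (S.εk ε k)⁻¹ * S.D * Real.sqrt (1 / S.ρ) * S.Lhat ε k ^ (3 / 2 : ℝ))
      (b := 9 * (S.εk ε (S.K ε))⁻¹ * S.D * Real.sqrt (1 / S.ρ) *
        (S.C6 ε + Real.sqrt (S.K ε) * S.β0 * S.C2) ^ (3 / 2 : ℝ))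
      (by positivity) (by gcongr)
    gcongr
    linarith
  push_cast
  refine (Finset.sum_le_sum hterm).trans_eq ?_
  rw [Finset.sum_const, Finset.card_range, nsmul_eq_mul, totalBound]
  ring

/-! #### The order of the bound -/

theorem Assumptions.exists_K_le (hS : S.Assumptions) :
    ∃ c : ℝ, 1 ≤ c ∧ ∀ ε : ℝ, 0 < ε → ε ≤ 1 → (S.K ε : ℝ) + 1 ≤ c * ε⁻¹ ^ 2 := by
  have hρ := hS.ρ_pos
  have hC4 := S.C4_pos
  have hCx := hS.Cx_pos
  have hC5 := hS.C5_pos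
  refine ⟨S.C5 + 64 * S.ρ * S.Cx * S.C4 ^ 2 + 3, ?_, fun ε hε hε1 => ?_⟩
  · have : 0 < 64 * S.ρ * S.Cx * S.C4 ^ 2 := by positivity
    linarith
  · have h1 := (Nat.ceil_lt_add_one (by positivity : 0 ≤ S.C5 / ε ^ 2)).le
    have h2 := (Nat.ceil_lt_add_one
      (by positivity : 0 ≤ 64 * S.ρ * S.Cx * S.C4 ^ 2 / ε ^ 2)).le
    have h3 : 1 ≤ ε⁻¹ ^ 2 := one_le_pow₀ ((one_le_inv₀ hε).2 hε1)
    have e1 : S.C5 / ε ^ 2 = S.C5 * ε⁻¹ ^ 2 := by rw [div_eq_mul_inv, inv_pow]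
    have e2 : 64 * S.ρ * S.Cx * S.C4 ^ 2 / ε ^ 2 = 64 * S.ρ * S.Cx * S.C4 ^ 2 * ε⁻¹ ^ 2 := by
      rw [div_eq_mul_inv, inv_pow]
    unfold K
    push_cast
    linarith

theorem Assumptions.exists_C6_le (hS : S.Assumptions) :
    ∃ c : ℝ, 0 ≤ c ∧ ∀ ε : ℝ, 0 < ε → ε ≤ 1 → S.C6 ε ≤ c * ε⁻¹ ^ 2 := by
  have hρ := hS.ρ_pos
  have hC4 := S.C4_pos
  have hMl := hS.Ml_pos
  have h0 := hS.sqrt_mul_Lg_mul_Bp_nonneg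
  set q := min 1 (1 / (64 * S.C4 ^ 2 * S.ρ * S.Ml ^ 2)) with hq
  have hqpos : 0 < q := lt_min one_pos (by positivity)
  refine ⟨S.normDc ^ 2 / q + Real.sqrt m * S.Lg * S.Bp, by positivity, fun ε hε hε1 => ?_⟩
  have h1 : q * ε ^ 2 ≤ S.ν ε := by
    refine le_min ?_ ?_
    · calc q * ε ^ 2 ≤ 1 * 1 ^ 2 := by
            gcongr
            exact min_le_left _ _
        _ = 1 := by norm_num
    · calc q * ε ^ 2 ≤ 1 / (64 * S.C4 ^ 2 * S.ρ * S.Ml ^ 2) * ε ^ 2 := by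
            gcongr
            exact min_le_right _ _
        _ = _ := by ring
  have h2 : S.normDc ^ 2 / S.ν ε ≤ S.normDc ^ 2 / (q * ε ^ 2) := by gcongr
  have h3 : S.normDc ^ 2 / (q * ε ^ 2) = S.normDc ^ 2 / q * ε⁻¹ ^ 2 := by
    rw [← div_div, inv_pow]
    rfl
  have h4 : 1 ≤ ε⁻¹ ^ 2 := one_le_pow₀ ((one_le_inv₀ hε).2 hε1)
  unfold C6
  nlinarith

/-- As β_K = O(ε⁻¹), the entry √(ρ/(2β_K)) is only of order √ε, so ε/(16C₄) sets the order. -/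
theorem Assumptions.exists_inv_εk_le (hS : S.Assumptions) :
    ∃ c : ℝ, 0 ≤ c ∧ ∀ ε : ℝ, 0 < ε → ε ≤ 1 → (S.εk ε (S.K ε))⁻¹ ≤ c * ε⁻¹ := by
  have hρ := hS.ρ_pos
  have hC4 := S.C4_pos
  have hβ0 := hS.β0_pos
  obtain ⟨cK, hcK, hK⟩ := hS.exists_K_le
  set q := min (1 / (16 * S.C4)) (min (Real.sqrt (S.ρ / (2 * (S.β0 * Real.sqrt cK)))) 1) with hq
  have hcK0 : 0 < Real.sqrt cK := Real.sqrt_pos.2 (by linarith)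
  have hqpos : 0 < q :=
    lt_min (by positivity) (lt_min (Real.sqrt_pos.2 (by positivity)) one_pos)
  refine ⟨q⁻¹, by positivity, fun ε hε hε1 => ?_⟩
  rw [← mul_inv]
  refine inv_anti₀ (by positivity) (le_min ?_ (le_min ?_ ?_))
  · calc q * ε ≤ 1 / (16 * S.C4) * ε := by
          gcongr
          exact min_le_left _ _
      _ = _ := by ring
  · have h1 : S.β (S.K ε) ≤ S.β0 * Real.sqrt cK * ε⁻¹ := by
      have h2 : Real.sqrt ((S.K ε : ℝ) + 1) ≤ Real.sqrt cK * ε⁻¹ := by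
        refine (Real.sqrt_le_sqrt (hK ε hε hε1)).trans_eq ?_
        rw [Real.sqrt_mul (by linarith), Real.sqrt_sq (by positivity)]
      unfold β
      rw [mul_assoc]
      gcongr
    have hβK := hS.β_pos (S.K ε)
    calc q * ε ≤ Real.sqrt (S.ρ / (2 * (S.β0 * Real.sqrt cK))) * ε := by
          gcongr
          exact (min_le_right _ _).trans (min_le_left _ _)
      _ = Real.sqrt (S.ρ / (2 * (S.β0 * Real.sqrt cK)) * ε ^ 2) := by
          rw [Real.sqrt_mul (by positivity), Real.sqrt_sq hε.le]
      _ ≤ Real.sqrt (S.ρ / (2 * (S.β0 * Real.sqrt cK)) * ε) := by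
          refine Real.sqrt_le_sqrt (mul_le_mul_of_nonneg_left ?_ (by positivity))
          nlinarith
      _ = Real.sqrt (S.ρ / (2 * (S.β0 * Real.sqrt cK * ε⁻¹))) := by
          congr 1
          field_simp
      _ ≤ _ := by gcongr
  · calc q * ε ≤ 1 * 1 := by
          gcongr
          exact (min_le_right _ _).trans (min_le_right _ _)
      _ = 1 := one_mul 1

theorem Assumptions.totalBound_isBigO (hS : S.Assumptions) :
    (fun ε : ℝ => S.totalBound ε) =O[nhdsWithin 0 (Set.Ioi 0)]
      (fun ε : ℝ => ε⁻¹ ^ 3 * Real.log ε⁻¹) := by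
  have hρ := hS.ρ_pos
  have hβ0 := hS.β0_pos
  have hC2 := hS.C2_nonneg
  have hD := hS.D_nonneg
  have hlog2 : 0 < Real.log 2 := Real.log_pos one_lt_two
  obtain ⟨cK, hcK, hK⟩ := hS.exists_K_le
  obtain ⟨c6, hc6, h6⟩ := hS.exists_C6_le
  obtain ⟨cε, hcε, hεk⟩ := hS.exists_inv_εk_le
  set cL := c6 + Real.sqrt cK * S.β0 * S.C2 with hcL
  have hcL0 : 0 ≤ cL := by positivity
  set c7 := 2 * Real.sqrt (c6 / S.ρ) + 2 * Real.sqrt (Real.sqrt cK * S.β0 * S.C2 / S.ρ) +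
    1 / Real.log 2 with hc7
  have hc70 : 0 ≤ c7 := by positivity
  set c8 := 9 * cε * S.D * Real.sqrt (1 / S.ρ) * cL ^ (3 / 2 : ℝ) with hc8
  have hc80 : 0 ≤ c8 := by positivity
  have hlc8 : 0 ≤ Real.log (c8 + 1) := Real.log_nonneg (by linarith)
  refine Asymptotics.IsBigO.of_bound (2 * cK + cK * c7 * (Real.log (c8 + 1) + 4)) ?_
  -- Below e⁻¹ the factor log ε⁻¹ is at least 1 and absorbs all constants.
  filter_upwards [Ioo_mem_nhdsGT (Real.exp_pos (-1))] with ε hε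
  have hε0 : 0 < ε := hε.1
  have hε1 : ε ≤ 1 := hε.2.le.trans (Real.exp_le_one_iff.2 (by norm_num))
  have hlog : 1 ≤ Real.log ε⁻¹ := by
    rw [Real.log_inv]
    have := (Real.log_lt_iff_lt_exp hε0).2 hε.2
    linarith
  have hK' := hK ε hε0 hε1
  have h6' := h6 ε hε0 hε1
  have hεk' := hεk ε hε0 hε1
  have hC6 := hS.C6_nonneg hε0
  have hεK := hS.εk_pos hε0 (S.K ε)
  set s := ε⁻¹ with hs
  have hs1 : 1 ≤ s := (one_le_inv₀ hε0).2 hε1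
  have hs0 : 0 ≤ s := by linarith
  have hKle : (S.K ε : ℝ) ≤ cK * s ^ 2 := by linarith
  have hsqK : Real.sqrt (S.K ε) ≤ Real.sqrt cK * s := by
    refine (Real.sqrt_le_sqrt hKle).trans_eq ?_
    rw [Real.sqrt_mul (by linarith), Real.sqrt_sq hs0]
  have hss : s ≤ s ^ 2 := by nlinarith
  have hA : 2 * Real.sqrt (S.C6 ε / S.ρ) +
      2 * Real.sqrt (Real.sqrt (S.K ε) * S.β0 * S.C2 / S.ρ) + 1 / Real.log 2 ≤ c7 * s := by
    have h1 : Real.sqrt (S.C6 ε / S.ρ) ≤ Real.sqrt (c6 / S.ρ) * s := by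
      have : S.C6 ε / S.ρ ≤ c6 / S.ρ * s ^ 2 := by
        rw [div_mul_eq_mul_div]
        gcongr
      refine (Real.sqrt_le_sqrt this).trans_eq ?_
      rw [Real.sqrt_mul (by positivity), Real.sqrt_sq hs0]
    have h2 : Real.sqrt (Real.sqrt (S.K ε) * S.β0 * S.C2 / S.ρ) ≤
        Real.sqrt (Real.sqrt cK * S.β0 * S.C2 / S.ρ) * s := by
      have : Real.sqrt (S.K ε) * S.β0 * S.C2 / S.ρ ≤
          Real.sqrt cK * S.β0 * S.C2 / S.ρ * s ^ 2 := by
        calc _ ≤ (Real.sqrt cK * s ^ 2) * S.β0 * S.C2 / S.ρ := by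
              gcongr
              exact hsqK.trans (by gcongr)
          _ = _ := by ring
      refine (Real.sqrt_le_sqrt this).trans_eq ?_
      rw [Real.sqrt_mul (by positivity), Real.sqrt_sq hs0]
    have h3 : 1 / Real.log 2 ≤ 1 / Real.log 2 * s := le_mul_of_one_le_right (by positivity) hs1
    rw [hc7]
    linarith
  have hB : max 0 (Real.log (9 * (S.εk ε (S.K ε))⁻¹ * S.D * Real.sqrt (1 / S.ρ) *
      (S.C6 ε + Real.sqrt (S.K ε) * S.β0 * S.C2) ^ (3 / 2 : ℝ))) ≤
      (Real.log (c8 + 1) + 4) * Real.log s := by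
    have h1 : S.C6 ε + Real.sqrt (S.K ε) * S.β0 * S.C2 ≤ cL * s ^ 2 := by
      have : Real.sqrt (S.K ε) * S.β0 * S.C2 ≤ (Real.sqrt cK * s ^ 2) * S.β0 * S.C2 := by
        gcongr
        exact hsqK.trans (by gcongr)
      rw [hcL]
      linarith
    have h2 : (cL * s ^ 2) ^ (3 / 2 : ℝ) = cL ^ (3 / 2 : ℝ) * s ^ 3 := by
      rw [Real.mul_rpow hcL0 (by positivity), ← Real.rpow_natCast s 2, ← Real.rpow_mul hs0,
        ← Real.rpow_natCast s 3]
      norm_num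
    -- The accuracy contributes s and the smoothness constant (s²)^{3/2} = s³, hence the 4 in front
    -- of log s; c8 + 1 avoids the logarithm of 0.
    have h3 : 9 * (S.εk ε (S.K ε))⁻¹ * S.D * Real.sqrt (1 / S.ρ) *
        (S.C6 ε + Real.sqrt (S.K ε) * S.β0 * S.C2) ^ (3 / 2 : ℝ) ≤ (c8 + 1) * s ^ 4 := by
      calc _ ≤ 9 * (cε * s) * S.D * Real.sqrt (1 / S.ρ) * (cL * s ^ 2) ^ (3 / 2 : ℝ) := by
            gcongr
        _ = c8 * s ^ 4 := by rw [h2, hc8]; ring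
        _ ≤ _ := by gcongr; linarith
    refine (max_zero_log_mono (by positivity) h3).trans ?_
    rw [Real.log_mul (by positivity) (by positivity), Real.log_pow]
    refine max_le (by positivity) ?_
    push_cast
    nlinarith
  have hT : S.totalBound ε ≤ 2 * (cK * s ^ 2) +
      cK * s ^ 2 * (c7 * s) * ((Real.log (c8 + 1) + 4) * Real.log s) := by
    unfold totalBound
    have : 0 ≤ max 0 (Real.log (9 * (S.εk ε (S.K ε))⁻¹ * S.D * Real.sqrt (1 / S.ρ) *
      (S.C6 ε + Real.sqrt (S.K ε) * S.β0 * S.C2) ^ (3 / 2 : ℝ))) := le_max_left _ _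
    gcongr
  have hT0 : 0 ≤ S.totalBound ε := by
    unfold totalBound
    have : 0 ≤ max 0 (Real.log (9 * (S.εk ε (S.K ε))⁻¹ * S.D * Real.sqrt (1 / S.ρ) *
      (S.C6 ε + Real.sqrt (S.K ε) * S.β0 * S.C2) ^ (3 / 2 : ℝ))) := le_max_left _ _
    positivity
  rw [Real.norm_of_nonneg hT0, Real.norm_of_nonneg (by positivity)]
  refine hT.trans ?_
  have h9 : cK * s ^ 2 ≤ cK * (s ^ 3 * Real.log s) := by
    refine mul_le_mul_of_nonneg_left ?_ (by linarith)
    calc s ^ 2 ≤ s ^ 3 := pow_le_pow_right₀ hs1 (by norm_num)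
      _ ≤ s ^ 3 * Real.log s := le_mul_of_one_le_right (by positivity) hlog
  calc _ ≤ 2 * (cK * (s ^ 3 * Real.log s)) +
        cK * s ^ 2 * (c7 * s) * ((Real.log (c8 + 1) + 4) * Real.log s) := by linarith
    _ = _ := by ring

end Setting

end DPALM

theorem mainTheorem4 {d n m p : ℕ} (S : DPALM.Setting d n m p) (hS : S.Assumptions) :
    (∀ ε : ℝ, 0 < ε → ∀ γd : ℝ, 2 ≤ γd →
      ∀ L0 : ℕ → ℝ, (∀ k, 0 < L0 k ∧ L0 k ≤ S.Lhat ε k) →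
      ∀ w : ℕ → DPALM.Vec d → DPALM.Vec d, (∀ k, ∀ x ∈ S.X, w k x ∈ S.X) →
        (∃ R : DPALM.Run d n m, S.IsRun ε γd L0 w R) ∧
        ∀ R : DPALM.Run d n m, S.IsRun ε γd L0 w R →
          (∃ k ≤ S.K ε, S.IsNearKKT ε (R.x k)) ∧
          ((∑ k ∈ Finset.range (S.K ε), R.T k : ℕ) : ℝ) ≤ S.totalBound ε) ∧
    (fun ε : ℝ => S.totalBound ε) =O[nhdsWithin 0 (Set.Ioi 0)]
      (fun ε : ℝ => ε⁻¹ ^ 3 * Real.log ε⁻¹) := by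
  refine ⟨fun ε hε γd hγ L0 hL0 w hw => ⟨hS.exists_isRun hε hγ hL0 hw, fun R hR =>
    ⟨hR.exists_isNearKKT hS hε, hR.total_le hS hε hγ hL0 hw⟩⟩, hS.totalBound_isBigO⟩
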